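/- Let $(M,\mathcal F)$ be an $n$-dimensional Finsler manifold: $M$ is a $C^\infty$ manifold and $\mathcal F\colon TM\to[0,\infty)$ is continuous, positively $1$-homogeneous, $C^\infty$ on $TM\setminus\{0\}$, and $g_{x,y}(u,v)=\frac12\frac{\partial^2\mathcal F^2_x(y+su+tv)}{\partial s\,\partial t}\big|_{s=t=0}$ is positive definite for every $y\in T_xM\setminus\{0\}$. Let $G^i$ be its geodesic coefficients, $4G^i=g^{il}\bigl(2\frac{\partial g_{jl}}{\partial x^k}-\frac{\partial g_{jk}}{\partial x^l}\bigr)y^jy^k$, and $G^i_j=\partial G^i/\partial y^j$. A vector field $X(t)$ along a curve $c$ in $M$ is parallel if $\frac{dX^i}{dt}+G^i_j(c,X)\,\dot c^j=0$; parallel translation along $c$ maps $X(0)$ to $X(1)$ for parallel $X$. The horizontal lift of a vector field $X=X^i\frac{\partial}{\partial x^i}$ is $X^h=X^i\bigl(\frac{\partial}{\partial x^i}-G^k_i\frac{\partial}{\partial y^k}\bigr)$, and the curvature tensor is given by $R(X^h,Y^h)=[X^h,Y^h]-[X,Y]^h$. Fix $p\in M$ and let $\mathcal I_p=\{v\in T_pM:\mathcal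 F(v)=1\}$ be the indicatrix, $\mathfrak X(\mathcal I_p)$ the Lie algebra of $C^\infty$ vector fields on it, and $\mathrm{Diff}(\mathcal I_p)$ its group of $C^\infty$ diffeomorphisms. Fix $r\in\{1,2,\dots,\infty\}$ and let $\mathrm{Hol}_p(M)\subset\mathrm{Diff}(\mathcal I_p)$ be the holonomy group, generated by the parallel translations along piecewise $C^r$ closed curves starting at $p$. A vector field $\xi\in\mathfrak X(\mathcal I_p)$ is called tangent to $\mathrm{Hol}_p(M)$ if there are a $C^\infty$ curve $t\mapsto\varphi_t\in\mathrm{Diff}(\mathcal I_p)$, defined on an open interval around $0$ and with values in $\mathrm{Hol}_p(M)$, and an integer $k\ge1$ such that $\varphi_0=\mathrm{id}$, $\frac{\partial^j\varphi_t}{\partial t^j}\big|_{t=0}=0$ for $1\le j<k$, and $\frac{\partial^k\varphi_t}{\partial t^k}\big|_{t=0}=\xi$. The holonomy algebra $\mathfrak{hol}_p(M)$ is the set of all vector fields on $\mathcal I_p$ tangent to $\mathrm{Hol}_p(M)$. The curvature algebra $\mathfrak R_p$ is the Lie subalgebra of $\mathfrak X(\mathcal I_p)$ generated by the curvature vector fields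 $\xi_p=R(X_p^h,Y_p^h)|_{\mathcal I_p}$, $X_p,Y_p\in T_pM$. Then: 1. for all $X_p,Y_p\in T_pM$, the restriction $R(X_p^h,Y_p^h)|_{\mathcal I_p}$ is a $C^\infty$ vector field on $\mathcal I_p$ and is tangent to $\mathrm{Hol}_p(M)$; 2. every element of the curvature algebra $\mathfrak R_p$ is tangent to $\mathrm{Hol}_p(M)$; 3. $\mathfrak{hol}_p(M)$ is a Lie subalgebra of $\mathfrak X(\mathcal I_p)$, and $\mathfrak R_p$ is a Lie subalgebra of $\mathfrak{hol}_p(M)$. -/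

import Mathlib

open scoped Manifold ContDiff

noncomputable section

namespace FinslerHolonomy

/-! ## Diffeomorphism groups of submanifolds of a vector space, and tangent vector fields -/

section Tangency

variable {V W : Type*} [NormedAddCommGroup V] [NormedSpace ℝ V]
  [NormedAddCommGroup W] [NormedSpace ℝ W]

/-- Let `ι : A → V` be the inclusion of a submanifold `A` of a normed space `V`.  A map `f : A → W`
is smooth if, near each point of `A`, it is the restriction of a `C^∞` map defined on an open
subset of `V`. -/
def SmoothAlong {A : Type*} (ι : A → V) (f : A → W) : Prop :=
  ∀ a : A, ∃ U : Set V, IsOpen U ∧ ι a ∈ U ∧ ∃ g : V → W, ContDiffOn ℝ ∞ g U ∧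
    ∀ b : A, ι b ∈ U → f b = g (ι b)

theorem SmoothAlong.comp {S : Set V} {A : Type*} {Z : Type*} [NormedAddCommGroup Z]
    [NormedSpace ℝ Z] {ι : A → Z} {h : S → W} {f : A → S}
    (hh : SmoothAlong (Subtype.val : S → V) h) (hf : SmoothAlong ι (fun a => (f a : V))) :
    SmoothAlong ι (fun a => h (f a)) := by
  intro a
  obtain ⟨U, hU, haU, g, hg, hgf⟩ := hf a
  obtain ⟨U', hU', haU', g', hg', hgf'⟩ := hh (f a)
  refine ⟨U ∩ g ⁻¹' U', hg.continuousOn.isOpen_inter_preimage hU hU',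
    ⟨haU, ?_⟩, g' ∘ g, ?_, ?_⟩
  · rw [Set.mem_preimage, ← hgf a haU]; exact haU'
  · exact hg'.comp (hg.mono Set.inter_subset_left) (fun x hx => hx.2)
  · rintro b ⟨hb, hb'⟩
    rw [Set.mem_preimage, ← hgf b hb] at hb'
    change h (f b) = g' (g (ι b))
    rw [hgf' _ hb', ← hgf b hb]

/-- The group `Diff(S)` of `C^∞` diffeomorphisms of a submanifold `S` of a normed space. -/
def diffGroup (S : Set V) : Subgroup (Equiv.Perm S) where
  carrier := {φ | SmoothAlong (Subtype.val : S → V) (fun v => (φ v : V)) ∧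
    SmoothAlong (Subtype.val : S → V) (fun v => (φ.symm v : V))}
  mul_mem' := fun {φ ψ} hφ hψ => ⟨hφ.1.comp hψ.1, hψ.2.comp hφ.2⟩
  one_mem' := by
    have h : SmoothAlong (Subtype.val : S → V) (fun v => (v : V)) := fun a =>
      ⟨Set.univ, isOpen_univ, trivial, id, contDiffOn_id, fun _ _ => rfl⟩
    exact ⟨h, h⟩
  inv_mem' := fun {φ} hφ => ⟨hφ.2, hφ.1⟩

/-- `φ_t`, `|t| < ε`, is a `C^∞` curve in `Diff(S)` (that is, `(t, v) ↦ φ_t(v)` is `C^∞`) with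
values in the subgroup `G`. -/
def IsSmoothCurveIn {S : Set V} (G : Subgroup (diffGroup S)) (ε : ℝ) (φ : ℝ → diffGroup S) :
    Prop :=
  (∀ t ∈ Set.Ioo (-ε) ε, φ t ∈ G) ∧
    SmoothAlong (fun a : Set.Ioo (-ε) ε × S => ((a.1 : ℝ), (a.2 : V)))
      (fun a => ((φ a.1 : Equiv.Perm S) a.2 : V))

/-- `φ` is an integral curve of order `k` of the vector field `X` on `S`: `φ_0 = id`, the first
`k - 1` time derivatives of `φ_t` at `t = 0` vanish, and the `k`-th one is `X`. -/
def IsIntegralCurveOfOrder {S : Set V} (k : ℕ) (φ : ℝ → diffGroup S) (X : S → V) : Prop :=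
  φ 0 = 1 ∧ ∀ v : S,
    (∀ j : ℕ, 1 ≤ j → j < k →
      iteratedDeriv j (fun t => ((φ t : Equiv.Perm S) v : V)) 0 = 0) ∧
    iteratedDeriv k (fun t => ((φ t : Equiv.Perm S) v : V)) 0 = X v

/-- The vector field `X` is tangent to the subgroup `G` of `Diff(S)`: there is a `C^∞` curve in `G`
that is an integral curve, of some order `k ≥ 1`, of `X`. -/
def IsTangentTo {S : Set V} (G : Subgroup (diffGroup S)) (X : S → V) : Prop :=
  ∃ ε : ℝ, 0 < ε ∧ ∃ φ : ℝ → diffGroup S, IsSmoothCurveIn G ε φ ∧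
    ∃ k : ℕ, 1 ≤ k ∧ IsIntegralCurveOfOrder k φ X

end Tangency

/-! ## Finsler manifolds -/

/-- The bilinear form `g_y(u, v) = (1/2) ∂²f²(y + s u + t v) / ∂s ∂t` at `s = t = 0`. -/
def fundForm {V : Type*} [AddCommGroup V] [Module ℝ V] (f : V → ℝ) (y u v : V) : ℝ :=
  (1 / 2) * deriv (fun s : ℝ => deriv (fun t : ℝ => f (y + s • u + t • v) ^ 2) 0) 0

variable {n : ℕ} {M : Type*} [TopologicalSpace M] [ChartedSpace (EuclideanSpace ℝ (Fin n)) M]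
  [IsManifold (𝓡 n) ∞ M]

variable (n M) in
/-- A Finsler metric on the `n`-dimensional manifold `M`. -/
structure FinslerMetric where
  /-- The Finsler norm. -/
  toFun : TangentBundle (𝓡 n) M → ℝ
  nonneg : ∀ v, 0 ≤ toFun v
  continuous : Continuous toFun
  homogeneous : ∀ (x : M) (v : TangentSpace (𝓡 n) x) (a : ℝ), 0 < a →
    toFun ⟨x, a • v⟩ = a * toFun ⟨x, v⟩
  smooth : ContMDiffOn (𝓡 n).tangent 𝓘(ℝ) ∞ toFun {v | v.2 ≠ 0}
  posDef : ∀ (x : M) (y u : TangentSpace (𝓡 n) x), y ≠ 0 → u ≠ 0 →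
    0 < fundForm (fun v : TangentSpace (𝓡 n) x => toFun ⟨x, v⟩) y u u

/-- The standard basis vector `∂/∂x^i` of the model space. -/
abbrev stdVec (i : Fin n) : EuclideanSpace ℝ (Fin n) := EuclideanSpace.single i 1

variable (n) in
/-- The chart `(x^i, y^i)` of `TM` induced by the chart `(x^i)` of `M` centred at `q`. -/
def inducedChart (q : M) : PartialEquiv (TangentBundle (𝓡 n) M)
    (EuclideanSpace ℝ (Fin n) × EuclideanSpace ℝ (Fin n)) :=
  extChartAt (𝓡 n).tangent (⟨q, 0⟩ : TangentBundle (𝓡 n) M)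

namespace FinslerMetric

variable (F : FinslerMetric n M)

/-- The coordinate expression of the Finsler norm in the chart at `q`. -/
def inCoord (q : M) (x y : EuclideanSpace ℝ (Fin n)) : ℝ :=
  F.toFun ((inducedChart n q).symm (x, y))

/-- The matrix `g_{ij}(x, y)` of the metric tensor in the chart at `q`. -/
def gMatrix (q : M) (x y : EuclideanSpace ℝ (Fin n)) : Matrix (Fin n) (Fin n) ℝ :=
  Matrix.of fun i j => fundForm (F.inCoord q x) y (stdVec i) (stdVec j)

/-- The partial derivative `∂g_{ij}/∂x^k (x, y)`. -/
def dgMatrix (q : M) (k i j : Fin n) (x y : EuclideanSpace ℝ (Fin n)) : ℝ :=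
  lineDeriv ℝ (fun x' => F.gMatrix q x' y i j) x (stdVec k)

/-- The geodesic coefficients `G^i`, given by
`4 G^i = g^{il} (2 ∂g_{jl}/∂x^k - ∂g_{jk}/∂x^l) y^j y^k`, in the chart at `q`. -/
def geodesicCoeff (q : M) (x y : EuclideanSpace ℝ (Fin n)) : EuclideanSpace ℝ (Fin n) :=
  WithLp.toLp 2 fun i => (1 / 4) * ∑ l, ∑ j, ∑ k, (F.gMatrix q x y)⁻¹ i l *
    (2 * F.dgMatrix q k j l x y - F.dgMatrix q l j k x y) * y j * y k

/-- The connection coefficients `G^i_j = ∂G^i/∂y^j` in the chart at `q`, as the linear map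
`w ↦ (G^i_j(x, y) w^j)_i`. -/
def connCoeff (q : M) (x y : EuclideanSpace ℝ (Fin n)) :
    EuclideanSpace ℝ (Fin n) →L[ℝ] EuclideanSpace ℝ (Fin n) :=
  fderiv ℝ (F.geodesicCoeff q x) y

/-! ### Parallel translation and holonomy -/

/-- The curve `γ` in `TM`, seen as the vector field `X(t) = γ(t)` along its projection
`c = π ∘ γ` to `M`, is parallel on `J`: at each `t ∈ J` one has
`dX^i/dt + G^i_j(c, X) dc^j/dt = 0` in a chart around `c(t)`.  (The equation does not depend on the
chart.  Derivatives are taken within `J`, i.e. one-sided at the endpoints of an interval.) -/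
def IsParallelOn (γ : ℝ → TangentBundle (𝓡 n) M) (J : Set ℝ) : Prop :=
  ∀ t ∈ J, ∃ q : M, (γ t).proj ∈ (chartAt (EuclideanSpace ℝ (Fin n)) q).source ∧
    HasDerivWithinAt (fun s => (inducedChart n q (γ s)).2)
      (-(F.connCoeff q (inducedChart n q (γ t)).1 (inducedChart n q (γ t)).2
        (derivWithin (fun s => (inducedChart n q (γ s)).1) J t))) J t

/-- The indicatrix `I_p = {v ∈ T_pM | F(v) = 1}`.  (In Mathlib the tangent space at `p` is the model
space, a tangent vector being given by its components in the chart at `p`.) -/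
def indicatrix (p : M) : Set (EuclideanSpace ℝ (Fin n)) := {v | F.toFun ⟨p, v⟩ = 1}

/-- `φ : I_p → I_p` is the parallel translation along a closed piecewise `C^r` curve
`c : [0, 1] → M` starting at `p`: for some subdivision `0 = τ_0 ≤ ⋯ ≤ τ_m = 1`, `c` is `C^r` on each
`[τ_i, τ_{i+1}]`, and each `v ∈ I_p` is the initial value of a vector field along `c`, parallel on
each `[τ_i, τ_{i+1}]`, with final value `φ(v)`. -/
def IsLoopTranslation (p : M) (r : ℕ∞) (φ : F.indicatrix p → F.indicatrix p) : Prop :=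
  ∃ (c : ℝ → M) (m : ℕ) (τ : ℕ → ℝ), c 0 = p ∧ c 1 = p ∧
    Monotone τ ∧ τ 0 = 0 ∧ τ m = 1 ∧
    (∀ i < m, ContMDiffOn 𝓘(ℝ) (𝓡 n) r c (Set.Icc (τ i) (τ (i + 1)))) ∧
    ∀ v : F.indicatrix p, ∃ γ : ℝ → TangentBundle (𝓡 n) M,
      (∀ t ∈ Set.Icc (0 : ℝ) 1, (γ t).proj = c t) ∧ γ 0 = ⟨p, v.1⟩ ∧ γ 1 = ⟨p, (φ v).1⟩ ∧
      ∀ i < m, F.IsParallelOn γ (Set.Icc (τ i) (τ (i + 1)))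

/-- The holonomy group at `p`: the subgroup of `Diff(I_p)` generated by the parallel translations
along closed piecewise `C^r` curves starting at `p`. -/
def holonomyGroup (p : M) (r : ℕ∞) : Subgroup (diffGroup (F.indicatrix p)) :=
  Subgroup.closure {φ | F.IsLoopTranslation p r (φ : Equiv.Perm (F.indicatrix p))}

/-! ### Horizontal lift and curvature -/

/-- The horizontal lift `X^h = X^i (∂/∂x^i - G^k_i ∂/∂y^k)` of a vector field `X`, in the chart
at `q`. -/
def horizontalLift (q : M) (X : EuclideanSpace ℝ (Fin n) → EuclideanSpace ℝ (Fin n)) :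
    EuclideanSpace ℝ (Fin n) × EuclideanSpace ℝ (Fin n) →
      EuclideanSpace ℝ (Fin n) × EuclideanSpace ℝ (Fin n) :=
  fun z => (X z.1, -(F.connCoeff q z.1 z.2 (X z.1)))

/-- `R(X^h, Y^h) = [X^h, Y^h] - [X, Y]^h`, in the chart at `q`. -/
def curvatureField (q : M) (X Y : EuclideanSpace ℝ (Fin n) → EuclideanSpace ℝ (Fin n)) :
    EuclideanSpace ℝ (Fin n) × EuclideanSpace ℝ (Fin n) →
      EuclideanSpace ℝ (Fin n) × EuclideanSpace ℝ (Fin n) :=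
  fun z => VectorField.lieBracket ℝ (F.horizontalLift q X) (F.horizontalLift q Y) z -
    F.horizontalLift q (VectorField.lieBracket ℝ X Y) z

/-- The vertical vector `R(u^h, w^h)` at `v ∈ T_pM`, seen as an element of `T_pM`, for
`u, w ∈ T_pM`.  As `R` is a tensor, `u` and `w` may be extended to vector fields with constant
components in the chart at `p`. -/
def curvature (p : M) (u w v : EuclideanSpace ℝ (Fin n)) : EuclideanSpace ℝ (Fin n) :=
  (F.curvatureField p (fun _ => u) (fun _ => w) (inducedChart n p ⟨p, v⟩)).2

/-! ### The Lie algebra of vector fields on the indicatrix -/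

/-- The restriction of the Finsler norm to `T_pM`. -/
abbrev normAt (p : M) (v : EuclideanSpace ℝ (Fin n)) : ℝ := F.toFun ⟨p, v⟩

theorem normAt_smul (p : M) (v : EuclideanSpace ℝ (Fin n)) {a : ℝ} (ha : 0 < a) :
    F.normAt p (a • v) = a * F.normAt p v :=
  F.homogeneous p v a ha

theorem normAt_zero (p : M) : F.normAt p 0 = 0 := by
  have h := F.normAt_smul p 0 (a := 2) (by norm_num)
  rw [smul_zero] at h
  linarith

theorem normAt_pos (p : M) {y : EuclideanSpace ℝ (Fin n)} (hy : y ≠ 0) : 0 < F.normAt p y := by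
  refine lt_of_le_of_ne (F.nonneg _) (fun h0 => ?_)
  have hpos : 0 < fundForm (F.normAt p) y y y := F.posDef p y y hy hy
  have key : ∀ s ∈ Set.Ioo (-(1 / 2) : ℝ) (1 / 2),
      deriv (fun t : ℝ => F.normAt p (y + s • y + t • y) ^ 2) 0 = 0 := by
    intro s hs
    have : (fun t : ℝ => F.normAt p (y + s • y + t • y) ^ 2) =ᶠ[nhds 0] fun _ => 0 := by
      filter_upwards [Ioo_mem_nhds (show (-(1 / 2) : ℝ) < 0 by norm_num)
        (show (0 : ℝ) < 1 / 2 by norm_num)] with t ht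
      have : y + s • y + t • y = (1 + s + t) • y := by rw [add_smul, add_smul, one_smul]
      rw [this, F.normAt_smul p y (by linarith [hs.1, ht.1]), ← h0]
      simp
    rw [this.deriv_eq]; simp
  have : (fun s : ℝ => deriv (fun t : ℝ => F.normAt p (y + s • y + t • y) ^ 2) 0)
      =ᶠ[nhds 0] fun _ => 0 := by
    filter_upwards [Ioo_mem_nhds (show (-(1 / 2) : ℝ) < 0 by norm_num)
        (show (0 : ℝ) < 1 / 2 by norm_num)] with s hs using key s hs
  rw [fundForm, this.deriv_eq] at hpos
  simp at hpos

theorem ne_zero_of_mem {p : M} {v : EuclideanSpace ℝ (Fin n)} (hv : v ∈ F.indicatrix p) :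
    v ≠ 0 := by
  rintro rfl
  have h : F.normAt p 0 = 1 := hv
  rw [F.normAt_zero p] at h
  exact zero_ne_one h

theorem inv_smul_mem (p : M) {y : EuclideanSpace ℝ (Fin n)} (hy : y ≠ 0) :
    (F.normAt p y)⁻¹ • y ∈ F.indicatrix p := by
  have h := F.normAt_pos p hy
  change F.normAt p _ = 1
  rw [F.normAt_smul p y (inv_pos.2 h), inv_mul_cancel₀ h.ne']

theorem contDiffOn_normAt (p : M) : ContDiffOn ℝ ∞ (F.normAt p) {0}ᶜ := by
  have h1 : ContMDiff 𝓘(ℝ, EuclideanSpace ℝ (Fin n)) (𝓡 n).tangent ∞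
      (fun v : EuclideanSpace ℝ (Fin n) => (⟨p, v⟩ : TangentBundle (𝓡 n) M)) := by
    intro v
    rw [Bundle.contMDiffAt_totalSpace]
    refine ⟨contMDiffAt_const, ?_⟩
    have : ∀ v : EuclideanSpace ℝ (Fin n), (trivializationAt (EuclideanSpace ℝ (Fin n))
        (TangentSpace (𝓡 n)) p (⟨p, v⟩ : TangentBundle (𝓡 n) M)).2 =
        (trivializationAt (EuclideanSpace ℝ (Fin n)) (TangentSpace (𝓡 n)) p).continuousLinearMapAt
          ℝ p v := by
      intro v
      exact (congrFun (Bundle.Trivialization.coe_linearMapAt_of_mem (R := ℝ)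
        (trivializationAt (EuclideanSpace ℝ (Fin n)) (TangentSpace (𝓡 n)) p)
        (FiberBundle.mem_baseSet_trivializationAt' p)) v).symm
    simp only [this]
    exact (ContinuousLinearMap.contDiff (𝕜 := ℝ) (E := EuclideanSpace ℝ (Fin n))
      (F := EuclideanSpace ℝ (Fin n)) _).contMDiff.contMDiffAt
  have h2 := F.smooth.comp (h1.contMDiffOn (s := {0}ᶜ)) (fun v hv => hv)
  exact h2.contDiffOn

theorem contDiffAt_normAt (p : M) {y : EuclideanSpace ℝ (Fin n)} (hy : y ≠ 0) :
    ContDiffAt ℝ ∞ (F.normAt p) y :=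
  (F.contDiffOn_normAt p).contDiffAt (isOpen_compl_singleton.mem_nhds hy)

/-- The space `𝔛(I_p)` of `C^∞` vector fields on the indicatrix `I_p`: the `C^∞` maps
`ξ : I_p → T_pM` such that `ξ(v)` lies in `T_v I_p = ker d_v(F|_{T_pM})` for all `v`. -/
def vectorFields (p : M) : Submodule ℝ (F.indicatrix p → EuclideanSpace ℝ (Fin n)) where
  carrier := {ξ | SmoothAlong (Subtype.val : F.indicatrix p → EuclideanSpace ℝ (Fin n)) ξ ∧
    ∀ v : F.indicatrix p, fderiv ℝ (F.normAt p) v (ξ v) = 0}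
  add_mem' := by
    rintro ξ η ⟨h1, h2⟩ ⟨h3, h4⟩
    refine ⟨fun a => ?_, fun v => by simp [h2 v, h4 v]⟩
    obtain ⟨U, hU, haU, g, hg, hgf⟩ := h1 a
    obtain ⟨U', hU', haU', g', hg', hgf'⟩ := h3 a
    refine ⟨U ∩ U', hU.inter hU', ⟨haU, haU'⟩, fun x => g x + g' x,
      (hg.mono Set.inter_subset_left).add (hg'.mono Set.inter_subset_right), ?_⟩
    intro b hb
    rw [Pi.add_apply, hgf b hb.1, hgf' b hb.2]
  zero_mem' := ⟨fun a => ⟨Set.univ, isOpen_univ, trivial, fun _ => 0, contDiffOn_const,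
    fun _ _ => rfl⟩, fun v => by simp⟩
  smul_mem' := by
    rintro a ξ ⟨h1, h2⟩
    refine ⟨fun b => ?_, fun v => by simp [h2 v]⟩
    obtain ⟨U, hU, haU, g, hg, hgf⟩ := h1 b
    exact ⟨U, hU, haU, fun x => a • g x, hg.const_smul a,
      fun c hc => by rw [Pi.smul_apply, hgf c hc]⟩

open Classical in
/-- The extension of `ξ : I_p → T_pM` to `T_pM` that is positively homogeneous of degree one. -/
def extend (p : M) (ξ : F.indicatrix p → EuclideanSpace ℝ (Fin n))
    (y : EuclideanSpace ℝ (Fin n)) : EuclideanSpace ℝ (Fin n) :=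
  if h : y ≠ 0 then F.normAt p y • ξ ⟨(F.normAt p y)⁻¹ • y, F.inv_smul_mem p h⟩ else 0

theorem extend_apply (p : M) (ξ : F.indicatrix p → EuclideanSpace ℝ (Fin n))
    {y : EuclideanSpace ℝ (Fin n)} (h : y ≠ 0) :
    F.extend p ξ y = F.normAt p y • ξ ⟨(F.normAt p y)⁻¹ • y, F.inv_smul_mem p h⟩ :=
  dif_pos h

theorem extend_coe (p : M) (ξ : F.indicatrix p → EuclideanSpace ℝ (Fin n))
    (v : F.indicatrix p) : F.extend p ξ v = ξ v := by
  have h1 : F.normAt p v = 1 := v.2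
  have h2 : (⟨(F.normAt p v)⁻¹ • v.1, F.inv_smul_mem p (F.ne_zero_of_mem v.2)⟩ :
      F.indicatrix p) = v := Subtype.ext (by simp [h1])
  rw [F.extend_apply p ξ (F.ne_zero_of_mem v.2), h2, h1, one_smul]

theorem extend_smul (p : M) (ξ : F.indicatrix p → EuclideanSpace ℝ (Fin n))
    {y : EuclideanSpace ℝ (Fin n)} (h : y ≠ 0) {a : ℝ} (ha : 0 < a) :
    F.extend p ξ (a • y) = a • F.extend p ξ y := by
  have h2 : (⟨(F.normAt p (a • y))⁻¹ • a • y, F.inv_smul_mem p (smul_ne_zero ha.ne' h)⟩ :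
      F.indicatrix p) = ⟨(F.normAt p y)⁻¹ • y, F.inv_smul_mem p h⟩ := by
    apply Subtype.ext
    change (F.normAt p (a • y))⁻¹ • a • y = (F.normAt p y)⁻¹ • y
    rw [F.normAt_smul p y ha, smul_smul, mul_inv, mul_right_comm, inv_mul_cancel₀ ha.ne', one_mul]
  rw [F.extend_apply p ξ h, F.extend_apply p ξ (smul_ne_zero ha.ne' h), h2, F.normAt_smul p y ha,
    mul_smul]

theorem contDiffAt_extend {p : M} {ξ : F.indicatrix p → EuclideanSpace ℝ (Fin n)}
    (hξ : SmoothAlong (Subtype.val : F.indicatrix p → EuclideanSpace ℝ (Fin n)) ξ)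
    {y : EuclideanSpace ℝ (Fin n)} (hy : y ≠ 0) : ContDiffAt ℝ ∞ (F.extend p ξ) y := by
  obtain ⟨U, hU, haU, g, hg, hgf⟩ := hξ ⟨_, F.inv_smul_mem p hy⟩
  have h1 : ContDiffAt ℝ ∞ (fun z => (F.normAt p z)⁻¹ • z) y :=
    ((F.contDiffAt_normAt p hy).inv (F.normAt_pos p hy).ne').smul contDiffAt_id
  have h2 : ContDiffAt ℝ ∞ (fun z => F.normAt p z • g ((F.normAt p z)⁻¹ • z)) y :=
    (F.contDiffAt_normAt p hy).smul
      (ContDiffAt.comp y (hg.contDiffAt (hU.mem_nhds haU)) h1)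
  refine h2.congr_of_eventuallyEq ?_
  filter_upwards [isOpen_compl_singleton.mem_nhds hy,
    h1.continuousAt.preimage_mem_nhds (hU.mem_nhds haU)] with z hz hzU
  rw [F.extend_apply p ξ hz, hgf ⟨_, F.inv_smul_mem p hz⟩ hzU]

theorem fderiv_normAt_smul (p : M) {y : EuclideanSpace ℝ (Fin n)} (hy : y ≠ 0) {a : ℝ}
    (ha : 0 < a) : fderiv ℝ (F.normAt p) (a • y) = fderiv ℝ (F.normAt p) y := by
  have hd : HasFDerivAt (F.normAt p) (fderiv ℝ (F.normAt p) (a • y)) (a • y) :=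
    ((F.contDiffAt_normAt p (smul_ne_zero ha.ne' hy)).differentiableAt (by simp)).hasFDerivAt
  have h1 : HasFDerivAt (fun z => F.normAt p (a • z))
      ((fderiv ℝ (F.normAt p) (a • y)).comp (a • ContinuousLinearMap.id ℝ _)) y :=
    HasFDerivAt.comp y hd ((hasFDerivAt_id y).const_smul a)
  have h2 : HasFDerivAt (fun z => a * F.normAt p z) (a • fderiv ℝ (F.normAt p) y) y :=
    ((F.contDiffAt_normAt p hy).differentiableAt (by simp)).hasFDerivAt.const_mul a
  have h3 : (fun z => F.normAt p (a • z)) = fun z => a * F.normAt p z := by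
    funext z; exact F.normAt_smul p z ha
  rw [h3] at h1
  have h4 := h1.unique h2
  ext w
  have h5 := congrArg (fun L => L w) h4
  simp only [ContinuousLinearMap.comp_apply, smul_apply, smul_eq_mul,
    ContinuousLinearMap.id_apply, map_smul] at h5
  exact mul_left_cancel₀ ha.ne' h5

theorem fderiv_normAt_extend {p : M} {ξ : F.indicatrix p → EuclideanSpace ℝ (Fin n)}
    (hξ : ∀ v : F.indicatrix p, fderiv ℝ (F.normAt p) v (ξ v) = 0)
    {y : EuclideanSpace ℝ (Fin n)} (hy : y ≠ 0) :
    fderiv ℝ (F.normAt p) y (F.extend p ξ y) = 0 := by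
  have h := hξ ⟨_, F.inv_smul_mem p hy⟩
  rw [F.fderiv_normAt_smul p hy (inv_pos.2 (F.normAt_pos p hy))] at h
  rw [F.extend_apply p ξ hy, map_smul, h, smul_zero]

/-- The Lie bracket of vector fields on the indicatrix, `[ξ, η] = Dη(ξ) - Dξ(η)`, computed with
the homogeneous extensions of the fields to `T_pM ∖ {0}`. -/
def bracket (p : M) (ξ η : F.indicatrix p → EuclideanSpace ℝ (Fin n)) :
    F.indicatrix p → EuclideanSpace ℝ (Fin n) :=
  fun v => VectorField.lieBracket ℝ (F.extend p ξ) (F.extend p η) v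

theorem fderiv_extend_smul {p : M} {ξ : F.indicatrix p → EuclideanSpace ℝ (Fin n)}
    (hξ : SmoothAlong (Subtype.val : F.indicatrix p → EuclideanSpace ℝ (Fin n)) ξ)
    {y : EuclideanSpace ℝ (Fin n)} (hy : y ≠ 0) {a : ℝ} (ha : 0 < a) :
    fderiv ℝ (F.extend p ξ) (a • y) = fderiv ℝ (F.extend p ξ) y := by
  have hd : HasFDerivAt (F.extend p ξ) (fderiv ℝ (F.extend p ξ) (a • y)) (a • y) :=
    ((F.contDiffAt_extend hξ (smul_ne_zero ha.ne' hy)).differentiableAt (by simp)).hasFDerivAt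
  have h1 : HasFDerivAt (fun z => F.extend p ξ (a • z))
      ((fderiv ℝ (F.extend p ξ) (a • y)).comp (a • ContinuousLinearMap.id ℝ _)) y :=
    HasFDerivAt.comp y hd ((hasFDerivAt_id y).const_smul a)
  have h2 : HasFDerivAt (fun z => a • F.extend p ξ z) (a • fderiv ℝ (F.extend p ξ) y) y :=
    ((F.contDiffAt_extend hξ hy).differentiableAt (by simp)).hasFDerivAt.const_smul a
  have h3 : (fun z => F.extend p ξ (a • z)) =ᶠ[nhds y] fun z => a • F.extend p ξ z := by
    filter_upwards [isOpen_compl_singleton.mem_nhds hy] with z hz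
    exact F.extend_smul p ξ hz ha
  have h4 := (h2.congr_of_eventuallyEq h3).unique h1
  ext1 w
  have h5 := congrArg (fun L => L w) h4
  simp only [ContinuousLinearMap.comp_apply, smul_apply,
    ContinuousLinearMap.id_apply, map_smul] at h5
  exact (smul_right_injective _ ha.ne' h5).symm

theorem extend_bracket {p : M} {ξ η : F.indicatrix p → EuclideanSpace ℝ (Fin n)}
    (hξ : SmoothAlong (Subtype.val : F.indicatrix p → EuclideanSpace ℝ (Fin n)) ξ)
    (hη : SmoothAlong (Subtype.val : F.indicatrix p → EuclideanSpace ℝ (Fin n)) η)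
    {y : EuclideanSpace ℝ (Fin n)} (hy : y ≠ 0) :
    F.extend p (F.bracket p ξ η) y =
      VectorField.lieBracket ℝ (F.extend p ξ) (F.extend p η) y := by
  have hp := F.normAt_pos p hy
  have hi := inv_pos.2 hp
  rw [F.extend_apply p _ hy, bracket, VectorField.lieBracket, VectorField.lieBracket,
    F.fderiv_extend_smul hξ hy hi, F.fderiv_extend_smul hη hy hi,
    F.extend_smul p ξ hy hi, F.extend_smul p η hy hi, map_smul, map_smul, ← smul_sub, smul_smul,
    mul_inv_cancel₀ hp.ne', one_smul]

theorem contDiffAt_lieBracket {p : M} {ξ η : F.indicatrix p → EuclideanSpace ℝ (Fin n)}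
    (hξ : SmoothAlong (Subtype.val : F.indicatrix p → EuclideanSpace ℝ (Fin n)) ξ)
    (hη : SmoothAlong (Subtype.val : F.indicatrix p → EuclideanSpace ℝ (Fin n)) η)
    {y : EuclideanSpace ℝ (Fin n)} (hy : y ≠ 0) :
    ContDiffAt ℝ ∞ (VectorField.lieBracket ℝ (F.extend p ξ) (F.extend p η)) y :=
  (F.contDiffAt_extend hξ hy).lieBracket_vectorField (F.contDiffAt_extend hη hy) (by simp)

theorem bracket_mem (p : M) {ξ η : F.indicatrix p → EuclideanSpace ℝ (Fin n)}
    (hξ : ξ ∈ F.vectorFields p) (hη : η ∈ F.vectorFields p) :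
    F.bracket p ξ η ∈ F.vectorFields p := by
  refine ⟨fun a => ⟨{0}ᶜ, isOpen_compl_singleton, F.ne_zero_of_mem a.2, _,
    fun y hy => (F.contDiffAt_lieBracket hξ.1 hη.1 hy).contDiffWithinAt, fun b _ => rfl⟩,
    fun v => ?_⟩
  have hv := F.ne_zero_of_mem v.2
  have hnear : ∀ᶠ y in nhds (v : EuclideanSpace ℝ (Fin n)), y ≠ 0 :=
    isOpen_compl_singleton.mem_nhds hv
  rw [bracket, VectorField.fderiv_apply_lieBracket (n := ∞)
    (F.contDiffAt_normAt p hv) (by simp only [minSmoothness_of_isRCLikeNormedField]; exact WithTop.coe_le_coe.2 (le_top : (2 : ℕ∞) ≤ ⊤))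
    ((F.contDiffAt_extend hη.1 hv).differentiableAt (by simp))
    ((F.contDiffAt_extend hξ.1 hv).differentiableAt (by simp))]
  have h1 : (fun y => fderiv ℝ (F.normAt p) y (F.extend p ξ y)) =ᶠ[nhds v.1] fun _ => 0 := by
    filter_upwards [hnear] with y hy using F.fderiv_normAt_extend hξ.2 hy
  have h2 : (fun y => fderiv ℝ (F.normAt p) y (F.extend p η y)) =ᶠ[nhds v.1] fun _ => 0 := by
    filter_upwards [hnear] with y hy using F.fderiv_normAt_extend hη.2 hy
  rw [h1.fderiv_eq, h2.fderiv_eq]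
  simp

theorem extend_add (p : M) (ξ η : F.indicatrix p → EuclideanSpace ℝ (Fin n)) :
    F.extend p (ξ + η) = fun y => F.extend p ξ y + F.extend p η y := by
  funext y
  by_cases hy : y = 0
  · simp [extend, hy]
  · simp [F.extend_apply p _ hy]

theorem extend_const_smul (p : M) (a : ℝ) (ξ : F.indicatrix p → EuclideanSpace ℝ (Fin n)) :
    F.extend p (a • ξ) = fun y => a • F.extend p ξ y := by
  funext y
  by_cases hy : y = 0
  · simp [extend, hy]
  · simp [F.extend_apply p _ hy, smul_comm a]

theorem differentiableAt_extend {p : M} (ξ : F.vectorFields p) (v : F.indicatrix p) :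
    DifferentiableAt ℝ (F.extend p ξ.1) v :=
  (F.contDiffAt_extend ξ.2.1 (F.ne_zero_of_mem v.2)).differentiableAt (by simp)

instance (p : M) : Bracket (F.vectorFields p) (F.vectorFields p) where
  bracket ξ η := ⟨F.bracket p ξ.1 η.1, F.bracket_mem p ξ.2 η.2⟩

theorem coe_bracket {p : M} (ξ η : F.vectorFields p) :
    (⁅ξ, η⁆ : F.vectorFields p).1 = F.bracket p ξ.1 η.1 := rfl

theorem bracket_add_left {p : M} (ξ η ζ : F.vectorFields p) : ⁅ξ + η, ζ⁆ = ⁅ξ, ζ⁆ + ⁅η, ζ⁆ := by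
  apply Subtype.ext
  funext v
  change F.bracket p (ξ.1 + η.1) ζ.1 v = F.bracket p ξ.1 ζ.1 v + F.bracket p η.1 ζ.1 v
  rw [bracket, F.extend_add]
  exact VectorField.lieBracket_add_left (F.differentiableAt_extend ξ v)
    (F.differentiableAt_extend η v)

theorem bracket_swap {p : M} (ξ η : F.vectorFields p) : ⁅ξ, η⁆ = -⁅η, ξ⁆ := by
  apply Subtype.ext
  funext v
  exact VectorField.lieBracket_swap

instance (p : M) : LieRing (F.vectorFields p) where
  add_lie := F.bracket_add_left
  lie_add ξ η ζ := by
    rw [F.bracket_swap, F.bracket_add_left, neg_add, ← F.bracket_swap, ← F.bracket_swap]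
  lie_self ξ := by
    apply Subtype.ext
    funext v
    change VectorField.lieBracket ℝ (F.extend p ξ.1) (F.extend p ξ.1) v = 0
    simp
  leibniz_lie ξ η ζ := by
    apply Subtype.ext
    funext v
    have hv := F.ne_zero_of_mem v.2
    have hnear : ∀ᶠ y in nhds (v : EuclideanSpace ℝ (Fin n)), y ≠ 0 :=
      isOpen_compl_singleton.mem_nhds hv
    have key : ∀ α β : F.vectorFields p, F.extend p (F.bracket p α.1 β.1) =ᶠ[nhds v.1]
        VectorField.lieBracket ℝ (F.extend p α.1) (F.extend p β.1) := fun α β => by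
      filter_upwards [hnear] with y hy using F.extend_bracket α.2.1 β.2.1 hy
    change VectorField.lieBracket ℝ (F.extend p ξ.1) (F.extend p (F.bracket p η.1 ζ.1)) v =
      VectorField.lieBracket ℝ (F.extend p (F.bracket p ξ.1 η.1)) (F.extend p ζ.1) v +
      VectorField.lieBracket ℝ (F.extend p η.1) (F.extend p (F.bracket p ξ.1 ζ.1)) v
    rw [Filter.EventuallyEq.lieBracket_vectorField_eq Filter.EventuallyEq.rfl (key η ζ),
      Filter.EventuallyEq.lieBracket_vectorField_eq (key ξ η) Filter.EventuallyEq.rfl,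
      Filter.EventuallyEq.lieBracket_vectorField_eq Filter.EventuallyEq.rfl (key ξ ζ)]
    exact VectorField.leibniz_identity_lieBracket (n := ∞)
      (by simp only [minSmoothness_of_isRCLikeNormedField]; exact WithTop.coe_le_coe.2 (le_top : (2 : ℕ∞) ≤ ⊤))
      (F.contDiffAt_extend ξ.2.1 hv) (F.contDiffAt_extend η.2.1 hv) (F.contDiffAt_extend ζ.2.1 hv)

instance (p : M) : LieAlgebra ℝ (F.vectorFields p) where
  lie_smul a ξ η := by
    apply Subtype.ext
    funext v
    change F.bracket p ξ.1 (a • η.1) v = a • F.bracket p ξ.1 η.1 v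
    rw [bracket, F.extend_const_smul]
    exact VectorField.lieBracket_const_smul_right (F.differentiableAt_extend η v)

/-- The curvature algebra `ℜ_p`: the Lie subalgebra of `𝔛(I_p)` generated by the curvature vector
fields `v ↦ R(u^h, w^h)(v)`, `u, w ∈ T_pM`. -/
def curvatureAlgebra (p : M) : LieSubalgebra ℝ (F.vectorFields p) :=
  LieSubalgebra.lieSpan ℝ (F.vectorFields p)
    {ξ | ∃ u w : EuclideanSpace ℝ (Fin n), ∀ v : F.indicatrix p, ξ.1 v = F.curvature p u w v}

/-- The holonomy algebra `𝔥𝔬𝔩_p(M)`: the set of the vector fields on `I_p` that are tangent to the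
holonomy group at `p`. -/
def holonomyAlgebra (p : M) (r : ℕ∞) : Set (F.vectorFields p) :=
  {ξ | IsTangentTo (F.holonomyGroup p r) ξ.1}

end FinslerMetric

end FinslerHolonomy

end

/-! Curvature is the second-order term of parallel translation around an infinitesimal
parallelogram. In the chart at `p`, take the horizontal lifts of two constant vector fields `u`, `w`
and follow their flows for times `-t`, `-t`, `t`, `t`. The projection closes up to a coordinate
parallelogram based at `p`, and on the indicatrix the motion is its parallel translation. The
resulting curve in the holonomy group expands as the identity plus `t ^ 2` times the Lie bracket of
the lifts. Constant fields commute, so this bracket is vertical and equals the curvature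
(`tendsto_loopMap`, `curvature_eq`, `hasTangentCurve_curvature`). That the translation preserves the
indicatrix is the identity `fderiv_energy_horizontal`: the geodesic coefficients are so made that
horizontal vectors annihilate the differential of the squared norm; it follows from Euler's
relation.

The fields tangent to any subgroup `G` of the diffeomorphism group form a Lie algebra
(`tangentAlgebra`). If curves in `G` have leading terms `t ^ k • ξ` and `t ^ l • η`, then `φ (t ^ l)
* ψ (t ^ k)` has leading term `ξ + η` in order `k * l`, the inverse curve has leading term `-ξ`, a
rescaling of time multiplies `ξ` by a positive constant, and a group commutator has leading term
`[ξ, η]` in order `k + l`. Such expansions come from dividing by powers of `t` with quotients smooth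
in all variables. To calculate in an open set of a vector space, diffeomorphisms and fields on the
indicatrix are replaced by their homogeneous extensions to the nonzero vectors.

The smooth flows rest on the contraction principle in a space of continuous curves: the fixed point
of a smooth family of contractions is smooth by the implicit function theorem, and composition with
a smooth map is a smooth operator on such curves. -/

noncomputable section

section

namespace FinslerHolonomy

open Filter Topology Set
open scoped NNReal unitInterval

/-! ### Smoothness of superposition operators on spaces of continuous functions -/

section Nemytskii

universe u
variable {K : Type*} [TopologicalSpace K] [CompactSpace K]
  {E F : Type u} [NormedAddCommGroup E] [NormedSpace ℝ E] [NormedAddCommGroup F] [NormedSpace ℝ F]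

/-- A family of continuous linear maps, applied pointwise. -/
def pointwiseCLM (K : Type*) [TopologicalSpace K] [CompactSpace K] (E F : Type u)
    [NormedAddCommGroup E] [NormedSpace ℝ E] [NormedAddCommGroup F] [NormedSpace ℝ F] :
    C(K, E →L[ℝ] F) →L[ℝ] C(K, E) →L[ℝ] C(K, F) :=
  LinearMap.mkContinuous₂ (LinearMap.mk₂ ℝ
    (fun (A : C(K, E →L[ℝ] F)) (h : C(K, E)) => (⟨fun s => A s (h s), by fun_prop⟩ : C(K, F)))
    (fun _ _ _ => by ext; simp) (fun _ _ _ => by ext; simp) (fun _ _ _ => by ext; simp)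
    (fun _ _ _ => by ext; simp)) 1 (fun A h => by
      rw [ContinuousMap.norm_le _ (by positivity)]
      intro s
      rw [one_mul]
      exact ((A s).le_opNorm (h s)).trans (by gcongr <;> exact ContinuousMap.norm_coe_le_norm _ s))

/-- The mean value inequality on the segment from `u s` to `w s` bounds the remainder, uniformly in
`s` because composition with the derivative of `f` is continuous for the sup norm. -/
theorem hasFDerivAt_postcomp {f : E → F} (hf : ContDiff ℝ 1 f) (u : C(K, E)) :
    HasFDerivAt (fun w : C(K, E) => (⟨f, hf.continuous⟩ : C(E, F)).comp w)
      (pointwiseCLM K E F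
        ((⟨fderiv ℝ f, hf.continuous_fderiv one_ne_zero⟩ : C(E, E →L[ℝ] F)).comp u)) u := by
  set D : C(E, E →L[ℝ] F) := ⟨fderiv ℝ f, hf.continuous_fderiv one_ne_zero⟩
  rw [hasFDerivAt_iff_isLittleO, Asymptotics.isLittleO_iff]
  intro c hc
  obtain ⟨δ, hδ, h⟩ := (Metric.continuousAt_iff (f := fun w : C(K, E) => D.comp w) (a := u)).1
    (ContinuousMap.continuous_postcomp D).continuousAt c hc
  filter_upwards [Metric.ball_mem_nhds u hδ] with w hw
  rw [ContinuousMap.norm_le _ (by positivity)]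
  intro s
  -- A point of the segment is the value at `s` of the function `a • u + b • w`, which lies in the
  -- same ball around `u` as `w`.
  have hseg : ∀ x ∈ segment ℝ (u s) (w s), ‖fderiv ℝ f x - fderiv ℝ f (u s)‖ ≤ c := by
    rintro x ⟨a, b, ha, hb, hab, rfl⟩
    have hd : dist (a • u + b • w) u < δ := by
      have : a • u + b • w - u = b • (w - u) := by
        rw [← eq_sub_iff_add_eq] at hab
        rw [hab, sub_smul, one_smul, smul_sub]; abel
      rw [dist_eq_norm, this, norm_smul, Real.norm_of_nonneg hb]
      rw [Metric.mem_ball, dist_eq_norm] at hw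
      exact (mul_le_of_le_one_left (norm_nonneg _) (by linarith)).trans_lt hw
    rw [← dist_eq_norm]
    exact (ContinuousMap.dist_apply_le_dist (f := D.comp (a • u + b • w)) (g := D.comp u) s).trans
      (h hd).le
  have := Convex.norm_image_sub_le_of_norm_hasFDerivWithin_le' (f := f)
    (φ := fderiv ℝ f (u s)) (fun x _ =>
      ((hf.differentiable one_ne_zero) x).hasFDerivAt.hasFDerivWithinAt) hseg
      (convex_segment _ _) (left_mem_segment ℝ _ _) (right_mem_segment ℝ _ _)
  exact this.trans (by gcongr; exact ContinuousMap.norm_coe_le_norm (w - u) s)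

/-- The derivative is again a superposition operator, that of `fderiv ℝ f`, followed by a continuous
linear map. The induction must vary the target, which becomes the space of continuous linear maps
from `E` to `F`; hence the common universe. -/
theorem contDiff_nat_postcomp (m : ℕ) {E F : Type u} [NormedAddCommGroup E] [NormedSpace ℝ E]
    [NormedAddCommGroup F] [NormedSpace ℝ F] {f : E → F} (hf : ContDiff ℝ ∞ f) :
    ContDiff ℝ m (fun w : C(K, E) => (⟨f, hf.continuous⟩ : C(E, F)).comp w) := by
  induction m generalizing F with
  | zero => exact contDiff_zero.2 (ContinuousMap.continuous_postcomp _)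
  | succ m ih =>
    have h1 := fun u : C(K, E) => hasFDerivAt_postcomp (hf.of_le (by simp)) u
    have hd : ContDiff ℝ ∞ (fderiv ℝ f) := hf.fderiv_right (by simp)
    push_cast
    rw [contDiff_succ_iff_fderiv]
    refine ⟨fun u => (h1 u).differentiableAt, by simp, ?_⟩
    rw [show fderiv ℝ (fun w : C(K, E) => (⟨f, hf.continuous⟩ : C(E, F)).comp w) = _ from
      funext fun u => (h1 u).fderiv]
    exact (pointwiseCLM K E F).contDiff.comp (ih hd)

/-- Composition with a smooth map is a smooth operator between spaces of continuous functions. -/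
theorem contDiff_postcomp {f : E → F} (hf : ContDiff ℝ ∞ f) :
    ContDiff ℝ ∞ (fun w : C(K, E) => (⟨f, hf.continuous⟩ : C(E, F)).comp w) :=
  contDiff_infty.2 fun m => contDiff_nat_postcomp m hf

end Nemytskii

/-! ### The integration operator on curves -/

section Volterra

variable {E : Type*} [NormedAddCommGroup E]

theorem continuous_comp_projIcc (u : C(I, E)) :
    Continuous fun θ : ℝ => u (projIcc 0 1 zero_le_one θ) :=
  u.continuous.comp continuous_projIcc

variable [NormedSpace ℝ E]

/-- The function `s ↦ ∫_0^s u` on the unit interval. -/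
def primitive (u : C(I, E)) (s : ℝ) : E := ∫ θ in (0 : ℝ)..s, u (projIcc 0 1 zero_le_one θ)

theorem hasDerivAt_primitive [CompleteSpace E] (u : C(I, E)) (s : ℝ) :
    HasDerivAt (primitive u) (u (projIcc 0 1 zero_le_one s)) s :=
  intervalIntegral.integral_hasDerivAt_right
    ((continuous_comp_projIcc u).intervalIntegrable _ _)
    ((continuous_comp_projIcc u).stronglyMeasurableAtFilter _ _)
    (continuous_comp_projIcc u).continuousAt

theorem norm_primitive_le (u : C(I, E)) (s : I) : ‖primitive u s‖ ≤ ‖u‖ := by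
  have := intervalIntegral.norm_integral_le_of_norm_le_const (a := (0 : ℝ)) (b := s)
    (f := fun θ : ℝ => u (projIcc 0 1 zero_le_one θ)) (C := ‖u‖)
    fun θ _ => ContinuousMap.norm_coe_le_norm u _
  refine this.trans (mul_le_of_le_one_right (norm_nonneg _) ?_)
  rw [sub_zero, abs_of_nonneg s.2.1]
  exact s.2.2

/-- The Volterra operator `u ↦ ∫_0^· u`. -/
def volterra (E : Type*) [NormedAddCommGroup E] [NormedSpace ℝ E] [CompleteSpace E] :
    C(I, E) →L[ℝ] C(I, E) :=
  LinearMap.mkContinuous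
    { toFun := fun u => ⟨fun s => primitive u s,
        (continuous_iff_continuousAt.2 fun s => (hasDerivAt_primitive u s).continuousAt).comp
          continuous_subtype_val⟩
      map_add' := fun u w => by
        ext s
        exact intervalIntegral.integral_add
          ((continuous_comp_projIcc u).intervalIntegrable _ _)
          ((continuous_comp_projIcc w).intervalIntegrable _ _)
      map_smul' := fun a u => by
        ext s
        exact intervalIntegral.integral_smul a _ } 1 (fun u => by
      rw [ContinuousMap.norm_le _ (by positivity), one_mul]
      exact norm_primitive_le u)

theorem norm_volterra_le [CompleteSpace E] (u : C(I, E)) : ‖volterra E u‖ ≤ ‖u‖ := by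
  rw [ContinuousMap.norm_le _ (norm_nonneg _)]
  exact norm_primitive_le u

end Volterra

/-! ### Smooth dependence of fixed points on parameters -/

section FixedPoint

/-- The fixed point of a smooth family of uniform contractions is smooth. -/
theorem contDiffAt_fixedPoint {P B : Type*} [NormedAddCommGroup P] [NormedSpace ℝ P]
    [CompleteSpace P] [NormedAddCommGroup B] [NormedSpace ℝ B] [CompleteSpace B]
    {T : P × B → B} {u : P → B} {p : P} (hT : ContDiffAt ℝ ∞ T (p, u p)) (hu : T (p, u p) = u p)
    {c : ℝ≥0} (hc : c < 1) (hL : LipschitzWith c fun w => T (p, w))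
    (huniq : ∀ᶠ q in 𝓝 p, ∀ w, T (q, w) = w → w = u q) : ContDiffAt ℝ ∞ u p := by
  have hS : ContDiffAt ℝ ∞ (fun x : P × B => x.2 - T x) (p, u p) := contDiffAt_snd.sub hT
  have hfd : fderiv ℝ (fun x : P × B => x.2 - T x) (p, u p) ∘L .inr ℝ P B =
      ContinuousLinearMap.id ℝ B - fderiv ℝ (fun w => T (p, w)) (u p) := by
    have h1 : HasFDerivAt (fun w => T (p, w)) (fderiv ℝ T (p, u p) ∘L .inr ℝ P B) (u p) :=
      HasFDerivAt.comp (u p) (hT.differentiableAt (by simp)).hasFDerivAt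
        (hasFDerivAt_prodMk_right p (u p))
    rw [h1.fderiv, fderiv_fun_sub differentiableAt_snd (hT.differentiableAt (by simp)), fderiv_snd]
    ext w
    simp
  -- The partial derivative is the identity minus an operator of norm at most `c < 1`, hence
  -- invertible by the Neumann series.
  have hinv : (fderiv ℝ (fun x : P × B => x.2 - T x) (p, u p) ∘L .inr ℝ P B).IsInvertible := by
    rw [hfd]
    have hn : ‖fderiv ℝ (fun w => T (p, w)) (u p)‖ < 1 :=
      (norm_fderiv_le_of_lipschitz ℝ hL).trans_lt (by exact_mod_cast hc)
    exact ⟨ContinuousLinearEquiv.unitsEquiv ℝ B (Units.oneSub _ hn), rfl⟩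
  have h2 := hS.contDiffAt_implicitFunction (by simp) hinv
  -- Fixed points are unique in all of `B`, so the implicit function must coincide with `u` near
  -- `p`; no continuity of `u` is needed beforehand.
  refine h2.congr_of_eventuallyEq ?_
  filter_upwards [hS.eventually_apply_implicitFunction (by simp) hinv, huniq] with q h3 h4
  refine (h4 _ ?_).symm
  simp only [hu, sub_self] at h3
  exact (sub_eq_zero.1 h3).symm

end FixedPoint

/-! ### Integral curves as fixed points -/

section Flow

universe u
variable {E : Type u} [NormedAddCommGroup E] [NormedSpace ℝ E] [CompleteSpace E]

/-- The integral operator whose fixed point is the integral curve `s ↦ w(s)`, `0 ≤ s ≤ 1`, of the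
vector field `t • X` that starts at `z`. -/
def integralOp {X : E → E} (hX : Continuous X) (t : ℝ) (z : E) (w : C(I, E)) : C(I, E) :=
  ContinuousMap.const I z + t • volterra E ((⟨X, hX⟩ : C(E, E)).comp w)

theorem lipschitzWith_integralOp {X : E → E} {L : ℝ≥0} (hL : LipschitzWith L X) {t : ℝ} (z : E)
    {ε : ℝ≥0} (ht : |t| ≤ ε) : LipschitzWith (ε * L) (integralOp hL.continuous t z) := by
  refine LipschitzWith.of_dist_le_mul fun w w' => ?_
  have h : integralOp hL.continuous t z w - integralOp hL.continuous t z w' =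
      t • volterra E ((⟨X, hL.continuous⟩ : C(E, E)).comp w -
        (⟨X, hL.continuous⟩ : C(E, E)).comp w') := by
    rw [integralOp, integralOp, map_sub, smul_sub]; abel
  rw [dist_eq_norm, h, norm_smul, dist_eq_norm]
  have h2 : ‖(⟨X, hL.continuous⟩ : C(E, E)).comp w - (⟨X, hL.continuous⟩ : C(E, E)).comp w'‖ ≤
      L * ‖w - w'‖ := by
    rw [ContinuousMap.norm_le _ (by positivity)]
    intro s
    have := hL.dist_le_mul (w s) (w' s)
    rw [dist_eq_norm, dist_eq_norm] at this
    exact this.trans (by gcongr; exact ContinuousMap.norm_coe_le_norm (w - w') s)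
  calc ‖t‖ * _ ≤ ε * (L * ‖w - w'‖) := by
        gcongr
        · exact ht
        · exact (norm_volterra_le _).trans h2
    _ = _ := by push_cast; ring

/-- This is the gain from rescaling every integral curve to `[0, 1]`: time becomes a scalar factor,
and all curves lie in one Banach space. -/
theorem contDiff_integralOp {X : E → E} (hX : ContDiff ℝ ∞ X) :
    ContDiff ℝ ∞ fun x : (ℝ × E) × C(I, E) => integralOp hX.continuous x.1.1 x.1.2 x.2 := by
  have h1 : ContDiff ℝ ∞ fun x : (ℝ × E) × C(I, E) => ContinuousLinearMap.const ℝ I x.1.2 :=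
    (ContinuousLinearMap.contDiff _).comp (contDiff_snd.comp contDiff_fst)
  have h2 : ContDiff ℝ ∞ fun x : (ℝ × E) × C(I, E) =>
      volterra E ((⟨X, hX.continuous⟩ : C(E, E)).comp x.2) :=
    (volterra E).contDiff.comp ((contDiff_postcomp hX).comp contDiff_snd)
  exact h1.add (contDiff_fst.fst.smul h2)

theorem contDiffAt_of_integralOp_eq {X : E → E} (hX : ContDiff ℝ ∞ X) {c : ℝ≥0} (hc : c < 1)
    {u : ℝ × E → C(I, E)} {p : ℝ × E} (hu : integralOp hX.continuous p.1 p.2 (u p) = u p)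
    (hL : LipschitzWith c (integralOp hX.continuous p.1 p.2))
    (huniq : ∀ᶠ q : ℝ × E in 𝓝 p, ∀ w, integralOp hX.continuous q.1 q.2 w = w → w = u q) :
    ContDiffAt ℝ ∞ u p := by
  have h := (contDiff_integralOp hX).contDiffAt (x := (p, u p))
  exact contDiffAt_fixedPoint h hu hc hL huniq

/-- A Lipschitz smooth vector field has a smooth local flow, uniformly in the initial point. -/
theorem exists_integralCurves {X : E → E} (hX : ContDiff ℝ ∞ X) {L : ℝ≥0}
    (hL : LipschitzWith L X) : ∃ ε : ℝ, 0 < ε ∧ ∃ u : ℝ × E → C(I, E),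
      ContDiffOn ℝ ∞ u (Ioo (-ε) ε ×ˢ univ) ∧
      ∀ t ∈ Ioo (-ε) ε, ∀ z w, integralOp hL.continuous t z w = w ↔ w = u (t, z) := by
  -- Chosen so that `ε * L < 1`. As `X` is globally Lipschitz, the same `ε` serves all initial
  -- points.
  set ε : ℝ≥0 := (L + 1)⁻¹ with hε
  have hc : ε * L < 1 := by
    rw [hε, inv_mul_lt_iff₀ (by positivity), mul_one]
    exact lt_add_one L
  have hcon : ∀ t ∈ Ioo (-(ε : ℝ)) ε, ∀ z, ContractingWith (ε * L)
      (integralOp hL.continuous t z) := fun t ht z =>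
    ⟨hc, lipschitzWith_integralOp hL z (abs_le.2 ⟨ht.1.le, ht.2.le⟩)⟩
  obtain ⟨u, hu⟩ : ∃ u : ℝ × E → C(I, E), ∀ t ∈ Ioo (-(ε : ℝ)) ε, ∀ z w,
      integralOp hL.continuous t z w = w ↔ w = u (t, z) := by
    classical
    refine ⟨fun x => if h : x.1 ∈ Ioo (-(ε : ℝ)) ε then (hcon x.1 h x.2).fixedPoint else 0,
      fun t ht z w => ?_⟩
    simp only [dif_pos ht]
    refine ⟨fun hw => (hcon t ht z).fixedPoint_unique hw, ?_⟩
    rintro rfl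
    exact (hcon t ht z).fixedPoint_isFixedPt
  refine ⟨ε, by positivity, u, ?_, hu⟩
  rintro ⟨t, z⟩ ⟨ht, -⟩
  refine ContDiffAt.contDiffWithinAt ?_
  have h2 : ∀ᶠ q : ℝ × E in 𝓝 (t, z), q.1 ∈ Ioo (-(ε : ℝ)) ε :=
    continuous_fst.continuousAt.preimage_mem_nhds (Ioo_mem_nhds ht.1 ht.2)
  have h3 : ∀ᶠ q : ℝ × E in 𝓝 (t, z), ∀ w, integralOp hL.continuous q.1 q.2 w = w → w = u q := by
    filter_upwards [h2] with q hq w hw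
    exact (hu q.1 hq q.2 w).1 hw
  exact contDiffAt_of_integralOp_eq hX hc ((hu t ht z _).2 rfl) (hcon t ht z).2 h3

end Flow

end FinslerHolonomy

end

section

namespace FinslerHolonomy

open Filter Topology Set
open scoped NNReal unitInterval

/-! ### Local flows and their first-order behaviour -/

section Flow

universe u
variable {E : Type u} [NormedAddCommGroup E] [NormedSpace ℝ E]

/-- A smooth local flow of `X`, defined for times in `(-ε, ε)`: `Γ t z` is the integral curve of
`t • X` on `[0, 1]` that starts at `z`. -/
structure IsFlowFor (X : E → E) (ε : ℝ) (Γ : ℝ → E → ℝ → E) : Prop where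
  contDiffOn : ContDiffOn ℝ ∞ (fun x : ℝ × E => Γ x.1 x.2 1) (Ioo (-ε) ε ×ˢ univ)
  apply_zero : ∀ t ∈ Ioo (-ε) ε, ∀ z, Γ t z 0 = z
  hasDerivWithinAt : ∀ t ∈ Ioo (-ε) ε, ∀ z, ∀ s ∈ Icc (0 : ℝ) 1,
    HasDerivWithinAt (Γ t z) (t • X (Γ t z s)) (Icc 0 1) s
  unique : ∀ t ∈ Ioo (-ε) ε, ∀ z, ∀ w : ℝ → E, w 0 = z →
    (∀ s ∈ Icc (0 : ℝ) 1, HasDerivWithinAt w (t • X (w s)) (Icc 0 1) s) →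
      ∀ s ∈ Icc (0 : ℝ) 1, w s = Γ t z s

theorem integralOp_eq_of_hasDerivWithinAt [CompleteSpace E] {X : E → E} (hX : Continuous X) {t : ℝ} {w : ℝ → E}
    (hw : ∀ s ∈ Icc (0 : ℝ) 1, HasDerivWithinAt w (t • X (w s)) (Icc 0 1) s) (w' : C(I, E))
    (hw' : ∀ s : I, w' s = w s) : integralOp hX t (w 0) w' = w' := by
  ext s
  have hcont : ContinuousOn w (Icc 0 1) := fun s hs => (hw s hs).continuousWithinAt
  have hsub : Icc 0 (s : ℝ) ⊆ Icc 0 1 := Icc_subset_Icc_right s.2.2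
  have key : ∫ θ in (0 : ℝ)..s, t • X (w θ) = w s - w 0 := by
    refine intervalIntegral.integral_eq_sub_of_hasDerivAt_of_le s.2.1 (hcont.mono hsub) ?_ ?_
    · intro θ hθ
      exact (hw θ (hsub ⟨hθ.1.le, hθ.2.le⟩)).hasDerivAt
        (Icc_mem_nhds hθ.1 (hθ.2.trans_le s.2.2))
    · refine ContinuousOn.intervalIntegrable ?_
      rw [uIcc_of_le s.2.1]
      exact continuousOn_const.smul (hX.comp_continuousOn (hcont.mono hsub))
  have h2 : primitive ((⟨X, hX⟩ : C(E, E)).comp w') s = ∫ θ in (0 : ℝ)..s, X (w θ) := by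
    refine intervalIntegral.integral_congr fun θ hθ => ?_
    rw [uIcc_of_le s.2.1] at hθ
    simp [hw', projIcc_of_mem zero_le_one (hsub hθ)]
  change w 0 + t • primitive ((⟨X, hX⟩ : C(E, E)).comp w') s = w' s
  rw [h2, ← intervalIntegral.integral_smul, key, hw']
  abel

theorem exists_isFlowFor [CompleteSpace E] {X : E → E} (hX : ContDiff ℝ ∞ X) {L : ℝ≥0} (hL : LipschitzWith L X) :
    ∃ ε : ℝ, 0 < ε ∧ ∃ Γ, IsFlowFor X ε Γ := by
  obtain ⟨ε, hε, u, hu, huniq⟩ := exists_integralCurves hX hL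
  have hval : ∀ t ∈ Ioo (-ε) ε, ∀ z, ∀ s ∈ Icc (0 : ℝ) 1, u (t, z) (projIcc 0 1 zero_le_one s) =
      z + t • primitive ((⟨X, hX.continuous⟩ : C(E, E)).comp (u (t, z))) s := by
    intro t ht z s hs
    have h := (huniq t ht z _).2 rfl
    rw [projIcc_of_mem zero_le_one hs]
    exact (congrArg (fun w : C(I, E) => w ⟨s, hs⟩) h).symm
  refine ⟨ε, hε, fun t z s => u (t, z) (projIcc 0 1 zero_le_one s), ?_, ?_, ?_, ?_⟩
  · exact (ContinuousMap.evalCLM ℝ (projIcc (0 : ℝ) 1 zero_le_one 1)).contDiff.comp_contDiffOn hu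
  · intro t ht z
    rw [hval t ht z 0 ⟨le_rfl, zero_le_one⟩, primitive, intervalIntegral.integral_same, smul_zero,
      add_zero]
  · intro t ht z s hs
    have h := ((hasDerivAt_primitive ((⟨X, hX.continuous⟩ : C(E, E)).comp (u (t, z))) s).const_smul
      t).const_add z
    exact h.hasDerivWithinAt.congr (fun s hs => hval t ht z s hs) (hval t ht z s hs)
  · rintro t ht z w rfl hw s hs
    have hcont : ContinuousOn w (Icc 0 1) := fun s hs => (hw s hs).continuousWithinAt
    let w' : C(I, E) := ⟨fun s => w s, hcont.domRestrict⟩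
    have h := (huniq t ht (w 0) w').1 (integralOp_eq_of_hasDerivWithinAt _ hw w' fun _ => rfl)
    change w s = u (t, w 0) _
    rw [← h, projIcc_of_mem zero_le_one hs]
    rfl

namespace IsFlowFor

variable {X : E → E} {ε : ℝ} {Γ : ℝ → E → ℝ → E}

/-- The curve run backwards is an integral curve of `-t • X`, so uniqueness applies. -/
theorem reverse (h : IsFlowFor X ε Γ) {t : ℝ} (ht : t ∈ Ioo (-ε) ε) (z : E) :
    Γ (-t) (Γ t z 1) 1 = z := by
  have ht' : -t ∈ Ioo (-ε) ε := ⟨by linarith [ht.2], by linarith [ht.1]⟩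
  have := h.unique (-t) ht' (Γ t z 1) (fun s => Γ t z (1 - s)) (by simp) (fun s hs => ?_) 1
    ⟨zero_le_one, le_rfl⟩
  · simpa [h.apply_zero t ht z] using this.symm
  · have hs' : 1 - s ∈ Icc (0 : ℝ) 1 := ⟨by linarith [hs.2], by linarith [hs.1]⟩
    have h1 := (h.hasDerivWithinAt t ht z _ hs').scomp s
      ((hasDerivAt_id s).const_sub 1).hasDerivWithinAt (s := Icc 0 1)
      (fun x hx => ⟨by simpa using hx.2, by simpa using hx.1⟩)
    simpa [Function.comp_def] using h1

theorem norm_sub_le (h : IsFlowFor X ε Γ) {C : ℝ} (hC : ∀ z, ‖X z‖ ≤ C) {t : ℝ}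
    (ht : t ∈ Ioo (-ε) ε) (z : E) {s : ℝ} (hs : s ∈ Icc (0 : ℝ) 1) :
    ‖Γ t z s - z‖ ≤ |t| * C := by
  have hC0 : 0 ≤ C := (norm_nonneg _).trans (hC z)
  have := (convex_Icc (0 : ℝ) 1).norm_image_sub_le_of_norm_hasDerivWithin_le (C := |t| * C)
    (h.hasDerivWithinAt t ht z) (fun s _ => by
      rw [norm_smul, Real.norm_eq_abs]; gcongr; exact hC _) (left_mem_Icc.2 zero_le_one) hs
  rw [h.apply_zero t ht z] at this
  refine this.trans (mul_le_of_le_one_right (by positivity) ?_)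
  rw [sub_zero, Real.norm_of_nonneg hs.1]
  exact hs.2

theorem apply_time_zero (h : IsFlowFor X ε Γ) (hε : 0 < ε) (z : E) {s : ℝ}
    (hs : s ∈ Icc (0 : ℝ) 1) : Γ 0 z s = z :=
  (h.unique 0 ⟨by linarith, hε⟩ z (fun _ => z) rfl (fun s _ => by
    simpa using hasDerivWithinAt_const s (Icc (0 : ℝ) 1) z) s hs).symm

/-- For small `t` the bound on `X` keeps the curve close to `z`, where `X` is within `c` of `X z`.
The mean value inequality for the difference from the straight line `s • t • X z` then leaves an
error of at most `|t| * c`. -/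
theorem hasDerivAt_time (h : IsFlowFor X ε Γ) (hε : 0 < ε) (hX : Continuous X) {C : ℝ}
    (hC : ∀ z, ‖X z‖ ≤ C) (z : E) : HasDerivAt (fun t => Γ t z 1) (X z) 0 := by
  have hC0 : 0 ≤ C := (norm_nonneg _).trans (hC z)
  rw [hasDerivAt_iff_isLittleO, Asymptotics.isLittleO_iff]
  intro c hc
  obtain ⟨δ, hδ, hXδ⟩ := Metric.continuousAt_iff.1 (hX.continuousAt (x := z)) c hc
  have hsmall : ∀ᶠ t : ℝ in 𝓝 0, |t| * C < δ := by
    have : ContinuousAt (fun t : ℝ => |t| * C) 0 := by fun_prop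
    exact this.eventually_lt continuousAt_const (by simpa using hδ)
  filter_upwards [Ioo_mem_nhds (show -ε < 0 by linarith) hε, hsmall] with t ht htδ
  have h1 : ∀ s ∈ Icc (0 : ℝ) 1, HasDerivWithinAt (fun s => Γ t z s - s • t • X z)
      (t • (X (Γ t z s) - X z)) (Icc 0 1) s := by
    intro s hs
    have := (h.hasDerivWithinAt t ht z s hs).sub
      ((hasDerivAt_id s).smul_const (t • X z)).hasDerivWithinAt
    rw [one_smul, ← smul_sub] at this
    exact this
  have h2 := (convex_Icc (0 : ℝ) 1).norm_image_sub_le_of_norm_hasDerivWithin_le (C := |t| * c)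
    h1 (fun s hs => by
      rw [norm_smul, Real.norm_eq_abs]
      gcongr
      rw [← dist_eq_norm]
      refine (hXδ ?_).le
      rw [dist_eq_norm]
      exact (h.norm_sub_le hC ht z hs).trans_lt htδ)
    (left_mem_Icc.2 zero_le_one) (right_mem_Icc.2 zero_le_one)
  rw [h.apply_zero t ht z] at h2
  rw [h.apply_time_zero hε z (right_mem_Icc.2 zero_le_one)]
  have h3 : Γ t z 1 - z - (t - 0) • X z = Γ t z 1 - (1 : ℝ) • t • X z - (z - (0 : ℝ) • t • X z) := by
    simp; abel
  rw [h3]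
  refine h2.trans (le_of_eq ?_)
  simp [mul_comm]

end IsFlowFor

end Flow

end FinslerHolonomy

end

section

namespace FinslerHolonomy

open Filter Topology Set
open scoped NNReal unitInterval

/-! ### Cutoffs, Hadamard's lemma and division by powers of time -/

section Division

universe u
variable {E F : Type u} [NormedAddCommGroup E] [NormedSpace ℝ E] [NormedAddCommGroup F]
  [NormedSpace ℝ F]

theorem exists_contDiff_cutoff [FiniteDimensional ℝ E] {K U : Set E} (hK : IsCompact K)
    (hU : IsOpen U) (hKU : K ⊆ U) : ∃ χ : E → ℝ, ContDiff ℝ ∞ χ ∧ HasCompactSupport χ ∧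
      tsupport χ ⊆ U ∧ ∀ᶠ x in 𝓝ˢ K, χ x = 1 := by
  obtain ⟨K', hK', hKK', hK'U⟩ := exists_compact_between hK hU hKU
  obtain ⟨χ, h1, h0, -⟩ := exists_contMDiffMap_one_nhds_of_subset_interior (n := ⊤)
    (modelWithCornersSelf ℝ E) hK.isClosed hKK'
  have hsub : tsupport χ ⊆ K' := closure_minimal
    (fun x hx => by by_contra h; exact hx (h0 x h)) hK'.isClosed
  exact ⟨χ, χ.contMDiff.contDiff, hK'.of_isClosed_subset (isClosed_tsupport _) hsub,
    hsub.trans hK'U, h1⟩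

/-- Extension by zero: a point outside `U` is outside the closed support, so the product vanishes
near it whatever values `f` takes there. -/
theorem contDiff_smul_of_tsupport_subset {χ : E → ℝ} (hχ : ContDiff ℝ ∞ χ) {U : Set E}
    (hU : IsOpen U) (hsub : tsupport χ ⊆ U) {f : E → F} (hf : ContDiffOn ℝ ∞ f U) :
    ContDiff ℝ ∞ fun x => χ x • f x := by
  rw [contDiff_iff_contDiffAt]
  intro x
  by_cases hx : x ∈ U
  · exact hχ.contDiffAt.smul (hf.contDiffAt (hU.mem_nhds hx))
  · have h0 : (fun x => χ x • f x) =ᶠ[𝓝 x] fun _ => 0 := by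
      filter_upwards [(isClosed_tsupport χ).isOpen_compl.mem_nhds fun h => hx (hsub h)] with y hy
      rw [image_eq_zero_of_notMem_tsupport hy, zero_smul]
    exact contDiffAt_const.congr_of_eventuallyEq h0

theorem exists_contDiff_eventuallyEq [FiniteDimensional ℝ E] {f : E → F} {U : Set E}
    (hU : IsOpen U) (hf : ContDiffOn ℝ ∞ f U) {z : E} (hz : z ∈ U) :
    ∃ g : E → F, ContDiff ℝ ∞ g ∧ g =ᶠ[𝓝 z] f := by
  obtain ⟨χ, hχ, -, hsub, h1⟩ := exists_contDiff_cutoff isCompact_singleton hU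
    (singleton_subset_iff.2 hz)
  rw [nhdsSet_singleton] at h1
  refine ⟨_, contDiff_smul_of_tsupport_subset hχ hU hsub hf, ?_⟩
  filter_upwards [h1] with x hx
  rw [hx, one_smul]

/-- Hadamard's lemma with parameters. -/
theorem exists_eq_add_smul [CompleteSpace F] {f : ℝ × E → F} (hf : ContDiff ℝ ∞ f) :
    ∃ g : ℝ × E → F, ContDiff ℝ ∞ g ∧ ∀ t y, f (t, y) = f (0, y) + t • g (t, y) := by
  have hd : ContDiff ℝ ∞ fun x => fderiv ℝ f x (1, 0) :=
    (hf.fderiv_right (by simp)).clm_apply contDiff_const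
  -- The segment `θ ↦ (θ * t, y)`. The quotient is the integral over it of the time derivative of
  -- `f`; its smoothness comes from the superposition and integration operators, without
  -- differentiating under the integral sign.
  let w : ℝ × E → C(I, ℝ × E) := fun x =>
    x.1 • (⟨fun θ => ((θ : ℝ), 0), by fun_prop⟩ : C(I, ℝ × E)) +
      ContinuousLinearMap.const ℝ I ((0, x.2) : ℝ × E)
  have hw : ContDiff ℝ ∞ w := by
    have h1 : ContDiff ℝ ∞ fun x : ℝ × E => ContinuousLinearMap.const ℝ I ((0, x.2) : ℝ × E) :=
      (ContinuousLinearMap.contDiff _).comp (contDiff_const.prodMk contDiff_snd)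
    exact (contDiff_fst.smul contDiff_const).add h1
  have hv : ContDiff ℝ ∞ fun x => volterra F ((⟨_, hd.continuous⟩ : C(ℝ × E, F)).comp (w x)) :=
    (volterra F).contDiff.comp ((contDiff_postcomp hd).comp hw)
  refine ⟨fun x => volterra F ((⟨_, hd.continuous⟩ : C(ℝ × E, F)).comp (w x)) 1,
    (ContinuousMap.evalCLM (M := F) ℝ (1 : I)).contDiff.comp hv, fun t y => ?_⟩
  have h1 : ∀ s ∈ uIcc (0 : ℝ) 1, HasDerivAt (fun s : ℝ => f (s * t, y))
      (t • fderiv ℝ f (s * t, y) (1, 0)) s := by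
    intro s _
    have h2 := (hf.differentiable (by simp) (s * t, y)).hasFDerivAt.comp_hasDerivAt s
      (((hasDerivAt_id s).mul_const t).prodMk (hasDerivAt_const s y))
    have h3 : ((1 * t, 0) : ℝ × E) = t • (1, 0) := by simp
    rw [h3, map_smul] at h2
    exact h2
  have h2 := intervalIntegral.integral_eq_sub_of_hasDerivAt h1 (by
    refine Continuous.intervalIntegrable ?_ _ _
    exact continuous_const.smul (hd.continuous.comp (by fun_prop)))
  rw [intervalIntegral.integral_smul, one_mul, zero_mul] at h2
  have h3 : volterra F ((⟨_, hd.continuous⟩ : C(ℝ × E, F)).comp (w (t, y))) 1 =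
      ∫ s in (0 : ℝ)..1, fderiv ℝ f (s * t, y) (1, 0) := by
    refine intervalIntegral.integral_congr fun θ hθ => ?_
    rw [Icc.coe_one, uIcc_of_le zero_le_one] at hθ
    simp [projIcc_of_mem zero_le_one hθ, w, mul_comm]
  simp only [h3, h2]
  abel

/-- One derivative turns `t ^ (k + 1) • h` into `t ^ k` times a new smooth function whose value at
`0` is `(k + 1) • h 0`. The induction therefore runs over all `h`, and these factors multiply to
`k!`. -/
theorem iteratedDeriv_pow_smul {h : ℝ → F} (hh : ContDiff ℝ ∞ h) (k : ℕ) :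
    (∀ j < k, iteratedDeriv j (fun t => t ^ k • h t) 0 = 0) ∧
      iteratedDeriv k (fun t => t ^ k • h t) 0 = (k.factorial : ℝ) • h 0 := by
  induction k generalizing h with
  | zero => simp
  | succ k ih =>
    have hd : ContDiff ℝ ∞ (deriv h) := (contDiff_infty_iff_deriv.1 hh).2
    have h1 : deriv (fun t => t ^ (k + 1) • h t) =
        fun t => t ^ k • (((k + 1 : ℕ) : ℝ) • h t + t • deriv h t) := by
      funext t
      have := ((hasDerivAt_pow (k + 1) t).smul
        ((hh.differentiable (by simp)) t).hasDerivAt).deriv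
      refine this.trans ?_
      rw [smul_add, smul_smul, smul_smul, add_comm, ← pow_succ, mul_comm, Nat.add_sub_cancel]
    have h2 := ih (h := fun t => ((k + 1 : ℕ) : ℝ) • h t + t • deriv h t)
      ((contDiff_const.smul hh).add (contDiff_id.smul hd))
    constructor
    · rintro (_ | j) hj
      · simp
      · rw [iteratedDeriv_succ', h1]
        exact h2.1 j (by omega)
    · rw [iteratedDeriv_succ', h1, h2.2, zero_smul, add_zero, smul_smul, Nat.factorial_succ]
      push_cast
      ring_nf

/-- A smooth function whose `t`-derivatives of order less than `k` vanish at `t = 0` is divisible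
by `t ^ k`. -/
theorem exists_eq_pow_smul [CompleteSpace F] {f : ℝ × E → F} (hf : ContDiff ℝ ∞ f) (k : ℕ) :
    ∃ A : ℝ × E → F, ContDiff ℝ ∞ A ∧
      ∀ y, (∀ j < k, iteratedDeriv j (fun t => f (t, y)) 0 = 0) →
        ∀ t, f (t, y) = t ^ k • A (t, y) := by
  induction k with
  | zero => exact ⟨f, hf, by simp⟩
  | succ k ih =>
    obtain ⟨A, hA, hfA⟩ := ih
    obtain ⟨B, hB, hAB⟩ := exists_eq_add_smul hA
    refine ⟨B, hB, fun y hy t => ?_⟩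
    have h1 := hfA y fun j hj => hy j (by omega)
    have h2 := hy k (by omega)
    rw [funext h1, (iteratedDeriv_pow_smul (h := fun t => A (t, y)) (by fun_prop) k).2] at h2
    have h3 : A (0, y) = 0 :=
      -- The `k`-th derivative at `0` is `k!` times the value of the quotient, so that value
      -- vanishes and one more factor of `t` can be split off.
      (smul_eq_zero.1 h2).resolve_left (by exact_mod_cast k.factorial_ne_zero)
    rw [h1, hAB, h3, zero_add, smul_smul, pow_succ]

/-- Local version of `exists_eq_pow_smul`, with the value of the quotient at `t = 0`. -/
theorem exists_eventually_eq_pow_smul [FiniteDimensional ℝ E] [CompleteSpace F] {f : ℝ × E → F}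
    {U : Set (ℝ × E)} (hU : IsOpen U) (hf : ContDiffOn ℝ ∞ f U) {z : E} (hz : (0, z) ∈ U) {k : ℕ}
    (hk : ∀ᶠ y in 𝓝 z, ∀ j < k, iteratedDeriv j (fun t => f (t, y)) 0 = 0) :
    ∃ A : ℝ × E → F, ContDiff ℝ ∞ A ∧ (∀ᶠ x in 𝓝 ((0 : ℝ), z), f x = x.1 ^ k • A x) ∧
      ∀ᶠ y in 𝓝 z, A (0, y) = (k.factorial : ℝ)⁻¹ • iteratedDeriv k (fun t => f (t, y)) 0 := by
  obtain ⟨g, hg, hgf⟩ := exists_contDiff_eventuallyEq hU hf hz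
  obtain ⟨A, hA, hgA⟩ := exists_eq_pow_smul hg k
  -- The globally smooth replacement `g` agrees with `f` near `(0, z)`, so for `y` near `z` both
  -- have the same time derivatives at `0`.
  have hev : ∀ᶠ y in 𝓝 z, (fun t => g (t, y)) =ᶠ[𝓝 0] fun t => f (t, y) := by
    have h1 := eventually_eventually_nhds.2 hgf
    have h2 : ContinuousAt (fun y : E => ((0 : ℝ), y)) z := by fun_prop
    filter_upwards [h2.eventually h1] with y hy
    have h3 : ContinuousAt (fun t : ℝ => (t, y)) 0 := by fun_prop
    exact h3.eventually hy
  have hgood : ∀ᶠ y in 𝓝 z, ∀ t, g (t, y) = t ^ k • A (t, y) := by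
    filter_upwards [hev, hk] with y h1 h2
    exact hgA y fun j hj => by rw [h1.iteratedDeriv_eq, h2 j hj]
  refine ⟨A, hA, ?_, ?_⟩
  · have h1 : ContinuousAt (fun x : ℝ × E => x.2) (0, z) := by fun_prop
    filter_upwards [hgf, h1.eventually hgood] with x h2 h3
    rw [← h2]
    exact h3 x.1
  · filter_upwards [hgood, hev] with y h1 h2
    rw [← h2.iteratedDeriv_eq, funext h1,
      (iteratedDeriv_pow_smul (h := fun t => A (t, y)) (by fun_prop) k).2, smul_smul,
      inv_mul_cancel₀ (by exact_mod_cast k.factorial_ne_zero), one_smul]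

/-- Taylor coefficients are determined by the asymptotic behaviour. -/
theorem iteratedDeriv_of_tendsto {F : Type} [NormedAddCommGroup F] [NormedSpace ℝ F]
    [CompleteSpace F] {f : ℝ → F} {ε : ℝ} (hε : 0 < ε)
    (hf : ContDiffOn ℝ ∞ f (Ioo (-ε) ε)) {v w : F} {k : ℕ} (hk : 1 ≤ k)
    (hlim : Tendsto (fun t => (t ^ k)⁻¹ • (f t - v)) (𝓝[≠] 0) (𝓝 w)) :
    (∀ j, 1 ≤ j → j < k → iteratedDeriv j f 0 = 0) ∧
      iteratedDeriv k f 0 = (k.factorial : ℝ) • w := by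
  obtain ⟨g, hg, hgf⟩ := exists_contDiff_eventuallyEq (f := fun t => f t - v) isOpen_Ioo
    (hf.sub contDiffOn_const) (show (0 : ℝ) ∈ Ioo (-ε) ε from ⟨by linarith, hε⟩)
  have hlim' : Tendsto (fun t => (t ^ k)⁻¹ • g t) (𝓝[≠] 0) (𝓝 w) := by
    refine hlim.congr' ?_
    filter_upwards [nhdsWithin_le_nhds hgf] with t ht
    rw [ht]
  have hdiv : ∀ j ≤ k, ∃ A : ℝ → F, ContDiff ℝ ∞ A ∧ ∀ t, g t = t ^ j • A t := by
    intro j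
    induction j with
    | zero => exact fun _ => ⟨g, hg, by simp⟩
    | succ j ih =>
      intro hj
      obtain ⟨A, hA, hgA⟩ := ih (by omega)
      obtain ⟨B, hB, hAB⟩ := exists_eq_add_smul (f := fun x : ℝ × ℝ => A x.1)
        (hA.comp contDiff_fst)
      -- Away from `0`, `A t` is `t ^ (k - j)` times the convergent quotient; since `j < k`, it
      -- tends to `0`.
      have h0 : A 0 = 0 := by
        have h1 : Tendsto A (𝓝[≠] 0) (𝓝 (A 0)) := hA.continuous.continuousAt.mono_left nhdsWithin_le_nhds
        have h2 : Tendsto (fun t : ℝ => t ^ (k - j) • (t ^ k)⁻¹ • g t) (𝓝[≠] 0) (𝓝 ((0 : ℝ) • w)) := by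
          refine Tendsto.smul ?_ hlim'
          have : ContinuousAt (fun t : ℝ => t ^ (k - j)) 0 := by fun_prop
          have h3 := this.tendsto.mono_left (nhdsWithin_le_nhds (s := {0}ᶜ))
          rwa [zero_pow (by omega)] at h3
        rw [zero_smul] at h2
        refine tendsto_nhds_unique (h1.congr' ?_) h2
        filter_upwards [self_mem_nhdsWithin] with t ht
        have ht' : t ≠ 0 := ht
        have hkj : t ^ k = t ^ (k - j) * t ^ j := by rw [← pow_add]; congr 1; omega
        rw [hgA t, smul_smul, smul_smul, hkj]
        field_simp
        simp
      refine ⟨fun t => B (t, 0), by fun_prop, fun t => ?_⟩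
      have h1 := hAB t 0
      simp only [h0, zero_add] at h1
      rw [hgA, h1, smul_smul, pow_succ]
  obtain ⟨A, hA, hgA⟩ := hdiv k le_rfl
  have hA0 : A 0 = w := by
    have h1 : Tendsto A (𝓝[≠] 0) (𝓝 (A 0)) := hA.continuous.continuousAt.mono_left nhdsWithin_le_nhds
    refine tendsto_nhds_unique (h1.congr' ?_) hlim'
    filter_upwards [self_mem_nhdsWithin] with t ht
    have ht' : t ≠ 0 := ht
    rw [hgA, smul_smul, inv_mul_cancel₀ (pow_ne_zero _ ht'), one_smul]
  have hfg : f =ᶠ[𝓝 0] fun t => v + g t := by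
    filter_upwards [hgf] with t ht
    rw [ht]; abel
  have hder : ∀ j, 1 ≤ j → iteratedDeriv j f 0 = iteratedDeriv j (fun t => t ^ k • A t) 0 := by
    intro j hj
    rw [hfg.iteratedDeriv_eq, ← funext hgA, iteratedDeriv_const_add (by omega)]
  have h1 := iteratedDeriv_pow_smul hA k
  exact ⟨fun j hj hjk => by rw [hder j hj, h1.1 j hjk], by rw [hder k hk, h1.2, hA0]⟩

end Division

/-! ### The leading term of a commutator -/

section Commutator

variable {E : Type*} [NormedAddCommGroup E] [NormedSpace ℝ E]

/-- Both points at which `B` is evaluated move with `t`, so strict differentiability is what is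
needed. Their difference has no time component, hence only `B' (0, ·)` enters the limit. -/
theorem tendsto_difference_quotient {B : ℝ × E → E} {B' : ℝ × E →L[ℝ] E} {z : E}
    (hB : HasStrictFDerivAt B B' (0, z)) {y a : ℝ → E} {a₀ : E}
    (hy : Tendsto y (𝓝[≠] 0) (𝓝 z)) (ha : Tendsto a (𝓝[≠] 0) (𝓝 a₀)) {k : ℕ} (hk : 1 ≤ k) :
    Tendsto (fun t => (t ^ k)⁻¹ • (B (t, y t + t ^ k • a t) - B (t, y t))) (𝓝[≠] 0)
      (𝓝 (B' (0, a₀))) := by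
  have hid : Tendsto (fun t : ℝ => t) (𝓝[≠] 0) (𝓝 0) := nhdsWithin_le_nhds
  have hpow : Tendsto (fun t : ℝ => t ^ k) (𝓝[≠] 0) (𝓝 0) := by
    have := hid.pow k
    rwa [zero_pow (by omega)] at this
  have hpa : Tendsto (fun t => y t + t ^ k • a t) (𝓝[≠] 0) (𝓝 z) := by
    have := hy.add (hpow.smul ha)
    rwa [zero_smul, add_zero] at this
  have h1 := hB.isLittleO.comp_tendsto
    ((hid.prodMk_nhds hpa).prodMk_nhds (hid.prodMk_nhds hy))
  have h2 : Tendsto (fun t => (t ^ k)⁻¹ • (B (t, y t + t ^ k • a t) - B (t, y t)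
      - B' (0, t ^ k • a t))) (𝓝[≠] 0) (𝓝 0) := by
    have h3 : (fun t => B (t, y t + t ^ k • a t) - B (t, y t) - B' (0, t ^ k • a t))
        =o[𝓝[≠] 0] fun t : ℝ => t ^ k := by
      have h4 : (fun t => ((0 : ℝ), t ^ k • a t)) =O[𝓝[≠] 0] fun t : ℝ => t ^ k := by
        have h5 : (fun t => ((0 : ℝ), a t)) =O[𝓝[≠] 0] fun _ => (1 : ℝ) :=
          (tendsto_const_nhds.prodMk_nhds ha).isBigO_one ℝ
        have h6 := (Asymptotics.isBigO_refl (fun t : ℝ => t ^ k) (𝓝[≠] 0)).smul h5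
        simpa using h6
      refine Asymptotics.IsLittleO.trans_isBigO (h1.congr (fun t => ?_) fun t => ?_) h4
      · simp only [Function.comp_apply, Prod.mk_sub_mk, sub_self, add_sub_cancel_left]
      · simp only [Function.comp_apply, Prod.mk_sub_mk, sub_self, add_sub_cancel_left]
    exact h3.tendsto_inv_smul_nhds_zero
  have h3 : Tendsto (fun t => B' (0, a t)) (𝓝[≠] 0) (𝓝 (B' (0, a₀))) :=
    (B'.continuous.tendsto _).comp (tendsto_const_nhds.prodMk_nhds ha)
  have h4 := h2.add h3
  rw [zero_add] at h4
  refine h4.congr' ?_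
  filter_upwards [self_mem_nhdsWithin] with t ht
  have ht' : t ^ k ≠ 0 := pow_ne_zero _ ht
  have h5 : ((0 : ℝ), t ^ k • a t) = t ^ k • ((0 : ℝ), a t) := by simp
  rw [h5, map_smul, smul_sub, smul_smul, inv_mul_cancel₀ ht', one_smul, sub_add_cancel]

/-- The leading term of the commutator of `y ↦ y + t ^ k A(t, y)` and `y ↦ y + t ^ l B(t, y)`. -/
theorem tendsto_commutator {φ ψ A B : ℝ × E → E} {A' B' : ℝ × E →L[ℝ] E} {z : E}
    (hA : HasStrictFDerivAt A A' (0, z)) (hB : HasStrictFDerivAt B B' (0, z)) {k l : ℕ}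
    (hk : 1 ≤ k) (hl : 1 ≤ l) (hφ : ∀ᶠ x in 𝓝 ((0 : ℝ), z), φ x = x.2 + x.1 ^ k • A x)
    (hψ : ∀ᶠ x in 𝓝 ((0 : ℝ), z), ψ x = x.2 + x.1 ^ l • B x) {y : ℝ → E}
    (hy : Tendsto y (𝓝[≠] 0) (𝓝 z)) :
    Tendsto (fun t => (t ^ (k + l))⁻¹ • (ψ (t, φ (t, y t)) - φ (t, ψ (t, y t)))) (𝓝[≠] 0)
      (𝓝 (B' (0, A (0, z)) - A' (0, B (0, z)))) := by
  have hid : Tendsto (fun t : ℝ => t) (𝓝[≠] 0) (𝓝 0) := nhdsWithin_le_nhds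
  have hty : Tendsto (fun t => (t, y t)) (𝓝[≠] 0) (𝓝 (0, z)) := hid.prodMk_nhds hy
  have hAy := hA.continuousAt.tendsto.comp hty
  have hBy := hB.continuousAt.tendsto.comp hty
  have hpow : ∀ {m : ℕ}, 1 ≤ m → Tendsto (fun t : ℝ => t ^ m) (𝓝[≠] 0) (𝓝 0) := by
    intro m hm
    have := hid.pow m
    rwa [zero_pow (by omega)] at this
  have hty' : ∀ {m : ℕ} (_ : 1 ≤ m) {C : ℝ × E → E} {c : E}, Tendsto (C ∘ fun t => (t, y t))
      (𝓝[≠] 0) (𝓝 c) → Tendsto (fun t => (t, y t + t ^ m • C (t, y t))) (𝓝[≠] 0) (𝓝 (0, z)) := by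
    intro m hm C c hC
    have := hy.add ((hpow hm).smul hC)
    rw [zero_smul, add_zero] at this
    exact hid.prodMk_nhds this
  have h1 := tendsto_difference_quotient hB hy hAy hk
  have h2 := tendsto_difference_quotient hA hy hBy hl
  -- After inserting the expansions the zeroth-order and linear terms cancel. What remains is `t ^
  -- l` times an increment of `B` over `t ^ k • A`, minus `t ^ k` times an increment of `A` over `t
  -- ^ l • B`.
  refine (h1.sub h2).congr' ?_
  filter_upwards [self_mem_nhdsWithin, hty.eventually hφ, hty.eventually hψ,
    (hty' hk hAy).eventually hψ, (hty' hl hBy).eventually hφ] with t ht e1 e2 e3 e4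
  have ht' : t ≠ 0 := ht
  rw [e1, e2, e3, e4]
  have hk' : (t ^ k)⁻¹ = (t ^ (k + l))⁻¹ * t ^ l := by rw [pow_add]; field_simp
  have hl' : (t ^ l)⁻¹ = (t ^ (k + l))⁻¹ * t ^ k := by rw [pow_add]; field_simp
  rw [hk', hl']
  simp only [Function.comp_apply, mul_smul, ← smul_sub]
  congr 1
  simp only [smul_sub]
  abel

end Commutator

end FinslerHolonomy

end

/-! ### Diffeomorphisms of the indicatrix through homogeneous extension -/

section

namespace FinslerHolonomy

open Filter Topology Set

namespace FinslerMetric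

variable {n : ℕ} {M : Type*} [TopologicalSpace M] [ChartedSpace (EuclideanSpace ℝ (Fin n)) M]
  [IsManifold (𝓡 n) ∞ M] (F : FinslerMetric n M) {p : M}

/-- The positively homogeneous extension to `T_pM` of a diffeomorphism of the indicatrix. -/
def homExt (φ : diffGroup (F.indicatrix p)) : EuclideanSpace ℝ (Fin n) →
    EuclideanSpace ℝ (Fin n) :=
  F.extend p fun v => ((φ : Equiv.Perm (F.indicatrix p)) v : EuclideanSpace ℝ (Fin n))

theorem homExt_apply (φ : diffGroup (F.indicatrix p)) {y : EuclideanSpace ℝ (Fin n)}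
    (hy : y ≠ 0) : F.homExt φ y = F.normAt p y •
      ((φ : Equiv.Perm (F.indicatrix p)) ⟨(F.normAt p y)⁻¹ • y, F.inv_smul_mem p hy⟩).1 :=
  F.extend_apply p _ hy

theorem homExt_coe (φ : diffGroup (F.indicatrix p)) (v : F.indicatrix p) :
    F.homExt φ v = ((φ : Equiv.Perm (F.indicatrix p)) v).1 :=
  F.extend_coe p _ v

theorem homExt_zero (φ : diffGroup (F.indicatrix p)) : F.homExt φ 0 = 0 :=
  dif_neg (by simp)

theorem homExt_smul (φ : diffGroup (F.indicatrix p)) {y : EuclideanSpace ℝ (Fin n)}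
    (hy : y ≠ 0) {a : ℝ} (ha : 0 < a) : F.homExt φ (a • y) = a • F.homExt φ y :=
  F.extend_smul p _ hy ha

theorem homExt_ne_zero (φ : diffGroup (F.indicatrix p)) {y : EuclideanSpace ℝ (Fin n)}
    (hy : y ≠ 0) : F.homExt φ y ≠ 0 := by
  rw [F.homExt_apply φ hy]
  exact smul_ne_zero (F.normAt_pos p hy).ne' (F.ne_zero_of_mem (Subtype.mem _))

theorem homExt_mul (φ ψ : diffGroup (F.indicatrix p)) (y : EuclideanSpace ℝ (Fin n)) :
    F.homExt (φ * ψ) y = F.homExt φ (F.homExt ψ y) := by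
  by_cases hy : y = 0
  · simp [hy, homExt_zero]
  · rw [F.homExt_apply ψ hy, F.homExt_smul φ (F.ne_zero_of_mem (Subtype.mem _))
      (F.normAt_pos p hy), F.homExt_coe, F.homExt_apply _ hy]
    rfl

theorem homExt_one (y : EuclideanSpace ℝ (Fin n)) :
    F.homExt (1 : diffGroup (F.indicatrix p)) y = y := by
  by_cases hy : y = 0
  · rw [hy, homExt_zero]
  · rw [F.homExt_apply _ hy]
    change F.normAt p y • (F.normAt p y)⁻¹ • y = y
    rw [smul_smul, mul_inv_cancel₀ (F.normAt_pos p hy).ne', one_smul]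

theorem homExt_inv_apply (φ : diffGroup (F.indicatrix p)) (y : EuclideanSpace ℝ (Fin n)) :
    F.homExt φ⁻¹ (F.homExt φ y) = y := by
  rw [← homExt_mul, inv_mul_cancel, homExt_one]

theorem homExt_apply_inv (φ : diffGroup (F.indicatrix p)) (y : EuclideanSpace ℝ (Fin n)) :
    F.homExt φ (F.homExt φ⁻¹ y) = y := by
  rw [← homExt_mul, mul_inv_cancel, homExt_one]

theorem contDiffAt_homExt (φ : diffGroup (F.indicatrix p)) {y : EuclideanSpace ℝ (Fin n)}
    (hy : y ≠ 0) : ContDiffAt ℝ ∞ (F.homExt φ) y :=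
  F.contDiffAt_extend φ.2.1 hy

/-- The chain rule applied to `homExt φ⁻¹ ∘ homExt φ = id`, and to the same identity for `φ⁻¹`,
yields a two-sided inverse. -/
theorem isInvertible_fderiv_homExt (φ : diffGroup (F.indicatrix p))
    {y : EuclideanSpace ℝ (Fin n)} (hy : y ≠ 0) : (fderiv ℝ (F.homExt φ) y).IsInvertible := by
  have key : ∀ (χ : diffGroup (F.indicatrix p)) {x : EuclideanSpace ℝ (Fin n)}, x ≠ 0 →
      ∀ w, fderiv ℝ (F.homExt χ⁻¹) (F.homExt χ x) (fderiv ℝ (F.homExt χ) x w) = w := by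
    intro χ x hx w
    have h1 := ((F.contDiffAt_homExt χ⁻¹ (F.homExt_ne_zero χ hx)).differentiableAt
      (by simp)).hasFDerivAt.comp x ((F.contDiffAt_homExt χ hx).differentiableAt
      (by simp)).hasFDerivAt
    have h2 : F.homExt χ⁻¹ ∘ F.homExt χ = id := funext (F.homExt_inv_apply χ)
    rw [h2] at h1
    exact congrArg (fun L => L w) (h1.unique (hasFDerivAt_id x))
  refine ⟨ContinuousLinearEquiv.equivOfInverse (fderiv ℝ (F.homExt φ) y)
    (fderiv ℝ (F.homExt φ⁻¹) (F.homExt φ y)) (key φ hy) fun w => ?_, rfl⟩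
  have := key φ⁻¹ (F.homExt_ne_zero φ hy) w
  rwa [inv_inv, F.homExt_inv_apply] at this

variable {G : Subgroup (diffGroup (F.indicatrix p))} {ε : ℝ} {φ ψ : ℝ → diffGroup (F.indicatrix p)}

theorem isOpen_timeDomain (ε : ℝ) :
    IsOpen (Ioo (-ε) ε ×ˢ ({0}ᶜ : Set (EuclideanSpace ℝ (Fin n)))) :=
  isOpen_Ioo.prod isOpen_compl_singleton

theorem contDiffOn_homExt (h : IsSmoothCurveIn G ε φ) :
    ContDiffOn ℝ ∞ (fun x : ℝ × EuclideanSpace ℝ (Fin n) => F.homExt (φ x.1) x.2)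
      (Ioo (-ε) ε ×ˢ {0}ᶜ) := by
  rintro ⟨t, y⟩ ⟨ht, hy⟩
  obtain ⟨U, hU, haU, g, hg, hgf⟩ := h.2 (⟨t, ht⟩, ⟨_, F.inv_smul_mem p hy⟩)
  have hN : ContDiffAt ℝ ∞ (fun x : ℝ × EuclideanSpace ℝ (Fin n) => F.normAt p x.2) (t, y) :=
    ContDiffAt.comp (g := F.normAt p) (t, y) (F.contDiffAt_normAt p hy) contDiffAt_snd
  have h1 : ContDiffAt ℝ ∞ (fun x : ℝ × EuclideanSpace ℝ (Fin n) =>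
      (x.1, (F.normAt p x.2)⁻¹ • x.2)) (t, y) :=
    contDiffAt_fst.prodMk ((hN.inv (F.normAt_pos p hy).ne').smul contDiffAt_snd)
  have h2 := hN.smul (ContDiffAt.comp (t, y) (hg.contDiffAt (hU.mem_nhds haU)) h1)
  refine (h2.congr_of_eventuallyEq ?_).contDiffWithinAt
  filter_upwards [(isOpen_timeDomain ε).mem_nhds ⟨ht, hy⟩,
    h1.continuousAt.preimage_mem_nhds (hU.mem_nhds haU)] with x hx hxU
  rw [F.homExt_apply _ hx.2]
  exact congrArg (F.normAt p x.2 • ·) (hgf (⟨x.1, hx.1⟩, ⟨_, F.inv_smul_mem p hx.2⟩) hxU)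

/-- The smooth map `Ψ` need agree with the curve only on the indicatrix. For parallel translations
it comes from flows in the chart and need not be the homogeneous extension. -/
theorem isSmoothCurveIn_of_contDiffOn (hG : ∀ t ∈ Ioo (-ε) ε, φ t ∈ G)
    {W : Set (ℝ × EuclideanSpace ℝ (Fin n))} (hW : IsOpen W)
    {Ψ : ℝ × EuclideanSpace ℝ (Fin n) → EuclideanSpace ℝ (Fin n)} (hΨ : ContDiffOn ℝ ∞ Ψ W)
    (hWmem : ∀ t ∈ Ioo (-ε) ε, ∀ v : F.indicatrix p, (t, v.1) ∈ W)
    (heq : ∀ t ∈ Ioo (-ε) ε, ∀ v : F.indicatrix p,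
      ((φ t : Equiv.Perm (F.indicatrix p)) v).1 = Ψ (t, v.1)) : IsSmoothCurveIn G ε φ :=
  ⟨hG, fun a => ⟨W, hW, hWmem _ a.1.2 a.2, Ψ, hΨ, fun b _ => heq _ b.1.2 b.2⟩⟩

theorem isSmoothCurveIn_of_contDiffOn_homExt (hG : ∀ t ∈ Ioo (-ε) ε, φ t ∈ G)
    (h : ContDiffOn ℝ ∞ (fun x : ℝ × EuclideanSpace ℝ (Fin n) => F.homExt (φ x.1) x.2)
      (Ioo (-ε) ε ×ˢ {0}ᶜ)) : IsSmoothCurveIn G ε φ :=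
  F.isSmoothCurveIn_of_contDiffOn hG (isOpen_timeDomain ε) h
    (fun _ ht v => ⟨ht, F.ne_zero_of_mem v.2⟩) fun _ _ v => (F.homExt_coe _ v).symm

theorem IsSmoothCurveIn.mono (h : IsSmoothCurveIn G ε φ) {ε' : ℝ} (hε : ε' ≤ ε) :
    IsSmoothCurveIn G ε' φ :=
  F.isSmoothCurveIn_of_contDiffOn_homExt (fun t ht => h.1 t ⟨by linarith [ht.1], by linarith [ht.2]⟩)
    ((F.contDiffOn_homExt h).mono
      (prod_mono (Ioo_subset_Ioo (by linarith) hε) le_rfl))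

theorem IsSmoothCurveIn.mul (hφ : IsSmoothCurveIn G ε φ) (hψ : IsSmoothCurveIn G ε ψ) :
    IsSmoothCurveIn G ε fun t => φ t * ψ t := by
  refine F.isSmoothCurveIn_of_contDiffOn_homExt
    (fun t ht => G.mul_mem (hφ.1 t ht) (hψ.1 t ht)) ?_
  simp only [homExt_mul]
  exact (F.contDiffOn_homExt hφ).comp (contDiffOn_fst.prodMk (F.contDiffOn_homExt hψ))
    fun x hx => ⟨hx.1, F.homExt_ne_zero _ hx.2⟩

/-- The implicit function theorem solves `homExt (φ t) x = y` smoothly in `(t, y)`. Injectivity of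
`homExt (φ t)` identifies the solution with the inverse. -/
theorem IsSmoothCurveIn.inv (hφ : IsSmoothCurveIn G ε φ) :
    IsSmoothCurveIn G ε fun t => (φ t)⁻¹ := by
  refine F.isSmoothCurveIn_of_contDiffOn_homExt (fun t ht => G.inv_mem (hφ.1 t ht)) ?_
  rintro ⟨t, y⟩ ⟨ht, hy⟩
  refine ContDiffAt.contDiffWithinAt ?_
  have hx := F.homExt_ne_zero (φ t)⁻¹ hy
  set x := F.homExt (φ t)⁻¹ y with hxdef
  have hΦ : ContDiffAt ℝ ∞ (fun x : ℝ × EuclideanSpace ℝ (Fin n) => F.homExt (φ x.1) x.2) (t, x) :=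
    (F.contDiffOn_homExt hφ).contDiffAt ((isOpen_timeDomain ε).mem_nhds ⟨ht, hx⟩)
  let f : (ℝ × EuclideanSpace ℝ (Fin n)) × EuclideanSpace ℝ (Fin n) → EuclideanSpace ℝ (Fin n) :=
    fun z => F.homExt (φ z.1.1) z.2 - z.1.2
  have hf : ContDiffAt ℝ ∞ f ((t, y), x) :=
    (ContDiffAt.comp (f := fun z : (ℝ × EuclideanSpace ℝ (Fin n)) × EuclideanSpace ℝ (Fin n) =>
      (z.1.1, z.2)) ((t, y), x) hΦ
      (contDiffAt_fst.fst.prodMk contDiffAt_snd)).sub contDiffAt_fst.snd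
  have hinv : (fderiv ℝ f ((t, y), x) ∘L .inr ℝ _ _).IsInvertible := by
    have h1 : HasFDerivAt (fun w => f ((t, y), w)) (fderiv ℝ f ((t, y), x) ∘L .inr ℝ _ _) x :=
      HasFDerivAt.comp x (hf.differentiableAt (by simp)).hasFDerivAt
        (hasFDerivAt_prodMk_right (t, y) x)
    have h2 : HasFDerivAt (fun w => f ((t, y), w)) (fderiv ℝ (F.homExt (φ t)) x) x :=
      ((F.contDiffAt_homExt (φ t) hx).differentiableAt (by simp)).hasFDerivAt.sub_const y
    rw [h1.unique h2]
    exact F.isInvertible_fderiv_homExt (φ t) hx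
  refine (hf.contDiffAt_implicitFunction (by simp) hinv).congr_of_eventuallyEq ?_
  filter_upwards [hf.eventually_apply_implicitFunction (by simp) hinv] with z hz
  have h0 : f ((t, y), x) = 0 := by simp [f, hxdef, F.homExt_apply_inv]
  rw [h0] at hz
  have h1 := sub_eq_zero.1 hz
  change F.homExt (φ z.1)⁻¹ z.2 = _
  rw [← h1, F.homExt_inv_apply]

theorem IsSmoothCurveIn.comp (h : IsSmoothCurveIn G ε φ) (hε : 0 < ε) {g : ℝ → ℝ}
    (hg : ContDiff ℝ ∞ g) (hg0 : g 0 = 0) : ∃ ε' > 0, IsSmoothCurveIn G ε' fun t => φ (g t) := by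
  obtain ⟨δ, hδ, hgδ⟩ := Metric.continuousAt_iff.1 (hg.continuous.continuousAt (x := 0)) ε hε
  have hmaps : ∀ t ∈ Ioo (-δ) δ, g t ∈ Ioo (-ε) ε := by
    intro t ht
    have := hgδ (x := t) (by rw [Real.dist_eq, sub_zero]; exact abs_lt.2 ht)
    rw [hg0, Real.dist_eq, sub_zero] at this
    exact abs_lt.1 this
  refine ⟨δ, hδ, F.isSmoothCurveIn_of_contDiffOn_homExt (fun t ht => h.1 _ (hmaps t ht)) ?_⟩
  exact (F.contDiffOn_homExt h).comp
    ((hg.comp contDiff_fst).prodMk contDiff_snd).contDiffOn fun x hx => ⟨hmaps _ hx.1, hx.2⟩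

theorem IsSmoothCurveIn.contDiffOn_apply (h : IsSmoothCurveIn G ε φ) (v : F.indicatrix p) :
    ContDiffOn ℝ ∞ (fun t => ((φ t : Equiv.Perm (F.indicatrix p)) v).1) (Ioo (-ε) ε) := by
  simp only [← F.homExt_coe]
  exact (F.contDiffOn_homExt h).comp (contDiff_id.prodMk contDiff_const).contDiffOn
    fun t ht => ⟨ht, F.ne_zero_of_mem v.2⟩

/-- The quotients `(φ_t(v) - v) / t ^ k` tend to `ξ(v)` as `t → 0`. -/
def HasLeadingTerm (φ : ℝ → diffGroup (F.indicatrix p)) (k : ℕ)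
    (ξ : F.indicatrix p → EuclideanSpace ℝ (Fin n)) : Prop :=
  φ 0 = 1 ∧ ∀ v : F.indicatrix p,
    Tendsto (fun t => (t ^ k)⁻¹ • (((φ t : Equiv.Perm (F.indicatrix p)) v).1 - v.1)) (𝓝[≠] 0)
      (𝓝 (ξ v))

variable {k l : ℕ} {ξ η : F.indicatrix p → EuclideanSpace ℝ (Fin n)}

/-- For a smooth curve the limit of the quotients determines the Taylor coefficients. Leading terms
are easier to follow through products and reparametrisations; the price is the factor `k!`. -/
theorem HasLeadingTerm.isIntegralCurveOfOrder (h : IsSmoothCurveIn G ε φ) (hε : 0 < ε)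
    (hk : 1 ≤ k) (hξ : F.HasLeadingTerm φ k ξ) :
    IsIntegralCurveOfOrder k φ ((k.factorial : ℝ) • ξ) :=
  ⟨hξ.1, fun v => iteratedDeriv_of_tendsto hε (IsSmoothCurveIn.contDiffOn_apply F h v) hk (hξ.2 v)⟩

/-- The expansion at `t = 0` of an integral curve of order `k` in the diffeomorphism group. -/
theorem exists_homExt_eq (h : IsSmoothCurveIn G ε φ) (hε : 0 < ε)
    (hξ : IsIntegralCurveOfOrder k φ ((k.factorial : ℝ) • ξ)) (hk : 1 ≤ k) (v : F.indicatrix p) :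
    ∃ A : ℝ × EuclideanSpace ℝ (Fin n) → EuclideanSpace ℝ (Fin n), ContDiff ℝ ∞ A ∧
      (∀ᶠ x in 𝓝 ((0 : ℝ), v.1), F.homExt (φ x.1) x.2 = x.2 + x.1 ^ k • A x) ∧
      ∀ᶠ y in 𝓝 v.1, A (0, y) = F.extend p ξ y := by
  have hv := F.ne_zero_of_mem v.2
  -- For fixed `y` the factor `normAt p y` is constant in `t`, so time derivatives commute with
  -- homogeneous extension; the subtracted `y` matters only for `j = 0`.
  have hder : ∀ y ≠ 0, ∀ j, 1 ≤ j → iteratedDeriv j (fun t => F.homExt (φ t) y - y) 0 =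
      F.extend p (fun v => iteratedDeriv j
        (fun t => ((φ t : Equiv.Perm (F.indicatrix p)) v).1) 0) y := by
    intro y hy j hj
    have h1 : (fun t => F.homExt (φ t) y - y) = fun t => -y + F.homExt (φ t) y := by
      funext t; abel
    rw [h1]
    simp only [F.homExt_apply _ hy]
    rw [iteratedDeriv_const_add (by omega), F.extend_apply p _ hy,
      iteratedDeriv_fun_const_smul_field]
  have hnear : ∀ᶠ y in 𝓝 v.1, y ≠ 0 := isOpen_compl_singleton.mem_nhds hv
  obtain ⟨A, hA, hfA, hA0⟩ := exists_eventually_eq_pow_smul (z := v.1) (k := k)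
    (f := fun x : ℝ × EuclideanSpace ℝ (Fin n) => F.homExt (φ x.1) x.2 - x.2)
    (isOpen_timeDomain ε) ((F.contDiffOn_homExt h).sub contDiffOn_snd)
    ⟨⟨by simpa using hε, hε⟩, hv⟩ (by
      filter_upwards [hnear] with y hy j hj
      rcases Nat.eq_zero_or_pos j with rfl | hj0
      · simp [hξ.1, homExt_one]
      · rw [hder y hy j hj0, F.extend_apply p _ hy, (hξ.2 _).1 j hj0 hj, smul_zero])
  refine ⟨A, hA, ?_, ?_⟩
  · filter_upwards [hfA] with x hx
    rw [← hx]; abel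
  · filter_upwards [hA0, hnear] with y h1 hy
    rw [h1, hder y hy k hk, F.extend_apply p _ hy, (hξ.2 _).2, F.extend_apply p _ hy,
      Pi.smul_apply, smul_smul, smul_smul]
    congr 1
    have : (k.factorial : ℝ) ≠ 0 := by exact_mod_cast k.factorial_ne_zero
    field_simp

end FinslerMetric

end FinslerHolonomy

end

/-! ### The Lie algebra of fields tangent to a subgroup -/

section

namespace FinslerHolonomy

open Filter Topology Set

namespace FinslerMetric

variable {n : ℕ} {M : Type*} [TopologicalSpace M] [ChartedSpace (EuclideanSpace ℝ (Fin n)) M]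
  [IsManifold (𝓡 n) ∞ M] (F : FinslerMetric n M) {p : M}
  {G : Subgroup (diffGroup (F.indicatrix p))} {ε : ℝ} {φ ψ : ℝ → diffGroup (F.indicatrix p)}
  {k l : ℕ} {ξ η : F.indicatrix p → EuclideanSpace ℝ (Fin n)}

theorem tendsto_homExt (h : IsSmoothCurveIn G ε φ) (hε : 0 < ε) (h0 : φ 0 = 1)
    (v : F.indicatrix p) : Tendsto (fun x : ℝ × EuclideanSpace ℝ (Fin n) => F.homExt (φ x.1) x.2)
      (𝓝 (0, v.1)) (𝓝 v.1) := by
  have h1 := ((F.contDiffOn_homExt h).contDiffAt ((isOpen_timeDomain ε).mem_nhds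
    (show ((0 : ℝ), v.1) ∈ _ from
      ⟨⟨by simpa using hε, hε⟩, F.ne_zero_of_mem v.2⟩))).continuousAt.tendsto
  simp only [h0, homExt_one] at h1
  exact h1

theorem tendsto_pow_nhdsNE {m : ℕ} (hm : 1 ≤ m) :
    Tendsto (fun t : ℝ => t ^ m) (𝓝[≠] 0) (𝓝 0) := by
  have := (tendsto_id (x := 𝓝 (0 : ℝ))).mono_left (nhdsWithin_le_nhds (s := {0}ᶜ)) |>.pow m
  rwa [zero_pow (by omega)] at this

theorem IsIntegralCurveOfOrder.hasLeadingTerm (h : IsSmoothCurveIn G ε φ) (hε : 0 < ε)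
    (hk : 1 ≤ k) (hξ : IsIntegralCurveOfOrder k φ ((k.factorial : ℝ) • ξ)) :
    F.HasLeadingTerm φ k ξ := by
  refine ⟨hξ.1, fun v => ?_⟩
  obtain ⟨A, hA, hφA, hA0⟩ := F.exists_homExt_eq h hε hξ hk v
  have hlim : Tendsto (fun t => A (t, v.1)) (𝓝[≠] 0) (𝓝 (A (0, v.1))) :=
    (hA.continuous.comp (by fun_prop : Continuous fun t : ℝ => (t, v.1))).continuousAt.mono_left
      nhdsWithin_le_nhds
  rw [hA0.self_of_nhds, F.extend_coe] at hlim
  refine hlim.congr' ?_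
  have hc : ContinuousAt (fun t : ℝ => (t, v.1)) 0 := by fun_prop
  filter_upwards [self_mem_nhdsWithin, nhdsWithin_le_nhds (hc.eventually hφA)] with t ht h1
  have ht' : t ≠ 0 := ht
  rw [F.homExt_coe] at h1
  rw [h1, add_sub_cancel_left, smul_smul, inv_mul_cancel₀ (pow_ne_zero _ ht'), one_smul]

theorem HasLeadingTerm.comp_const_mul (h : F.HasLeadingTerm φ k ξ) {c : ℝ} (hc : c ≠ 0) :
    F.HasLeadingTerm (fun t => φ (c * t)) k (c ^ k • ξ) := by
  refine ⟨by simp [h.1], fun v => ?_⟩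
  have hlim : Tendsto (fun t : ℝ => c * t) (𝓝[≠] 0) (𝓝[≠] 0) := by
    refine tendsto_nhdsWithin_iff.2 ⟨?_, ?_⟩
    · have : ContinuousAt (fun t : ℝ => c * t) 0 := by fun_prop
      have h1 := this.tendsto.mono_left (nhdsWithin_le_nhds (s := {0}ᶜ))
      rwa [mul_zero] at h1
    · filter_upwards [self_mem_nhdsWithin] with t ht
      exact mul_ne_zero hc ht
  refine (((h.2 v).comp hlim).const_smul (c ^ k)).congr fun t => ?_
  simp only [Function.comp_apply, smul_smul, mul_pow, mul_inv]
  rw [mul_inv_cancel_left₀ (pow_ne_zero _ hc)]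

variable (G ξ) in
/-- Some smooth curve in `G` is an integral curve of order `k` of `k! • ξ`. -/
def HasTangentCurve (k : ℕ) : Prop :=
  ∃ ε > 0, ∃ φ : ℝ → diffGroup (F.indicatrix p), IsSmoothCurveIn G ε φ ∧ F.HasLeadingTerm φ k ξ

/-- Rescaling time by `c ^ (1 / k)` multiplies the leading term by `c`. Negative constants need the
inverse curve, since for even `k` no real rescaling changes the sign. -/
theorem HasTangentCurve.const_smul (h : F.HasTangentCurve G ξ k) (hk : 1 ≤ k) {c : ℝ}
    (hc : 0 < c) : F.HasTangentCurve G (c • ξ) k := by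
  obtain ⟨ε, hε, φ, h1, h2⟩ := h
  have hb : 0 < c ^ ((k : ℝ)⁻¹) := Real.rpow_pos_of_pos hc _
  obtain ⟨ε', hε', h3⟩ := IsSmoothCurveIn.comp F h1 hε (g := fun t => c ^ ((k : ℝ)⁻¹) * t)
    (by fun_prop) (by simp)
  have h4 := HasLeadingTerm.comp_const_mul F h2 hb.ne'
  rw [Real.rpow_inv_natCast_pow hc.le (by omega)] at h4
  exact ⟨ε', hε', _, h3, h4⟩

/-- The factor `k!` between leading term and `k`-th derivative is positive and is absorbed by a
rescaling of time. -/
theorem isTangentTo_iff : IsTangentTo G ξ ↔ ∃ k, 1 ≤ k ∧ F.HasTangentCurve G ξ k := by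
  constructor
  · rintro ⟨ε, hε, φ, h1, k, hk, h2⟩
    have hf : 0 < (k.factorial : ℝ) := by exact_mod_cast k.factorial_pos
    have h3 : IsIntegralCurveOfOrder k φ ((k.factorial : ℝ) • (k.factorial : ℝ)⁻¹ • ξ) := by
      rwa [smul_smul, mul_inv_cancel₀ hf.ne', one_smul]
    have h4 : F.HasTangentCurve G ((k.factorial : ℝ)⁻¹ • ξ) k :=
      ⟨ε, hε, φ, h1, IsIntegralCurveOfOrder.hasLeadingTerm F h1 hε hk h3⟩
    have h5 := HasTangentCurve.const_smul F h4 hk hf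
    rw [smul_smul, mul_inv_cancel₀ hf.ne', one_smul] at h5
    exact ⟨k, hk, h5⟩
  · rintro ⟨k, hk, h⟩
    have hf : 0 < (k.factorial : ℝ) := by exact_mod_cast k.factorial_pos
    obtain ⟨ε, hε, φ, h1, h2⟩ := HasTangentCurve.const_smul F h hk (inv_pos.2 hf)
    have h3 := HasLeadingTerm.isIntegralCurveOfOrder F h1 hε hk h2
    rw [smul_smul, mul_inv_cancel₀ hf.ne', one_smul] at h3
    exact ⟨ε, hε, φ, h1, k, hk, h3⟩

/-- With `y` the image of `v` under the inverse of `φ t`, the expansion at the moving point `y`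
reads `v = y + t ^ k • A (t, y)`. Hence `y - v` is `-t ^ k • A (t, y)`, and `A (t, y)` tends to `ξ
v`. -/
theorem HasTangentCurve.neg (h : F.HasTangentCurve G ξ k) (hk : 1 ≤ k) :
    F.HasTangentCurve G (-ξ) k := by
  obtain ⟨ε, hε, φ, h1, h2⟩ := h
  have h3 := IsSmoothCurveIn.inv F h1
  refine ⟨ε, hε, _, h3, by simp [h2.1], fun v => ?_⟩
  obtain ⟨A, hA, hφA, hA0⟩ := F.exists_homExt_eq h1 hε
    (HasLeadingTerm.isIntegralCurveOfOrder F h1 hε hk h2) hk v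
  have hy : Tendsto (fun t => (t, F.homExt (φ t)⁻¹ v)) (𝓝[≠] 0) (𝓝 (0, v.1)) := by
    have hid : Tendsto (fun t : ℝ => t) (𝓝[≠] 0) (𝓝 0) := nhdsWithin_le_nhds
    exact hid.prodMk_nhds ((F.tendsto_homExt h3 hε (by simp [h2.1]) v).comp
      (hid.prodMk_nhds tendsto_const_nhds))
  have hlim := (hA.continuous.tendsto (0, v.1)).comp hy |>.neg
  rw [hA0.self_of_nhds, F.extend_coe] at hlim
  refine hlim.congr' ?_
  filter_upwards [self_mem_nhdsWithin, hy.eventually hφA] with t ht h4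
  have ht' : t ≠ 0 := ht
  rw [F.homExt_apply_inv] at h4
  have h5 : F.homExt (φ t)⁻¹ v - v.1 = -(t ^ k • A (t, F.homExt (φ t)⁻¹ v)) := by
    nth_rewrite 2 [h4]; abel
  rw [← F.homExt_coe, h5, smul_neg, smul_smul, inv_mul_cancel₀ (pow_ne_zero _ ht'), one_smul]
  rfl

/-- The substitutions `t ^ l` in `φ` and `t ^ k` in `ψ` bring both curves to the common order `k *
l`, where leading terms of a product add. -/
theorem HasTangentCurve.add (hξ : F.HasTangentCurve G ξ k) (hη : F.HasTangentCurve G η l)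
    (hk : 1 ≤ k) (hl : 1 ≤ l) : F.HasTangentCurve G (ξ + η) (k * l) := by
  obtain ⟨ε, hε, φ, h1, h2⟩ := hξ
  obtain ⟨δ, hδ, ψ, h3, h4⟩ := hη
  obtain ⟨ε', hε', h5⟩ := IsSmoothCurveIn.comp F h1 hε (g := fun t => t ^ l) (by fun_prop)
    (zero_pow (by omega))
  obtain ⟨δ', hδ', h6⟩ := IsSmoothCurveIn.comp F h3 hδ (g := fun t => t ^ k) (by fun_prop)
    (zero_pow (by omega))
  refine ⟨min ε' δ', lt_min hε' hδ', _, IsSmoothCurveIn.mul F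
    (IsSmoothCurveIn.mono F h5 (min_le_left _ _)) (IsSmoothCurveIn.mono F h6 (min_le_right _ _)),
    ?_, fun v => ?_⟩
  · change φ (0 ^ l) * ψ (0 ^ k) = 1
    rw [zero_pow (by omega), zero_pow (by omega), h2.1, h4.1, one_mul]
  obtain ⟨A, hA, hφA, hA0⟩ := F.exists_homExt_eq h1 hε
    (HasLeadingTerm.isIntegralCurveOfOrder F h1 hε hk h2) hk v
  obtain ⟨B, hB, hψB, hB0⟩ := F.exists_homExt_eq h3 hδ
    (HasLeadingTerm.isIntegralCurveOfOrder F h3 hδ hl h4) hl v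
  have hv : Tendsto (fun t : ℝ => (t ^ k, v.1)) (𝓝[≠] 0) (𝓝 (0, v.1)) :=
    (tendsto_pow_nhdsNE hk).prodMk_nhds tendsto_const_nhds
  have hy : Tendsto (fun t : ℝ => (t ^ l, F.homExt (ψ (t ^ k)) v)) (𝓝[≠] 0) (𝓝 (0, v.1)) :=
    (tendsto_pow_nhdsNE hl).prodMk_nhds ((F.tendsto_homExt h3 hδ h4.1 v).comp hv)
  have hlim := ((hA.continuous.tendsto (0, v.1)).comp hy).add
    ((hB.continuous.tendsto (0, v.1)).comp hv)
  rw [hA0.self_of_nhds, F.extend_coe, hB0.self_of_nhds, F.extend_coe] at hlim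
  refine hlim.congr' ?_
  filter_upwards [self_mem_nhdsWithin, hy.eventually hφA, hv.eventually hψB] with t ht e1 e2
  have ht' : t ^ (k * l) ≠ 0 := pow_ne_zero _ ht
  rw [← F.homExt_coe, F.homExt_mul, e1, ← pow_mul, mul_comm l k]
  rw [← pow_mul] at e2
  simp only [Function.comp_apply]
  generalize A (t ^ l, F.homExt (ψ (t ^ k)) v) = a at *
  rw [e2, add_assoc, add_sub_cancel_left, ← smul_add, smul_smul, inv_mul_cancel₀ ht', one_smul,
    add_comm]

theorem fderiv_apply_zero_prod {E : Type*} [NormedAddCommGroup E] [NormedSpace ℝ E]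
    {C : ℝ × E → E} (hC : ContDiff ℝ ∞ C) {X : E → E} {z : E} (h : ∀ᶠ y in 𝓝 z, C (0, y) = X y)
    (w : E) : fderiv ℝ C (0, z) (0, w) = fderiv ℝ X z w := by
  have e1 : HasFDerivAt (fun y => C (0, y)) (fderiv ℝ C (0, z) ∘L .inr ℝ _ _) z :=
    HasFDerivAt.comp z (hC.differentiable (by simp) (0, z)).hasFDerivAt
      (hasFDerivAt_prodMk_right (0 : ℝ) z)
  have e2 : (fun y => C (0, y)) =ᶠ[𝓝 z] X := h
  rw [← e2.fderiv_eq, e1.fderiv]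
  simp

/-- The curve is `ψ φ (φ ψ)⁻¹`. At the moving point `y = (φ ψ)⁻¹ v` its displacement of `v` is
exactly `ψ φ y - φ ψ y`, so the inverses never have to be expanded. -/
theorem HasTangentCurve.bracket (hξ : F.HasTangentCurve G ξ k) (hη : F.HasTangentCurve G η l)
    (hk : 1 ≤ k) (hl : 1 ≤ l) :
    F.HasTangentCurve G (F.bracket p ξ η) (k + l) := by
  obtain ⟨ε₁, hε₁, φ, h1, h2⟩ := hξ
  obtain ⟨ε₂, hε₂, ψ, h3, h4⟩ := hη
  obtain ⟨ε, hε, h1, h3⟩ : ∃ ε > 0, IsSmoothCurveIn G ε φ ∧ IsSmoothCurveIn G ε ψ :=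
    ⟨min ε₁ ε₂, lt_min hε₁ hε₂, IsSmoothCurveIn.mono F h1 (min_le_left _ _),
      IsSmoothCurveIn.mono F h3 (min_le_right _ _)⟩
  have h5 := IsSmoothCurveIn.inv F (IsSmoothCurveIn.mul F h1 h3)
  refine ⟨ε, hε, _, IsSmoothCurveIn.mul F (IsSmoothCurveIn.mul F h3 h1) h5, ?_, fun v => ?_⟩
  · simp [h2.1, h4.1]
  obtain ⟨A, hA, hφA, hA0⟩ := F.exists_homExt_eq h1 hε
    (HasLeadingTerm.isIntegralCurveOfOrder F h1 hε hk h2) hk v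
  obtain ⟨B, hB, hψB, hB0⟩ := F.exists_homExt_eq h3 hε
    (HasLeadingTerm.isIntegralCurveOfOrder F h3 hε hl h4) hl v
  have hid : Tendsto (fun t : ℝ => t) (𝓝[≠] 0) (𝓝 0) := nhdsWithin_le_nhds
  have h0 : (φ 0 * ψ 0)⁻¹ = 1 := by simp [h2.1, h4.1]
  have hy : Tendsto (fun t => F.homExt (φ t * ψ t)⁻¹ v) (𝓝[≠] 0) (𝓝 v.1) :=
    Tendsto.comp (g := fun x : ℝ × EuclideanSpace ℝ (Fin n) => F.homExt (φ x.1 * ψ x.1)⁻¹ x.2)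
      (f := fun t : ℝ => (t, v.1)) (F.tendsto_homExt h5 hε h0 v)
      (hid.prodMk_nhds tendsto_const_nhds)
  have hA' : HasStrictFDerivAt A (fderiv ℝ A (0, v.1)) (0, v.1) :=
    hA.contDiffAt.hasStrictFDerivAt (by simp)
  have hB' : HasStrictFDerivAt B (fderiv ℝ B (0, v.1)) (0, v.1) :=
    hB.contDiffAt.hasStrictFDerivAt (by simp)
  have hlim := tendsto_commutator (φ := fun x => F.homExt (φ x.1) x.2)
    (ψ := fun x => F.homExt (ψ x.1) x.2) hA' hB' hk hl hφA hψB hy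
  rw [fderiv_apply_zero_prod hA hA0, fderiv_apply_zero_prod hB hB0, hA0.self_of_nhds,
    hB0.self_of_nhds] at hlim
  refine Tendsto.congr (fun t => ?_) hlim
  have e2 : F.homExt (φ t) (F.homExt (ψ t) (F.homExt (φ t * ψ t)⁻¹ v)) = v := by
    rw [← F.homExt_mul, F.homExt_apply_inv]
  rw [e2, ← F.homExt_coe, F.homExt_mul, F.homExt_mul]

variable (G) in
/-- The vector fields on the indicatrix that are tangent to a subgroup of its diffeomorphism group
form a Lie algebra. -/
def tangentAlgebra : LieSubalgebra ℝ (F.vectorFields p) where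
  carrier := {ξ | IsTangentTo G ξ.1}
  add_mem' := by
    intro ξ η hξ hη
    obtain ⟨k, hk, h1⟩ := F.isTangentTo_iff.1 hξ
    obtain ⟨l, hl, h2⟩ := F.isTangentTo_iff.1 hη
    exact F.isTangentTo_iff.2 ⟨k * l, Nat.mul_pos hk hl, HasTangentCurve.add F h1 h2 hk hl⟩
  zero_mem' := by
    refine F.isTangentTo_iff.2 ⟨1, le_rfl, 1, one_pos, fun _ => 1,
      F.isSmoothCurveIn_of_contDiffOn_homExt (fun _ _ => G.one_mem) ?_, rfl, fun v => ?_⟩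
    · simp only [homExt_one]
      exact contDiffOn_snd
    · simp
  smul_mem' := by
    intro c ξ hξ
    obtain ⟨k, hk, h1⟩ := F.isTangentTo_iff.1 hξ
    refine F.isTangentTo_iff.2 ?_
    change ∃ k, 1 ≤ k ∧ F.HasTangentCurve G (c • ξ.1) k
    rcases lt_trichotomy c 0 with hc | rfl | hc
    · refine ⟨k, hk, ?_⟩
      have := HasTangentCurve.const_smul F (HasTangentCurve.neg F h1 hk) hk (neg_pos.2 hc)
      rwa [smul_neg, neg_smul, neg_neg] at this
    -- The zero field is written as `ξ + (-ξ)`, with a curve of order `k * k`.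
    · refine ⟨k * k, Nat.mul_pos hk hk, ?_⟩
      have := HasTangentCurve.add F h1 (HasTangentCurve.neg F h1 hk) hk hk
      rwa [add_neg_cancel, ← zero_smul ℝ ξ.1] at this
    · exact ⟨k, hk, HasTangentCurve.const_smul F h1 hk hc⟩
  lie_mem' := by
    intro ξ η hξ hη
    obtain ⟨k, hk, h1⟩ := F.isTangentTo_iff.1 hξ
    obtain ⟨l, hl, h2⟩ := F.isTangentTo_iff.1 hη
    exact F.isTangentTo_iff.2 ⟨k + l, by omega, HasTangentCurve.bracket F h1 h2 hk hl⟩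

end FinslerMetric

end FinslerHolonomy

end

/-! ### The induced chart of the tangent bundle and the squared norm -/

section

namespace FinslerHolonomy

open Filter Topology Set Bundle

/-- The model space. -/
abbrev Model (n : ℕ) : Type := EuclideanSpace ℝ (Fin n)

section Chart

variable {n : ℕ} {M : Type*} [TopologicalSpace M] [ChartedSpace (EuclideanSpace ℝ (Fin n)) M]
  [IsManifold (𝓡 n) ∞ M]

theorem inducedChart_eq (q : M) : inducedChart n q =
    (trivializationAt (Model n) (TangentSpace (𝓡 n)) q).toPartialEquiv ≫
      (extChartAt (𝓡 n) q).prod (PartialEquiv.refl _) :=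
  FiberBundle.extChartAt _

theorem inducedChart_target (q : M) :
    (inducedChart n q).target = (extChartAt (𝓡 n) q).target ×ˢ univ := by
  rw [inducedChart, FiberBundle.extChartAt_target]
  congr 1
  refine inter_eq_left.2 fun x hx => ?_
  have := (extChartAt (𝓡 n) q).map_target hx
  rwa [extChartAt_source] at this

theorem mem_baseSet_of_mem_target (q : M) {x : Model n} (hx : x ∈ (extChartAt (𝓡 n) q).target) :
    (extChartAt (𝓡 n) q).symm x ∈
      (trivializationAt (Model n) (TangentSpace (𝓡 n) : M → Type) q).baseSet := by
  have := (extChartAt (𝓡 n) q).map_target hx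
  rwa [extChartAt_source] at this

/-- The tangent space at the point with coordinates `x`, identified with the model space. -/
def fiberEquiv (q : M) {x : Model n} (hx : x ∈ (extChartAt (𝓡 n) q).target) :
    Model n ≃L[ℝ] TangentSpace (𝓡 n) ((extChartAt (𝓡 n) q).symm x) :=
  ((trivializationAt (Model n) (TangentSpace (𝓡 n)) q).continuousLinearEquivAt ℝ _
    (mem_baseSet_of_mem_target q hx)).symm

theorem inducedChart_symm_apply (q : M) {x : Model n} (hx : x ∈ (extChartAt (𝓡 n) q).target)
    (y : Model n) : (inducedChart n q).symm (x, y) =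
      ⟨(extChartAt (𝓡 n) q).symm x, fiberEquiv q hx y⟩ := by
  rw [inducedChart_eq]
  exact (Trivialization.mk_symm _ (mem_baseSet_of_mem_target q hx) y).symm

theorem inducedChart_apply_symm (q : M) {x : Model n} (hx : x ∈ (extChartAt (𝓡 n) q).target)
    (y : Model n) : inducedChart n q ((inducedChart n q).symm (x, y)) = (x, y) :=
  (inducedChart n q).right_inv (by rw [inducedChart_target]; exact ⟨hx, trivial⟩)

theorem inducedChart_symm_proj_mem (q : M) {x : Model n}
    (hx : x ∈ (extChartAt (𝓡 n) q).target) (y : Model n) :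
    ((inducedChart n q).symm (x, y)).proj ∈ (chartAt (EuclideanSpace ℝ (Fin n)) q).source := by
  rw [inducedChart_symm_apply q hx]
  exact mem_baseSet_of_mem_target q hx

/-- The tangent coordinate change from the chart at `p` to itself is the identity, so elements of
the tangent space at `p` are their own fibre coordinates. -/
theorem inducedChart_self (p : M) (v : Model n) :
    inducedChart n p ⟨p, v⟩ = (extChartAt (𝓡 n) p p, v) := by
  rw [inducedChart_eq]
  change (extChartAt (𝓡 n) p p, (trivializationAt (Model n) (TangentSpace (𝓡 n)) p
    (⟨p, v⟩ : TangentBundle (𝓡 n) M)).2) = _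
  congr 1
  rw [TangentBundle.trivializationAt_apply]
  exact (tangentBundleCore (𝓡 n) M).coordChange_self (achart _ p) p (mem_chart_source _ p) v

theorem inducedChart_symm_self (p : M) (v : Model n) :
    (inducedChart n p).symm (extChartAt (𝓡 n) p p, v) = ⟨p, v⟩ := by
  rw [← inducedChart_self, (inducedChart n p).left_inv]
  rw [inducedChart, extChartAt_source, TangentBundle.mem_chart_source_iff]
  exact mem_chart_source _ p

end Chart

namespace FinslerMetric

variable {n : ℕ} {M : Type*} [TopologicalSpace M] [ChartedSpace (EuclideanSpace ℝ (Fin n)) M]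
  [IsManifold (𝓡 n) ∞ M] (F : FinslerMetric n M) (q : M)

/-- The nonzero vectors, in the chart at `q`. -/
def slitDomain (q : M) : Set (Model n × Model n) := (extChartAt (𝓡 n) q).target ×ˢ {0}ᶜ

omit [IsManifold (𝓡 n) ∞ M] in
theorem isOpen_slitDomain : IsOpen (slitDomain (n := n) q) :=
  (isOpen_extChartAt_target q).prod isOpen_compl_singleton

theorem inCoord_eq {x : Model n} (hx : x ∈ (extChartAt (𝓡 n) q).target) (y : Model n) :
    F.inCoord q x y = F.toFun ⟨(extChartAt (𝓡 n) q).symm x, fiberEquiv q hx y⟩ := by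
  rw [inCoord, inducedChart_symm_apply q hx]

theorem inCoord_self (p : M) (v : Model n) :
    F.inCoord p (extChartAt (𝓡 n) p p) v = F.normAt p v := by
  rw [inCoord, inducedChart_symm_self]

theorem inCoord_smul {x : Model n} (hx : x ∈ (extChartAt (𝓡 n) q).target) (y : Model n) {a : ℝ}
    (ha : 0 < a) : F.inCoord q x (a • y) = a * F.inCoord q x y := by
  rw [F.inCoord_eq q hx, F.inCoord_eq q hx, map_smul]
  exact F.homogeneous _ _ a ha

theorem fundForm_inCoord_pos {x : Model n} (hx : x ∈ (extChartAt (𝓡 n) q).target) {y u : Model n}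
    (hy : y ≠ 0) (hu : u ≠ 0) : 0 < fundForm (F.inCoord q x) y u u := by
  have h := F.posDef _ (fiberEquiv q hx y) (fiberEquiv q hx u)
    ((map_ne_zero_iff _ (fiberEquiv q hx).injective).2 hy)
    ((map_ne_zero_iff _ (fiberEquiv q hx).injective).2 hu)
  have h2 : fundForm (F.inCoord q x) y u u = fundForm (fun v => F.toFun
      ⟨(extChartAt (𝓡 n) q).symm x, v⟩) (fiberEquiv q hx y) (fiberEquiv q hx u)
      (fiberEquiv q hx u) := by
    simp only [fundForm, F.inCoord_eq q hx, map_add, map_smul]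
  rwa [h2]

/-- The square of the Finsler norm in the chart at `q`. -/
def energy (z : Model n × Model n) : ℝ := F.inCoord q z.1 z.2 ^ 2

theorem contDiffOn_energy : ContDiffOn ℝ ∞ (F.energy q) (slitDomain q) := by
  have h1 : ContMDiffOn 𝓘(ℝ, Model n × Model n) (𝓡 n).tangent ∞ (inducedChart n q).symm
      (slitDomain q) := by
    have := contMDiffOn_extChartAt_symm (I := (𝓡 n).tangent) (n := ∞)
      (⟨q, 0⟩ : TangentBundle (𝓡 n) M)
    refine this.mono fun z hz => ?_
    change z ∈ (inducedChart n q).target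
    rw [inducedChart_target]
    exact ⟨hz.1, trivial⟩
  have h2 : ContMDiffOn 𝓘(ℝ, Model n × Model n) 𝓘(ℝ) ∞
      (fun z => F.toFun ((inducedChart n q).symm z)) (slitDomain q) := by
    refine F.smooth.comp h1 ?_
    rintro ⟨x, y⟩ hz
    rw [mem_preimage, inducedChart_symm_apply q hz.1]
    exact (map_ne_zero_iff _ (fiberEquiv q hz.1).injective).2 hz.2
  exact h2.contDiffOn.pow 2

theorem energy_smul {x : Model n} (hx : x ∈ (extChartAt (𝓡 n) q).target) (y : Model n) {a : ℝ}
    (ha : 0 < a) : F.energy q (x, a • y) = a ^ 2 * F.energy q (x, y) := by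
  simp only [energy, F.inCoord_smul q hx y ha, mul_pow]

end FinslerMetric

end FinslerHolonomy

end

/-! ### Geodesic coefficients, and invariance of the norm under horizontal motion -/

section

namespace FinslerHolonomy

open Filter Topology Set

namespace FinslerMetric

variable {n : ℕ} {M : Type*} [TopologicalSpace M] [ChartedSpace (EuclideanSpace ℝ (Fin n)) M]
  [IsManifold (𝓡 n) ∞ M] (F : FinslerMetric n M) (q : M) {z : Model n × Model n}

theorem contDiffAt_energy (hz : z ∈ slitDomain q) : ContDiffAt ℝ ∞ (F.energy q) z :=
  (F.contDiffOn_energy q).contDiffAt ((isOpen_slitDomain q).mem_nhds hz)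

theorem contDiffAt_fderiv_energy (hz : z ∈ slitDomain q) :
    ContDiffAt ℝ ∞ (fderiv ℝ (F.energy q)) z :=
  (F.contDiffAt_energy q hz).fderiv_right (by simp)

theorem contDiffAt_fderiv_fderiv_energy (hz : z ∈ slitDomain q) :
    ContDiffAt ℝ ∞ (fderiv ℝ (fderiv ℝ (F.energy q))) z :=
  (F.contDiffAt_fderiv_energy q hz).fderiv_right (by simp)

theorem hasFDerivAt_energy (hz : z ∈ slitDomain q) :
    HasFDerivAt (F.energy q) (fderiv ℝ (F.energy q) z) z :=
  ((F.contDiffAt_energy q hz).differentiableAt (by simp)).hasFDerivAt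

theorem hasFDerivAt_fderiv_energy (hz : z ∈ slitDomain q) :
    HasFDerivAt (fderiv ℝ (F.energy q)) (fderiv ℝ (fderiv ℝ (F.energy q)) z) z :=
  ((F.contDiffAt_fderiv_energy q hz).differentiableAt (by simp)).hasFDerivAt

theorem fderiv_fderiv_energy_comm (hz : z ∈ slitDomain q) (a b : Model n × Model n) :
    fderiv ℝ (fderiv ℝ (F.energy q)) z a b = fderiv ℝ (fderiv ℝ (F.energy q)) z b a :=
  ContDiffAt.isSymmSndFDerivAt (F.contDiffAt_energy q hz) (by
    simp only [minSmoothness_of_isRCLikeNormedField]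
    exact WithTop.coe_le_coe.2 (le_top : (2 : ℕ∞) ≤ ⊤)) a b

/-- Euler's identity. -/
theorem fderiv_energy_euler (hz : z ∈ slitDomain q) :
    fderiv ℝ (F.energy q) z (0, z.2) = 2 * F.energy q z := by
  have h1 : HasDerivAt (fun a : ℝ => F.energy q (z.1, a • z.2))
      (fderiv ℝ (F.energy q) z (0, z.2)) 1 := by
    have hpath : HasDerivAt (fun a : ℝ => (z.1, a • z.2)) ((0, z.2) : Model n × Model n) 1 := by
      have := (hasDerivAt_const (1 : ℝ) z.1).prodMk ((hasDerivAt_id (1 : ℝ)).smul_const z.2)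
      simpa using this
    have h := F.hasFDerivAt_energy q hz
    exact HasFDerivAt.comp_hasDerivAt (1 : ℝ) (by simpa using h) hpath
  have h2 : HasDerivAt (fun a : ℝ => a ^ 2 * F.energy q z) (2 * F.energy q z) 1 := by
    simpa using (hasDerivAt_pow 2 (1 : ℝ)).mul_const (F.energy q z)
  refine h1.unique (h2.congr_of_eventuallyEq ?_)
  filter_upwards [lt_mem_nhds (zero_lt_one (α := ℝ))] with a ha
  exact F.energy_smul q hz.1 z.2 ha

/-- Euler's identity differentiated in the direction `a`; the last term comes from differentiating
the argument `(0, z.2)`. -/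
theorem fderiv_fderiv_energy_euler (hz : z ∈ slitDomain q) (a : Model n × Model n) :
    fderiv ℝ (fderiv ℝ (F.energy q)) z a (0, z.2) =
      2 * fderiv ℝ (F.energy q) z a - fderiv ℝ (F.energy q) z (0, a.2) := by
  have h1 := (F.hasFDerivAt_fderiv_energy q hz).clm_apply
    ((ContinuousLinearMap.inr ℝ (Model n) (Model n)).comp
      (ContinuousLinearMap.snd ℝ (Model n) (Model n))).hasFDerivAt
  have h2 := (F.hasFDerivAt_energy q hz).const_mul 2
  have h3 := (h2.congr_of_eventuallyEq (f₁ := fun x => fderiv ℝ (F.energy q) x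
    (((ContinuousLinearMap.inr ℝ (Model n) (Model n)).comp
      (ContinuousLinearMap.snd ℝ (Model n) (Model n))) x)) (by
    filter_upwards [(isOpen_slitDomain q).mem_nhds hz] with x hx
    exact F.fderiv_energy_euler q hx)).unique h1
  have h4 := congrArg (fun L => L a) h3
  simp at h4
  linarith

theorem fundForm_inCoord (hz : z ∈ slitDomain q) (u w : Model n) :
    fundForm (F.inCoord q z.1) z.2 u w =
      (1 / 2) * fderiv ℝ (fderiv ℝ (F.energy q)) z (0, u) (0, w) := by
  have hc : ContinuousAt (fun s : ℝ => (z.1, z.2 + s • u)) 0 := by fun_prop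
  have hmem : ∀ᶠ s : ℝ in 𝓝 0, (z.1, z.2 + s • u) ∈ slitDomain q :=
    hc.preimage_mem_nhds ((isOpen_slitDomain q).mem_nhds (by simpa using hz))
  have hpath : ∀ (y w : Model n), HasDerivAt (fun t : ℝ => (z.1, y + t • w))
      ((0, w) : Model n × Model n) 0 := by
    intro y w
    have := (hasDerivAt_const (0 : ℝ) z.1).prodMk
      (((hasDerivAt_id (0 : ℝ)).smul_const w).const_add y)
    simpa using this
  have h1 : (fun s : ℝ => deriv (fun t : ℝ => F.inCoord q z.1 (z.2 + s • u + t • w) ^ 2) 0)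
      =ᶠ[𝓝 0] fun s => fderiv ℝ (F.energy q) (z.1, z.2 + s • u) (0, w) := by
    filter_upwards [hmem] with s hs
    have h := F.hasFDerivAt_energy q hs
    exact (HasFDerivAt.comp_hasDerivAt (0 : ℝ) (by simpa using h)
      (hpath (z.2 + s • u) w)).deriv
  have h2 : HasDerivAt (fun s : ℝ => fderiv ℝ (F.energy q) (z.1, z.2 + s • u))
      (fderiv ℝ (fderiv ℝ (F.energy q)) z (0, u)) 0 := by
    have h := F.hasFDerivAt_fderiv_energy q hz
    exact HasFDerivAt.comp_hasDerivAt (0 : ℝ) (by simpa using h) (hpath z.2 u)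
  have h3 := h2.clm_apply (hasDerivAt_const (0 : ℝ) ((0, w) : Model n × Model n))
  rw [fundForm, h1.deriv_eq, h3.deriv]
  simp

theorem gMatrix_apply (hz : z ∈ slitDomain q) (i j : Fin n) : F.gMatrix q z.1 z.2 i j =
    (1 / 2) * fderiv ℝ (fderiv ℝ (F.energy q)) z (0, stdVec i) (0, stdVec j) :=
  F.fundForm_inCoord q hz _ _

theorem sum_smul_stdVec (w : Model n) : ∑ i, w i • (stdVec i : Model n) = w := by
  ext j
  simp [stdVec, Pi.single_apply]

theorem map_inr_eq_sum (L : Model n × Model n →L[ℝ] ℝ) (w : Model n) :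
    L (0, w) = ∑ i, w i * L (0, stdVec i) := by
  have h : ∀ w : Model n, L (0, w) = (L ∘L .inr ℝ _ _) w := fun w => by simp
  simp only [h]
  conv_lhs => rw [← sum_smul_stdVec w]
  simp

theorem map_inl_eq_sum (L : Model n × Model n →L[ℝ] ℝ) (w : Model n) :
    L (w, 0) = ∑ i, w i * L (stdVec i, 0) := by
  have h : ∀ w : Model n, L (w, 0) = (L ∘L .inl ℝ _ _) w := fun w => by simp
  simp only [h]
  conv_lhs => rw [← sum_smul_stdVec w]
  simp

theorem sum_gMatrix_mul (hz : z ∈ slitDomain q) (l : Fin n) (w : Model n) :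
    ∑ i, F.gMatrix q z.1 z.2 l i * w i =
      (1 / 2) * fderiv ℝ (fderiv ℝ (F.energy q)) z (0, w) (0, stdVec l) := by
  rw [F.fderiv_fderiv_energy_comm q hz, map_inr_eq_sum, Finset.mul_sum]
  refine Finset.sum_congr rfl fun i _ => ?_
  rw [F.gMatrix_apply q hz]
  ring

/-- A nonzero vector in the kernel would contradict positive definiteness of the fundamental form.
-/
theorem isUnit_det_gMatrix (hz : z ∈ slitDomain q) : IsUnit (F.gMatrix q z.1 z.2).det := by
  rw [isUnit_iff_ne_zero]
  intro h
  obtain ⟨v, hv, hv0⟩ := Matrix.exists_mulVec_eq_zero_iff.2 h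
  have hu : WithLp.toLp 2 v ≠ (0 : Model n) := fun h0 => hv (by
    funext i; exact congrArg (fun w : Model n => w i) h0)
  have hpos := F.fundForm_inCoord_pos q hz.1 hz.2 hu
  rw [F.fundForm_inCoord q hz, map_inr_eq_sum, Finset.mul_sum] at hpos
  have h0 : ∀ l, (1 / 2 : ℝ) * (v l * fderiv ℝ (fderiv ℝ (F.energy q)) z (0, WithLp.toLp 2 v)
      (0, stdVec l)) = 0 := by
    intro l
    have h1 := congrFun hv0 l
    have h2 := F.sum_gMatrix_mul q hz l (WithLp.toLp 2 v)
    simp only [Matrix.mulVec, dotProduct, Pi.zero_apply] at h1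
    rw [h1] at h2
    linear_combination (-v l) * h2
  exact hpos.ne' (Finset.sum_eq_zero fun l _ => h0 l)

theorem contDiffAt_gMatrix (hz : z ∈ slitDomain q) (i j : Fin n) :
    ContDiffAt ℝ ∞ (fun z : Model n × Model n => F.gMatrix q z.1 z.2 i j) z := by
  have h : ContDiffAt ℝ ∞ (fun z => (1 / 2) *
      fderiv ℝ (fderiv ℝ (F.energy q)) z (0, stdVec i) (0, stdVec j)) z :=
    contDiffAt_const.mul (((F.contDiffAt_fderiv_fderiv_energy q hz).clm_apply
      contDiffAt_const).clm_apply contDiffAt_const)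
  refine h.congr_of_eventuallyEq ?_
  filter_upwards [(isOpen_slitDomain q).mem_nhds hz] with x hx
  exact F.gMatrix_apply q hx i j

theorem hasFDerivAt_gMatrix_fst (hz : z ∈ slitDomain q) (i j : Fin n) :
    HasFDerivAt (fun x => F.gMatrix q x z.2 i j)
      (fderiv ℝ (fun z : Model n × Model n => F.gMatrix q z.1 z.2 i j) z ∘L .inl ℝ _ _) z.1 :=
  HasFDerivAt.comp z.1 (f := fun x : Model n => (x, z.2))
    ((F.contDiffAt_gMatrix q hz i j).differentiableAt (by simp)).hasFDerivAt
    (hasFDerivAt_prodMk_left z.1 z.2)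

theorem dgMatrix_eq (hz : z ∈ slitDomain q) (k i j : Fin n) : F.dgMatrix q k i j z.1 z.2 =
    fderiv ℝ (fun z : Model n × Model n => F.gMatrix q z.1 z.2 i j) z (stdVec k, 0) := by
  have h := F.hasFDerivAt_gMatrix_fst q hz i j
  rw [dgMatrix, h.differentiableAt.lineDeriv_eq_fderiv, h.fderiv]
  simp

theorem contDiffAt_dgMatrix (hz : z ∈ slitDomain q) (k i j : Fin n) :
    ContDiffAt ℝ ∞ (fun z : Model n × Model n => F.dgMatrix q k i j z.1 z.2) z := by
  have h : ContDiffAt ℝ ∞ (fun z' : Model n × Model n =>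
      fderiv ℝ (fun z : Model n × Model n => F.gMatrix q z.1 z.2 i j) z' (stdVec k, 0)) z :=
    ((F.contDiffAt_gMatrix q hz i j).fderiv_right (by simp)).clm_apply contDiffAt_const
  refine h.congr_of_eventuallyEq ?_
  filter_upwards [(isOpen_slitDomain q).mem_nhds hz] with x hx
  exact F.dgMatrix_eq q hx k i j

theorem contDiffAt_det {E ι : Type*} [NormedAddCommGroup E] [NormedSpace ℝ E] [Fintype ι]
    [DecidableEq ι] {A : E → Matrix ι ι ℝ} {z : E} (h : ∀ i j, ContDiffAt ℝ ∞ (fun z => A z i j) z) :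
    ContDiffAt ℝ ∞ (fun z => (A z).det) z := by
  simp only [Matrix.det_apply]
  refine ContDiffAt.sum fun σ _ => ?_
  exact (contDiffAt_prod fun i _ => h _ _).const_smul _

/-- By Cramer's rule the entries are quotients of determinants, which are polynomials in the entries
of the matrix. -/
theorem contDiffAt_inv_apply {E ι : Type*} [NormedAddCommGroup E] [NormedSpace ℝ E] [Fintype ι]
    [DecidableEq ι] {A : E → Matrix ι ι ℝ} {z : E} (h : ∀ i j, ContDiffAt ℝ ∞ (fun z => A z i j) z)
    (hz : IsUnit (A z).det) (i j : ι) : ContDiffAt ℝ ∞ (fun z => (A z)⁻¹ i j) z := by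
  simp only [Matrix.inv_def, Matrix.smul_apply, Matrix.adjugate_apply, Ring.inverse_eq_inv',
    smul_eq_mul]
  refine ((contDiffAt_det h).inv hz.ne_zero).mul (contDiffAt_det fun a b => ?_)
  by_cases hab : a = j
  · subst hab
    simp only [Matrix.updateRow_self]
    exact contDiffAt_const
  · simp only [Matrix.updateRow_ne hab]
    exact h a b

theorem contDiffAt_geodesicCoeff (hz : z ∈ slitDomain q) :
    ContDiffAt ℝ ∞ (fun z : Model n × Model n => F.geodesicCoeff q z.1 z.2) z := by
  refine contDiffAt_euclidean.2 fun i => ?_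
  have hy : ∀ j, ContDiffAt ℝ ∞ (fun z : Model n × Model n => z.2 j) z := fun j =>
    contDiffAt_euclidean.1 contDiffAt_snd j
  refine contDiffAt_const.mul (ContDiffAt.sum fun l _ => ContDiffAt.sum fun j _ =>
    ContDiffAt.sum fun k _ => ?_)
  exact (((contDiffAt_inv_apply (F.contDiffAt_gMatrix q hz) (F.isUnit_det_gMatrix q hz) i l).mul
    ((contDiffAt_const.mul (F.contDiffAt_dgMatrix q hz k j l)).sub
      (F.contDiffAt_dgMatrix q hz l j k))).mul (hy j)).mul (hy k)

theorem hasFDerivAt_geodesicCoeff_snd (hz : z ∈ slitDomain q) :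
    HasFDerivAt (F.geodesicCoeff q z.1)
      (fderiv ℝ (fun z : Model n × Model n => F.geodesicCoeff q z.1 z.2) z ∘L .inr ℝ _ _) z.2 :=
  HasFDerivAt.comp z.2 (f := fun y : Model n => (z.1, y))
    ((F.contDiffAt_geodesicCoeff q hz).differentiableAt (by simp)).hasFDerivAt
    (hasFDerivAt_prodMk_right z.1 z.2)

theorem contDiffAt_connCoeff (hz : z ∈ slitDomain q) :
    ContDiffAt ℝ ∞ (fun z : Model n × Model n => F.connCoeff q z.1 z.2) z := by
  have h : ContDiffAt ℝ ∞ (fun z' : Model n × Model n =>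
      fderiv ℝ (fun z : Model n × Model n => F.geodesicCoeff q z.1 z.2) z' ∘L .inr ℝ _ _) z :=
    ((F.contDiffAt_geodesicCoeff q hz).fderiv_right (by simp)).clm_comp contDiffAt_const
  refine h.congr_of_eventuallyEq ?_
  filter_upwards [(isOpen_slitDomain q).mem_nhds hz] with x hx
  exact (F.hasFDerivAt_geodesicCoeff_snd q hx).fderiv

/-- By the second Euler identity, contracting the metric with `y` gives half the fibre derivative of
the energy. Differentiating this in `x` with `y` fixed gives the claim. -/
theorem sum_dgMatrix_mul (hz : z ∈ slitDomain q) (k l : Fin n) :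
    ∑ j, F.dgMatrix q k j l z.1 z.2 * z.2 j =
      (1 / 2) * fderiv ℝ (fderiv ℝ (F.energy q)) z (stdVec k, 0) (0, stdVec l) := by
  have h1 : HasFDerivAt (fun x => ∑ j, F.gMatrix q x z.2 j l * z.2 j) _ z.1 :=
    HasFDerivAt.fun_sum fun j _ => (F.hasFDerivAt_gMatrix_fst q hz j l).mul_const (z.2 j)
  have h2 : HasFDerivAt (fun x => fderiv ℝ (F.energy q) (x, z.2))
      (fderiv ℝ (fderiv ℝ (F.energy q)) z ∘L .inl ℝ _ _) z.1 :=
    HasFDerivAt.comp z.1 (F.hasFDerivAt_fderiv_energy q hz) (hasFDerivAt_prodMk_left z.1 z.2)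
  have h3 := (h2.clm_apply (hasFDerivAt_const ((0, stdVec l) : Model n × Model n) z.1)).const_mul
    (1 / 2)
  have h4 : (fun x => ∑ j, F.gMatrix q x z.2 j l * z.2 j) =ᶠ[𝓝 z.1]
      fun x => (1 / 2) * fderiv ℝ (F.energy q) (x, z.2) (0, stdVec l) := by
    have hc : ContinuousAt (fun x : Model n => (x, z.2)) z.1 := by fun_prop
    filter_upwards [hc.preimage_mem_nhds ((isOpen_slitDomain q).mem_nhds hz)] with x hx
    have e1 := F.fderiv_fderiv_energy_euler q hx (0, stdVec l)
    have e2 := map_inr_eq_sum (fderiv ℝ (fderiv ℝ (F.energy q)) (x, z.2) (0, stdVec l)) z.2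
    simp only at e1
    rw [e1] at e2
    have e3 : fderiv ℝ (F.energy q) (x, z.2) (0, stdVec l) = ∑ i, z.2 i *
        fderiv ℝ (fderiv ℝ (F.energy q)) (x, z.2) (0, stdVec l) (0, stdVec i) := by
      rw [← e2]; ring
    rw [e3, Finset.mul_sum]
    refine Finset.sum_congr rfl fun j _ => ?_
    have e4 := F.gMatrix_apply q hx j l
    simp only at e4
    rw [e4, F.fderiv_fderiv_energy_comm q hx (0, stdVec j)]
    ring
  have h5 := (h3.congr_of_eventuallyEq h4).unique h1
  have h6 := congrArg (fun L => L (stdVec k)) h5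
  simp only [F.dgMatrix_eq q hz]
  simp at h6
  rw [← mul_comm, mul_comm, one_div, h6]
  refine Finset.sum_congr rfl fun j _ => mul_comm _ _

/-- The definition of the geodesic coefficients freed of indices: the contractions of the metric
derivatives with `y` become derivatives of the energy, and multiplying by the metric matrix removes
its inverse. -/
theorem fderiv_fderiv_energy_geodesicCoeff (hz : z ∈ slitDomain q) (w : Model n) :
    2 * fderiv ℝ (fderiv ℝ (F.energy q)) z (0, F.geodesicCoeff q z.1 z.2) (0, w) =
      fderiv ℝ (fderiv ℝ (F.energy q)) z (z.2, 0) (0, w) - fderiv ℝ (F.energy q) z (w, 0) := by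
  have hc : ∀ l, ∑ j, ∑ k, (2 * F.dgMatrix q k j l z.1 z.2 - F.dgMatrix q l j k z.1 z.2) *
      z.2 j * z.2 k = fderiv ℝ (fderiv ℝ (F.energy q)) z (z.2, 0) (0, stdVec l) -
        fderiv ℝ (F.energy q) z (stdVec l, 0) := by
    intro l
    have h1 : fderiv ℝ (fderiv ℝ (F.energy q)) z (z.2, 0) (0, stdVec l) =
        2 * ∑ k, (∑ j, F.dgMatrix q k j l z.1 z.2 * z.2 j) * z.2 k := by
      rw [F.fderiv_fderiv_energy_comm q hz, map_inl_eq_sum, Finset.mul_sum]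
      refine Finset.sum_congr rfl fun k _ => ?_
      rw [F.sum_dgMatrix_mul q hz, F.fderiv_fderiv_energy_comm q hz]
      ring
    have h2 : fderiv ℝ (F.energy q) z (stdVec l, 0) =
        ∑ k, (∑ j, F.dgMatrix q l j k z.1 z.2 * z.2 j) * z.2 k := by
      have e1 := F.fderiv_fderiv_energy_euler q hz (stdVec l, 0)
      rw [map_inr_eq_sum] at e1
      have e2 : fderiv ℝ (F.energy q) z ((0 : Model n), (0 : Model n)) = 0 := map_zero _
      simp only [e2, sub_zero] at e1
      have e3 : fderiv ℝ (F.energy q) z (stdVec l, 0) = (1 / 2) * ∑ i, z.2 i *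
          fderiv ℝ (fderiv ℝ (F.energy q)) z (stdVec l, 0) (0, stdVec i) := by
        rw [e1]; ring
      rw [e3, Finset.mul_sum]
      refine Finset.sum_congr rfl fun k _ => ?_
      rw [F.sum_dgMatrix_mul q hz]
      ring
    rw [h1, h2, Finset.sum_comm, Finset.mul_sum, ← Finset.sum_sub_distrib]
    refine Finset.sum_congr rfl fun k _ => ?_
    rw [Finset.sum_mul, Finset.sum_mul, Finset.mul_sum, ← Finset.sum_sub_distrib]
    refine Finset.sum_congr rfl fun j _ => ?_
    ring
  have hG : ∀ m, F.geodesicCoeff q z.1 z.2 m = ((F.gMatrix q z.1 z.2)⁻¹.mulVec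
      fun l => (1 / 4) * (fderiv ℝ (fderiv ℝ (F.energy q)) z (z.2, 0) (0, stdVec l) -
        fderiv ℝ (F.energy q) z (stdVec l, 0))) m := by
    intro m
    simp only [← hc, Matrix.mulVec, dotProduct]
    change (1 / 4) * ∑ l, ∑ j, ∑ k, _ = _
    simp only [Finset.mul_sum]
    refine Finset.sum_congr rfl fun l _ => Finset.sum_congr rfl fun j _ =>
      Finset.sum_congr rfl fun k _ => ?_
    ring
  have hbasis : ∀ l, 2 * fderiv ℝ (fderiv ℝ (F.energy q)) z (0, F.geodesicCoeff q z.1 z.2)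
      (0, stdVec l) = fderiv ℝ (fderiv ℝ (F.energy q)) z (z.2, 0) (0, stdVec l) -
        fderiv ℝ (F.energy q) z (stdVec l, 0) := by
    intro l
    have h1 := F.sum_gMatrix_mul q hz l (F.geodesicCoeff q z.1 z.2)
    have h2 : ∑ i, F.gMatrix q z.1 z.2 l i * F.geodesicCoeff q z.1 z.2 i =
        (F.gMatrix q z.1 z.2).mulVec (fun i => F.geodesicCoeff q z.1 z.2 i) l := rfl
    rw [h2, funext hG, Matrix.mulVec_mulVec, Matrix.mul_nonsing_inv _ (F.isUnit_det_gMatrix q hz),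
      Matrix.one_mulVec] at h1
    linarith
  rw [map_inr_eq_sum, map_inr_eq_sum _ w, map_inl_eq_sum, Finset.mul_sum,
    ← Finset.sum_sub_distrib]
  refine Finset.sum_congr rfl fun l _ => ?_
  linear_combination w l * hbasis l

/-- The previous identity for `w = z.2`, simplified by Euler's relations: the energy is constant
along the geodesic spray. -/
theorem fderiv_energy_geodesicCoeff (hz : z ∈ slitDomain q) :
    2 * fderiv ℝ (F.energy q) z (0, F.geodesicCoeff q z.1 z.2) =
      fderiv ℝ (F.energy q) z (z.2, 0) := by
  have h := F.fderiv_fderiv_energy_geodesicCoeff q hz z.2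
  rw [F.fderiv_fderiv_energy_euler q hz, F.fderiv_fderiv_energy_euler q hz] at h
  have e2 : fderiv ℝ (F.energy q) z ((0 : Model n), (0 : Model n)) = 0 := map_zero _
  simp only [e2] at h
  linarith

/-- Horizontal vectors are tangent to the level sets of the Finsler norm. -/
theorem fderiv_energy_horizontal (hz : z ∈ slitDomain q) (w : Model n) :
    fderiv ℝ (F.energy q) z (w, -(F.connCoeff q z.1 z.2 w)) = 0 := by
  have hG : HasFDerivAt (fun z : Model n × Model n =>
      ((0, F.geodesicCoeff q z.1 z.2) : Model n × Model n))
      (ContinuousLinearMap.inr ℝ (Model n) (Model n) ∘L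
        fderiv ℝ (fun z : Model n × Model n => F.geodesicCoeff q z.1 z.2) z) z :=
    (ContinuousLinearMap.inr ℝ (Model n) (Model n)).hasFDerivAt.comp z
      ((F.contDiffAt_geodesicCoeff q hz).differentiableAt (by simp)).hasFDerivAt
  have h1 := ((F.hasFDerivAt_fderiv_energy q hz).clm_apply hG).const_mul 2
  have h2 := (F.hasFDerivAt_fderiv_energy q hz).clm_apply
    ((ContinuousLinearMap.inl ℝ (Model n) (Model n)).comp
      (ContinuousLinearMap.snd ℝ (Model n) (Model n))).hasFDerivAt
  have h3 := (h2.congr_of_eventuallyEq (f₁ := fun z => 2 * fderiv ℝ (F.energy q) z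
      (0, F.geodesicCoeff q z.1 z.2)) (by
    filter_upwards [(isOpen_slitDomain q).mem_nhds hz] with x hx
    exact F.fderiv_energy_geodesicCoeff q hx)).unique h1
  -- The spray identity differentiated in the fibre direction `w`. Subtracting `h7` cancels the
  -- second derivatives of the energy and leaves twice the claim.
  have h4 := congrArg (fun L => L (0, w)) h3
  have h5 : F.connCoeff q z.1 z.2 w =
      fderiv ℝ (fun z : Model n × Model n => F.geodesicCoeff q z.1 z.2) z (0, w) := by
    rw [connCoeff, (F.hasFDerivAt_geodesicCoeff_snd q hz).fderiv]
    simp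
  have h6 : ((w, -(F.connCoeff q z.1 z.2 w)) : Model n × Model n) =
      (w, 0) - (0, F.connCoeff q z.1 z.2 w) := by simp
  have h7 := F.fderiv_fderiv_energy_geodesicCoeff q hz w
  rw [F.fderiv_fderiv_energy_comm q hz, F.fderiv_fderiv_energy_comm q hz (z.2, 0)] at h7
  simp at h4
  rw [h6, map_sub, h5]
  linarith

end FinslerMetric

end FinslerHolonomy

end

/-! ### Curvature as a bracket of horizontal fields, and horizontal flow lines -/

section

namespace FinslerHolonomy

open Filter Topology Set

namespace FinslerMetric

variable {n : ℕ} {M : Type*} [TopologicalSpace M] [ChartedSpace (EuclideanSpace ℝ (Fin n)) M]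
  [IsManifold (𝓡 n) ∞ M] (F : FinslerMetric n M) (p : M) {z : Model n × Model n}

/-- The horizontal lift of the vector field with constant components `d` in the chart at `p`. -/
def horizField (d : Model n) : Model n × Model n → Model n × Model n :=
  F.horizontalLift p fun _ => d

theorem horizField_apply (d : Model n) (z : Model n × Model n) :
    F.horizField p d z = (d, -(F.connCoeff p z.1 z.2 d)) := rfl

theorem contDiffAt_horizField (hz : z ∈ slitDomain p) (d : Model n) :
    ContDiffAt ℝ ∞ (F.horizField p d) z :=
  contDiffAt_const.prodMk ((F.contDiffAt_connCoeff p hz).clm_apply contDiffAt_const).neg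

theorem fderiv_energy_horizField (hz : z ∈ slitDomain p) (d : Model n) :
    fderiv ℝ (F.energy p) z (F.horizField p d z) = 0 :=
  F.fderiv_energy_horizontal p hz d

theorem fderiv_horizField_fst (hz : z ∈ slitDomain p) (d : Model n) (a : Model n × Model n) :
    (fderiv ℝ (F.horizField p d) z a).1 = 0 := by
  have h := ((F.contDiffAt_horizField p hz d).differentiableAt (by simp)).hasFDerivAt.fst
  exact congrArg (fun L => L a) (h.unique (hasFDerivAt_const d z))

theorem lieBracket_horizField_fst (hz : z ∈ slitDomain p) (u w : Model n) :
    (VectorField.lieBracket ℝ (F.horizField p u) (F.horizField p w) z).1 = 0 := by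
  rw [VectorField.lieBracket, Prod.fst_sub, F.fderiv_horizField_fst p hz,
    F.fderiv_horizField_fst p hz, sub_zero]

theorem contDiffAt_lieBracket_horizField (hz : z ∈ slitDomain p) (u w : Model n) :
    ContDiffAt ℝ ∞ (VectorField.lieBracket ℝ (F.horizField p u) (F.horizField p w)) z :=
  (F.contDiffAt_horizField p hz u).lieBracket_vectorField (F.contDiffAt_horizField p hz w)
    (by simp)

/-- Fields that annihilate a function near a point have a bracket that annihilates it there. -/
theorem fderiv_energy_lieBracket (hz : z ∈ slitDomain p) (u w : Model n) :
    fderiv ℝ (F.energy p) z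
      (VectorField.lieBracket ℝ (F.horizField p u) (F.horizField p w) z) = 0 := by
  rw [VectorField.fderiv_apply_lieBracket (n := ∞) (F.contDiffAt_energy p hz)
    (by simp only [minSmoothness_of_isRCLikeNormedField]
        exact WithTop.coe_le_coe.2 (le_top : (2 : ℕ∞) ≤ ⊤))
    ((F.contDiffAt_horizField p hz w).differentiableAt (by simp))
    ((F.contDiffAt_horizField p hz u).differentiableAt (by simp))]
  have h : ∀ d, (fun y => fderiv ℝ (F.energy p) y (F.horizField p d y)) =ᶠ[𝓝 z] fun _ => 0 := by
    intro d
    filter_upwards [(isOpen_slitDomain p).mem_nhds hz] with y hy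
    exact F.fderiv_energy_horizField p hy d
  rw [(h u).fderiv_eq, (h w).fderiv_eq]
  simp

omit [IsManifold (𝓡 n) ∞ M] in
theorem mem_slitDomain_self {v : Model n} (hv : v ≠ 0) :
    (extChartAt (𝓡 n) p p, v) ∈ slitDomain p :=
  ⟨mem_extChartAt_target p, hv⟩

theorem energy_self (v : Model n) :
    F.energy p (extChartAt (𝓡 n) p p, v) = F.normAt p v ^ 2 := by
  rw [energy, F.inCoord_self p v]

theorem mem_indicatrix_iff_energy (v : Model n) :
    v ∈ F.indicatrix p ↔ F.energy p (extChartAt (𝓡 n) p p, v) = 1 := by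
  rw [F.energy_self, pow_eq_one_iff_of_nonneg (F.nonneg _) two_ne_zero]
  rfl

/-- Constant fields commute, so the correction term, the lift of their bracket, vanishes. -/
theorem curvature_eq (u w v : Model n) : F.curvature p u w v =
    (VectorField.lieBracket ℝ (F.horizField p u) (F.horizField p w)
      (extChartAt (𝓡 n) p p, v)).2 := by
  have h : VectorField.lieBracket ℝ (fun _ : Model n => u) (fun _ : Model n => w) = 0 := by
    funext x
    simp [VectorField.lieBracket]
  rw [curvature, curvatureField, inducedChart_self, h]
  simp [horizontalLift, horizField]

theorem curvature_mem (u w : Model n) :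
    (fun v : F.indicatrix p => F.curvature p u w v) ∈ F.vectorFields p := by
  constructor
  · intro a
    refine ⟨{0}ᶜ, isOpen_compl_singleton, F.ne_zero_of_mem a.2, fun v => F.curvature p u w v,
      fun v hv => ContDiffAt.contDiffWithinAt ?_, fun _ _ => rfl⟩
    simp only [curvature_eq]
    exact (ContDiffAt.comp (f := fun v : Model n => (extChartAt (𝓡 n) p p, v)) v
      (F.contDiffAt_lieBracket_horizField p (mem_slitDomain_self p hv) u w)
      (contDiffAt_const.prodMk contDiffAt_id)).snd
  · intro v
    have hv := F.ne_zero_of_mem v.2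
    have hz := mem_slitDomain_self p hv
    have h1 : HasFDerivAt (fun y => F.energy p (extChartAt (𝓡 n) p p, y))
        (fderiv ℝ (F.energy p) (extChartAt (𝓡 n) p p, v.1) ∘L .inr ℝ _ _) v.1 :=
      HasFDerivAt.comp v.1 (f := fun y : Model n => (extChartAt (𝓡 n) p p, y))
        (F.hasFDerivAt_energy p hz) (hasFDerivAt_prodMk_right _ _)
    have h2 := ((F.contDiffAt_normAt p hv).differentiableAt (by simp)).hasFDerivAt.pow 2
    simp only [energy_self] at h1
    have h3 := congrArg (fun L => L (F.curvature p u w v)) (h2.unique h1)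
    -- The bracket is vertical and annihilates the energy, so its fibre part lies in the kernel of
    -- the differential of the squared norm on the tangent space at `p`. On the indicatrix this
    -- differential is twice that of the norm.
    have h4 : ((0, F.curvature p u w v) : Model n × Model n) =
        VectorField.lieBracket ℝ (F.horizField p u) (F.horizField p w)
          (extChartAt (𝓡 n) p p, v.1) :=
      Prod.ext (F.lieBracket_horizField_fst p hz u w).symm (F.curvature_eq p u w v)
    have h5 : F.normAt p v.1 = 1 := v.2
    have h6 : (2 : ℝ) * fderiv ℝ (F.normAt p) v.1 (F.curvature p u w v) = 0 := by
      have h7 := F.fderiv_energy_lieBracket p hz u w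
      rw [← h4] at h7
      simpa [h5] using h3.trans h7
    linarith

/-! ### Parallel translation along polygons -/

theorem eq_of_hasDerivWithinAt_zero {E : Type*} [NormedAddCommGroup E] [NormedSpace ℝ E]
    {f : ℝ → E} (h : ∀ s ∈ Icc (0 : ℝ) 1, HasDerivWithinAt f 0 (Icc 0 1) s) {s : ℝ}
    (hs : s ∈ Icc (0 : ℝ) 1) : f s = f 0 := by
  have := (convex_Icc (0 : ℝ) 1).norm_image_sub_le_of_norm_hasDerivWithin_le (C := 0) h
    (by simp) (left_mem_Icc.2 zero_le_one) hs
  rw [zero_mul] at this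
  exact sub_eq_zero.1 (norm_le_zero_iff.1 this)

variable {X : Model n × Model n → Model n × Model n} {ε : ℝ}
  {Γ : ℝ → Model n × Model n → ℝ → Model n × Model n} {N : Set (Model n × Model n)} {d : Model n}

theorem IsFlowFor.hasDerivWithinAt_horizField (h : IsFlowFor X ε Γ)
    (hX : ∀ y ∈ N, X y = F.horizField p d y) {t : ℝ} (ht : t ∈ Ioo (-ε) ε)
    (hstay : ∀ s ∈ Icc (0 : ℝ) 1, Γ t z s ∈ N) {s : ℝ} (hs : s ∈ Icc (0 : ℝ) 1) :
    HasDerivWithinAt (Γ t z) (t • d, -(F.connCoeff p (Γ t z s).1 (Γ t z s).2 (t • d)))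
      (Icc 0 1) s := by
  have h1 := h.hasDerivWithinAt t ht z s hs
  rw [hX _ (hstay s hs), horizField_apply] at h1
  simpa using h1

/-- The base component of the lift of a constant field is constant, so the projection is a straight
segment. It does not depend on the fibre coordinate, hence one base curve serves all initial
vectors. -/
theorem IsFlowFor.fst_eq (h : IsFlowFor X ε Γ)
    (hX : ∀ y ∈ N, X y = F.horizField p d y) {t : ℝ} (ht : t ∈ Ioo (-ε) ε)
    (hstay : ∀ s ∈ Icc (0 : ℝ) 1, Γ t z s ∈ N) {s : ℝ} (hs : s ∈ Icc (0 : ℝ) 1) :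
    (Γ t z s).1 = z.1 + s • t • d := by
  have h1 : ∀ s ∈ Icc (0 : ℝ) 1,
      HasDerivWithinAt (fun s => (Γ t z s).1 - s • t • d) 0 (Icc 0 1) s := by
    intro s hs
    have h0 : HasDerivWithinAt (fun s => (Γ t z s).1) (t • d) (Icc 0 1) s :=
      (ContinuousLinearMap.fst ℝ (Model n) (Model n)).hasFDerivAt.comp_hasDerivWithinAt s
        (IsFlowFor.hasDerivWithinAt_horizField F p h hX ht hstay hs)
    have h2 := h0.sub ((hasDerivAt_id s).smul_const (t • d)).hasDerivWithinAt
    rw [one_smul, sub_self] at h2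
    exact h2
  have h3 := eq_of_hasDerivWithinAt_zero h1 hs
  simp only [h.apply_zero t ht z, zero_smul, sub_zero] at h3
  rw [← h3]; abel

theorem IsFlowFor.energy_eq (h : IsFlowFor X ε Γ) (hN : N ⊆ slitDomain p)
    (hX : ∀ y ∈ N, X y = F.horizField p d y) {t : ℝ} (ht : t ∈ Ioo (-ε) ε)
    (hstay : ∀ s ∈ Icc (0 : ℝ) 1, Γ t z s ∈ N) {s : ℝ} (hs : s ∈ Icc (0 : ℝ) 1) :
    F.energy p (Γ t z s) = F.energy p z := by
  have h1 : ∀ s ∈ Icc (0 : ℝ) 1,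
      HasDerivWithinAt (fun s => F.energy p (Γ t z s)) 0 (Icc 0 1) s := by
    intro s hs
    have h2 := (F.hasFDerivAt_energy p (hN (hstay s hs))).comp_hasDerivWithinAt s
      (h.hasDerivWithinAt t ht z s hs)
    rw [hX _ (hstay s hs), map_smul, F.fderiv_energy_horizField p (hN (hstay s hs)),
      smul_zero] at h2
    exact h2
  have h3 := eq_of_hasDerivWithinAt_zero h1 hs
  simpa only [h.apply_zero t ht z] using h3

end FinslerMetric

/-- The path that runs through `P 0`, `P 1`, `P 2`, ... on the intervals `[i / 4, (i + 1) / 4]`. -/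
def concat {E : Type*} (P : ℕ → ℝ → E) (s : ℝ) : E := P ⌊4 * s⌋₊ (4 * s - ⌊4 * s⌋₊)

theorem concat_eq {E : Type*} {P : ℕ → ℝ → E} (hP : ∀ i, P i 1 = P (i + 1) 0) {i : ℕ} {s : ℝ}
    (hs : s ∈ Icc ((i : ℝ) / 4) (((i + 1 : ℕ) : ℝ) / 4)) : concat P s = P i (4 * s - i) := by
  push_cast at hs
  -- At the right end point the floor already equals `i + 1`, and the matching condition is used.
  rcases eq_or_lt_of_le hs.2 with h | h
  · have h1 : 4 * s = ((i + 1 : ℕ) : ℝ) := by push_cast; linarith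
    rw [concat, h1, Nat.floor_natCast]
    push_cast
    rw [sub_self, ← hP]
    congr 1
    ring
  · have h1 : ⌊4 * s⌋₊ = i := by
      rw [Nat.floor_eq_iff (by linarith [hs.1, (Nat.cast_nonneg i : (0 : ℝ) ≤ i)])]
      constructor <;> linarith [hs.1]
    rw [concat, h1]

theorem concat_map {E E' : Type*} {P : ℕ → ℝ → E} {Q : ℕ → ℝ → E'} {f : E → E'}
    (h : ∀ i, ∀ s ∈ Icc (0 : ℝ) 1, f (P i s) = Q i s) {s : ℝ} (hs : 0 ≤ s) :
    f (concat P s) = concat Q s := by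
  refine h _ _ ⟨?_, ?_⟩
  · linarith [Nat.floor_le (show 0 ≤ 4 * s by linarith)]
  · linarith [Nat.lt_floor_add_one (4 * s)]

end FinslerHolonomy

end

/-! ### Horizontal polygons, the parallelogram map and its second-order term -/

section

namespace FinslerHolonomy

open Filter Topology Set

section Polygon

variable {E : Type*}

/-- The vertices of the polygon whose `i`-th side is the integral curve `Γ i (a i)`. -/
def polygonPt (Γ : ℕ → ℝ → E → ℝ → E) (a : ℕ → ℝ) (z : E) : ℕ → E
  | 0 => z
  | i + 1 => Γ i (a i) (polygonPt Γ a z i) 1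

/-- The sides of a polygon. -/
def polygonLeg (Γ : ℕ → ℝ → E → ℝ → E) (a : ℕ → ℝ) (z : E) (i : ℕ) (s : ℝ) : E :=
  Γ i (a i) (polygonPt Γ a z i) s

/-- The end point of the parallelogram with sides `-X₁, -X₂, X₁, X₂`, traversed for time `t`. -/
def loopMap (Γ₁ Γ₂ : ℝ → E → ℝ → E) (t : ℝ) (z : E) : E :=
  Γ₂ t (Γ₁ t (Γ₂ (-t) (Γ₁ (-t) z 1) 1) 1) 1

end Polygon

section LoopMap

variable {E : Type} [NormedAddCommGroup E] [NormedSpace ℝ E] {X₁ X₂ : E → E} {ε : ℝ}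
  {Γ₁ Γ₂ : ℝ → E → ℝ → E}

theorem contDiffOn_loopMap (h₁ : IsFlowFor X₁ ε Γ₁) (h₂ : IsFlowFor X₂ ε Γ₂) :
    ContDiffOn ℝ ∞ (fun x : ℝ × E => loopMap Γ₁ Γ₂ x.1 x.2) (Ioo (-ε) ε ×ˢ univ) := by
  have hneg : ∀ x ∈ Ioo (-ε) ε ×ˢ (univ : Set E), -x.1 ∈ Ioo (-ε) ε := fun x hx =>
    ⟨by linarith [hx.1.2], by linarith [hx.1.1]⟩
  have e1 : ContDiffOn ℝ ∞ (fun x : ℝ × E => Γ₁ (-x.1) x.2 1) (Ioo (-ε) ε ×ˢ univ) :=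
    h₁.contDiffOn.comp (contDiffOn_fst.neg.prodMk contDiffOn_snd) fun x hx => ⟨hneg x hx, trivial⟩
  have e2 := h₂.contDiffOn.comp (contDiffOn_fst.neg.prodMk e1) fun x hx => ⟨hneg x hx, trivial⟩
  have e3 := h₁.contDiffOn.comp (contDiffOn_fst.prodMk e2) fun x hx => ⟨hx.1, trivial⟩
  exact h₂.contDiffOn.comp (contDiffOn_fst.prodMk e3) fun x hx => ⟨hx.1, trivial⟩

theorem loopMap_zero (hε : 0 < ε) (h₁ : IsFlowFor X₁ ε Γ₁) (h₂ : IsFlowFor X₂ ε Γ₂) (z : E) :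
    loopMap Γ₁ Γ₂ 0 z = z := by
  simp [loopMap, h₁.apply_time_zero hε _ (right_mem_Icc.2 zero_le_one),
    h₂.apply_time_zero hε _ (right_mem_Icc.2 zero_le_one)]

theorem IsFlowFor.reverse' {X : E → E} {Γ : ℝ → E → ℝ → E} (h : IsFlowFor X ε Γ) {t : ℝ}
    (ht : t ∈ Ioo (-ε) ε) (z : E) : Γ t (Γ (-t) z 1) 1 = z := by
  simpa using h.reverse (t := -t) ⟨by linarith [ht.2], by linarith [ht.1]⟩ z

/-- Exchanging the two flows traverses the parallelogram in the opposite sense, so the four sides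
cancel one after another. -/
theorem loopMap_loopMap (h₁ : IsFlowFor X₁ ε Γ₁) (h₂ : IsFlowFor X₂ ε Γ₂) {t : ℝ}
    (ht : t ∈ Ioo (-ε) ε) (z : E) : loopMap Γ₂ Γ₁ t (loopMap Γ₁ Γ₂ t z) = z := by
  simp only [loopMap]
  rw [h₂.reverse ht, h₁.reverse ht, h₂.reverse' ht, h₁.reverse' ht]

theorem IsFlowFor.exists_eq_add_smul [FiniteDimensional ℝ E] {X : E → E} {Γ : ℝ → E → ℝ → E}
    (h : IsFlowFor X ε Γ) (hε : 0 < ε) (hX : Continuous X) {C : ℝ} (hC : ∀ z, ‖X z‖ ≤ C) (z : E) :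
    ∃ A : ℝ × E → E, ContDiff ℝ ∞ A ∧
      (∀ᶠ x in 𝓝 ((0 : ℝ), z), Γ x.1 x.2 1 = x.2 + x.1 ^ 1 • A x) ∧
      ∀ᶠ y in 𝓝 z, A (0, y) = X y := by
  have hc : CompleteSpace E := FiniteDimensional.complete ℝ E
  obtain ⟨A, hA, h1, h2⟩ := exists_eventually_eq_pow_smul (z := z) (k := 1)
    (f := fun x : ℝ × E => Γ x.1 x.2 1 - x.2) (isOpen_Ioo.prod isOpen_univ)
    (h.contDiffOn.sub contDiffOn_snd) ⟨⟨by simpa using hε, hε⟩, trivial⟩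
    (Eventually.of_forall fun y j hj => by
      obtain rfl : j = 0 := by omega
      simp [h.apply_time_zero hε _ (right_mem_Icc.2 zero_le_one)])
  refine ⟨A, hA, ?_, ?_⟩
  · filter_upwards [h1] with x hx
    rw [← hx]; abel
  · filter_upwards [h2] with y hy
    have h3 := (h.hasDerivAt_time hε hX hC y).sub_const y
    rw [hy, iteratedDeriv_one, h3.deriv]
    simp

/-- With `y` the image of `z` under the two backward sides, applying the forward flow of `X₂` and
then that of `X₁` returns `z`. The displacement is therefore the commutator difference at `y`, with
both orders equal to `1`. -/
theorem tendsto_loopMap [FiniteDimensional ℝ E] (hε : 0 < ε) (h₁ : IsFlowFor X₁ ε Γ₁)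
    (h₂ : IsFlowFor X₂ ε Γ₂) (hX₁ : Continuous X₁) (hX₂ : Continuous X₂) {C : ℝ}
    (hC₁ : ∀ z, ‖X₁ z‖ ≤ C) (hC₂ : ∀ z, ‖X₂ z‖ ≤ C) (z : E) :
    Tendsto (fun t => (t ^ 2)⁻¹ • (loopMap Γ₁ Γ₂ t z - z)) (𝓝[≠] 0)
      (𝓝 (VectorField.lieBracket ℝ X₁ X₂ z)) := by
  obtain ⟨A, hA, hφA, hA0⟩ := h₁.exists_eq_add_smul hε hX₁ hC₁ z
  obtain ⟨B, hB, hψB, hB0⟩ := h₂.exists_eq_add_smul hε hX₂ hC₂ z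
  have hmem : ∀ᶠ t : ℝ in 𝓝 0, t ∈ Ioo (-ε) ε := Ioo_mem_nhds (by linarith) hε
  have hy : Tendsto (fun t => Γ₂ (-t) (Γ₁ (-t) z 1) 1) (𝓝[≠] 0) (𝓝 z) := by
    have e1 : ContDiffAt ℝ ∞ (fun x : ℝ × E => Γ₂ x.1 x.2 1) (-0, Γ₁ (-0) z 1) :=
      h₂.contDiffOn.contDiffAt ((isOpen_Ioo.prod isOpen_univ).mem_nhds
        ⟨⟨by simpa using hε, by simpa using hε⟩, trivial⟩)
    have e2 : ContDiffAt ℝ ∞ (fun x : ℝ × E => Γ₁ x.1 x.2 1) (-0, z) :=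
      h₁.contDiffOn.contDiffAt ((isOpen_Ioo.prod isOpen_univ).mem_nhds
        ⟨⟨by simpa using hε, by simpa using hε⟩, trivial⟩)
    have e3 : ContinuousAt (fun t : ℝ => Γ₁ (-t) z 1) 0 :=
      ContinuousAt.comp (g := fun x : ℝ × E => Γ₁ x.1 x.2 1) (f := fun t : ℝ => (-t, z))
        e2.continuousAt (by fun_prop)
    have e4 : ContinuousAt (fun t : ℝ => Γ₂ (-t) (Γ₁ (-t) z 1) 1) 0 :=
      ContinuousAt.comp (g := fun x : ℝ × E => Γ₂ x.1 x.2 1)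
        (f := fun t : ℝ => (-t, Γ₁ (-t) z 1)) e1.continuousAt (continuousAt_neg.prodMk e3)
    have e5 := e4.tendsto.mono_left (nhdsWithin_le_nhds (s := {0}ᶜ))
    simpa [h₁.apply_time_zero hε _ (right_mem_Icc.2 zero_le_one),
      h₂.apply_time_zero hε _ (right_mem_Icc.2 zero_le_one)] using e5
  have hA' : HasStrictFDerivAt A (fderiv ℝ A (0, z)) (0, z) :=
    hA.contDiffAt.hasStrictFDerivAt (by simp)
  have hB' : HasStrictFDerivAt B (fderiv ℝ B (0, z)) (0, z) :=
    hB.contDiffAt.hasStrictFDerivAt (by simp)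
  have hlim := tendsto_commutator (φ := fun x => Γ₁ x.1 x.2 1) (ψ := fun x => Γ₂ x.1 x.2 1)
    hA' hB' le_rfl le_rfl hφA hψB hy
  rw [FinslerMetric.fderiv_apply_zero_prod hA hA0, FinslerMetric.fderiv_apply_zero_prod hB hB0,
    hA0.self_of_nhds, hB0.self_of_nhds] at hlim
  refine hlim.congr' ?_
  filter_upwards [nhdsWithin_le_nhds hmem] with t ht
  simp only [loopMap]
  rw [h₂.reverse' ht, h₁.reverse' ht]

end LoopMap

namespace FinslerMetric

variable {n : ℕ} {M : Type*} [TopologicalSpace M] [ChartedSpace (EuclideanSpace ℝ (Fin n)) M]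
  [IsManifold (𝓡 n) ∞ M] (F : FinslerMetric n M) (p : M)

/-- A polygon whose sides are integral curves of vector fields `X i` that, on a `δ`-neighbourhood
`N` of the indicatrix, are the horizontal lifts of the constant fields `d i`. -/
structure IsHorizontalPolygon (X : ℕ → Model n × Model n → Model n × Model n) (d : ℕ → Model n)
    (Γ : ℕ → ℝ → Model n × Model n → ℝ → Model n × Model n) (a : ℕ → ℝ)
    (N : Set (Model n × Model n)) (ε C δ : ℝ) : Prop where
  flow : ∀ i, IsFlowFor (X i) ε (Γ i)
  time : ∀ i, a i ∈ Ioo (-ε) ε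
  bound : ∀ i z, ‖X i z‖ ≤ C
  horiz : ∀ i, ∀ y ∈ N, X i y = F.horizField p (d i) y
  subset : N ⊆ slitDomain p
  stay : ∀ v ∈ F.indicatrix p, ∀ y, ‖y - (extChartAt (𝓡 n) p p, v)‖ < δ → y ∈ N
  sum_lt : ∀ i, (∑ j ∈ Finset.range i, |a j|) * C < δ
  closed : ∑ j ∈ Finset.range 4, a j • d j = 0

namespace IsHorizontalPolygon

variable {F p} {X : ℕ → Model n × Model n → Model n × Model n} {d : ℕ → Model n}
  {Γ : ℕ → ℝ → Model n × Model n → ℝ → Model n × Model n} {a : ℕ → ℝ}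
  {N : Set (Model n × Model n)} {ε C δ : ℝ} {v : Model n}

theorem norm_polygonPt_sub_le (h : F.IsHorizontalPolygon p X d Γ a N ε C δ)
    (z : Model n × Model n) (i : ℕ) :
    ‖polygonPt Γ a z i - z‖ ≤ (∑ j ∈ Finset.range i, |a j|) * C := by
  induction i with
  | zero => simp [polygonPt]
  | succ i ih =>
    have h1 := (h.flow i).norm_sub_le (h.bound i) (h.time i) (polygonPt Γ a z i)
      (right_mem_Icc.2 zero_le_one)
    rw [Finset.sum_range_succ, add_mul, polygonPt]
    calc _ = ‖(Γ i (a i) (polygonPt Γ a z i) 1 - polygonPt Γ a z i) +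
          (polygonPt Γ a z i - z)‖ := by congr 1; abel
      _ ≤ _ := (norm_add_le _ _).trans (by linarith)

/-- Total time multiplied by the bound on the fields is less than `δ`, so the polygon never leaves
the region where the fields are horizontal lifts. -/
theorem polygonLeg_mem (h : F.IsHorizontalPolygon p X d Γ a N ε C δ) (hv : v ∈ F.indicatrix p)
    (i : ℕ) {s : ℝ} (hs : s ∈ Icc (0 : ℝ) 1) :
    polygonLeg Γ a (extChartAt (𝓡 n) p p, v) i s ∈ N := by
  refine h.stay v hv _ (lt_of_le_of_lt ?_ (h.sum_lt (i + 1)))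
  have h1 := (h.flow i).norm_sub_le (h.bound i) (h.time i)
    (polygonPt Γ a (extChartAt (𝓡 n) p p, v) i) hs
  have h2 := h.norm_polygonPt_sub_le (extChartAt (𝓡 n) p p, v) i
  rw [Finset.sum_range_succ, add_mul, polygonLeg]
  calc _ = ‖(Γ i (a i) (polygonPt Γ a (extChartAt (𝓡 n) p p, v) i) s -
        polygonPt Γ a (extChartAt (𝓡 n) p p, v) i) +
        (polygonPt Γ a (extChartAt (𝓡 n) p p, v) i - (extChartAt (𝓡 n) p p, v))‖ := by
          congr 1; abel
    _ ≤ _ := (norm_add_le _ _).trans (by linarith)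

theorem polygonLeg_fst (h : F.IsHorizontalPolygon p X d Γ a N ε C δ) (hv : v ∈ F.indicatrix p)
    (i : ℕ) {s : ℝ} (hs : s ∈ Icc (0 : ℝ) 1) :
    (polygonLeg Γ a (extChartAt (𝓡 n) p p, v) i s).1 =
      (extChartAt (𝓡 n) p p + ∑ j ∈ Finset.range i, a j • d j) + s • a i • d i := by
  have h1 : ∀ i, (polygonPt Γ a (extChartAt (𝓡 n) p p, v) i).1 =
      extChartAt (𝓡 n) p p + ∑ j ∈ Finset.range i, a j • d j := by
    intro i
    induction i with
    | zero => simp [polygonPt]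
    | succ i ih =>
      rw [polygonPt, IsFlowFor.fst_eq F p (h.flow i) (h.horiz i) (h.time i)
        (fun s hs => h.polygonLeg_mem hv i hs) (right_mem_Icc.2 zero_le_one), ih,
        Finset.sum_range_succ, one_smul, add_assoc]
  rw [polygonLeg, IsFlowFor.fst_eq F p (h.flow i) (h.horiz i) (h.time i)
    (fun s hs => h.polygonLeg_mem hv i hs) hs, h1]

theorem polygonLeg_zero (h : F.IsHorizontalPolygon p X d Γ a N ε C δ) (z : Model n × Model n)
    (i : ℕ) : polygonLeg Γ a z i 0 = polygonPt Γ a z i :=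
  (h.flow i).apply_zero _ (h.time i) _

theorem polygonPt_four_fst (h : F.IsHorizontalPolygon p X d Γ a N ε C δ)
    (hv : v ∈ F.indicatrix p) :
    (polygonPt Γ a (extChartAt (𝓡 n) p p, v) 4).1 = extChartAt (𝓡 n) p p := by
  rw [← h.polygonLeg_zero, h.polygonLeg_fst hv 4 (left_mem_Icc.2 zero_le_one), h.closed]
  simp

theorem energy_polygonPt (h : F.IsHorizontalPolygon p X d Γ a N ε C δ)
    (hv : v ∈ F.indicatrix p) (i : ℕ) :
    F.energy p (polygonPt Γ a (extChartAt (𝓡 n) p p, v) i) =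
      F.energy p (extChartAt (𝓡 n) p p, v) := by
  induction i with
  | zero => rfl
  | succ i ih =>
    rw [polygonPt, IsFlowFor.energy_eq F p (h.flow i) h.subset (h.horiz i) (h.time i)
      (fun s hs => h.polygonLeg_mem hv i hs) (right_mem_Icc.2 zero_le_one), ih]

theorem polygonPt_four_snd_mem (h : F.IsHorizontalPolygon p X d Γ a N ε C δ)
    (hv : v ∈ F.indicatrix p) :
    (polygonPt Γ a (extChartAt (𝓡 n) p p, v) 4).2 ∈ F.indicatrix p := by
  have h1 : (extChartAt (𝓡 n) p p, (polygonPt Γ a (extChartAt (𝓡 n) p p, v) 4).2) =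
      polygonPt Γ a (extChartAt (𝓡 n) p p, v) 4 := Prod.ext (h.polygonPt_four_fst hv).symm rfl
  rw [F.mem_indicatrix_iff_energy, h1]
  exact (h.energy_polygonPt hv 4).trans ((F.mem_indicatrix_iff_energy p v).1 hv)

theorem isParallelOn (h : F.IsHorizontalPolygon p X d Γ a N ε C δ) (hv : v ∈ F.indicatrix p)
    (i : ℕ) : F.IsParallelOn (fun s => (inducedChart n p).symm
      (concat (polygonLeg Γ a (extChartAt (𝓡 n) p p, v)) s))
      (Icc ((i : ℝ) / 4) (((i + 1 : ℕ) : ℝ) / 4)) := by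
  set P := polygonLeg Γ a (extChartAt (𝓡 n) p p, v) with hPdef
  set J := Icc ((i : ℝ) / 4) (((i + 1 : ℕ) : ℝ) / 4) with hJ
  have hP : ∀ i, P i 1 = P (i + 1) 0 := fun i => (h.polygonLeg_zero _ (i + 1)).symm
  have hmaps : MapsTo (fun s : ℝ => 4 * s - i) J (Icc 0 1) := by
    intro s hs
    rw [hJ] at hs
    push_cast at hs
    constructor <;> linarith [hs.1, hs.2]
  have hchart : ∀ s ∈ J, inducedChart n p ((inducedChart n p).symm (concat P s)) =
      P i (4 * s - i) := by
    intro s hs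
    rw [concat_eq hP hs]
    exact inducedChart_apply_symm p (h.subset (h.polygonLeg_mem hv i (hmaps hs))).1 _
  intro t ht
  refine ⟨p, ?_, ?_⟩
  · change ((inducedChart n p).symm (concat P t)).proj ∈ _
    rw [concat_eq hP ht]
    exact inducedChart_symm_proj_mem p (h.subset (h.polygonLeg_mem hv i (hmaps ht))).1 _
  -- Running a side four times faster multiplies both components of the velocity by `4`; the
  -- parallel equation survives because it is linear in the velocity of the base curve.
  have h1 : HasDerivWithinAt (fun s => P i (4 * s - i)) ((4 : ℝ) • (a i • d i,
      -(F.connCoeff p (P i (4 * t - i)).1 (P i (4 * t - i)).2 (a i • d i)))) J t := by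
    have e1 := IsFlowFor.hasDerivWithinAt_horizField F p (h.flow i) (h.horiz i) (h.time i)
      (fun s hs => h.polygonLeg_mem hv i hs) (hmaps ht)
    have e2 : HasDerivWithinAt (fun s : ℝ => 4 * s - i) 4 J t := by
      simpa using (((hasDerivAt_id t).const_mul 4).sub_const (i : ℝ)).hasDerivWithinAt
    exact HasDerivWithinAt.scomp t e1 e2 hmaps
  have h2 : HasDerivWithinAt
      (fun s => inducedChart n p ((inducedChart n p).symm (concat P s))) ((4 : ℝ) • (a i • d i,
      -(F.connCoeff p (P i (4 * t - i)).1 (P i (4 * t - i)).2 (a i • d i)))) J t :=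
    h1.congr hchart (hchart t ht)
  have hfst := (ContinuousLinearMap.fst ℝ (Model n) (Model n)).hasFDerivAt.comp_hasDerivWithinAt
    t h2
  have hsnd := (ContinuousLinearMap.snd ℝ (Model n) (Model n)).hasFDerivAt.comp_hasDerivWithinAt
    t h2
  have hu : UniqueDiffWithinAt ℝ J t := by
    refine uniqueDiffOn_Icc ?_ t ht
    push_cast
    linarith
  have hder := hfst.derivWithin hu
  refine HasDerivWithinAt.congr_deriv hsnd ?_
  change _ = -(F.connCoeff p _ _ (derivWithin (⇑(ContinuousLinearMap.fst ℝ (Model n) (Model n)) ∘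
    fun s => inducedChart n p ((inducedChart n p).symm (concat P s))) J t))
  rw [hder, hchart t ht]
  simp

theorem isLoopTranslation [Nonempty (F.indicatrix p)]
    (h : F.IsHorizontalPolygon p X d Γ a N ε C δ) (r : ℕ∞)
    {φ : F.indicatrix p → F.indicatrix p}
    (hφ : ∀ v : F.indicatrix p,
      (φ v).1 = (polygonPt Γ a (extChartAt (𝓡 n) p p, v.1) 4).2) :
    F.IsLoopTranslation p r φ := by
  set x₀ := extChartAt (𝓡 n) p p with hx₀
  let Q : ℕ → ℝ → Model n := fun i s =>
    (x₀ + ∑ j ∈ Finset.range i, a j • d j) + s • a i • d i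
  have hQ : ∀ i, Q i 1 = Q (i + 1) 0 := by
    intro i
    simp [Q, Finset.sum_range_succ, add_assoc]
  -- At time `1` the floor is `4`, so the path ends at the start of leg `4`. This is why the polygon
  -- has sides for every index and not only for the first four.
  have hc0 : ∀ {E : Type} (P : ℕ → ℝ → E), concat P 0 = P 0 0 := fun P => by simp [concat]
  have hc1 : ∀ {E : Type} (P : ℕ → ℝ → E), concat P 1 = P 4 0 := fun P => by
    simp [concat]
  have hQ0 : concat Q 0 = x₀ := by simp [hc0, Q]
  have hQ1 : concat Q 1 = x₀ := by
    rw [hc1]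
    simp only [Q, h.closed]
    simp
  have hsymm : (extChartAt (𝓡 n) p).symm x₀ = p := extChartAt_to_inv p
  refine ⟨fun s => (extChartAt (𝓡 n) p).symm (concat Q s), 4, fun i => (i : ℝ) / 4, ?_, ?_, ?_,
    by simp, by norm_num, ?_, fun v => ?_⟩
  · change (extChartAt (𝓡 n) p).symm (concat Q 0) = p
    rw [hQ0, hsymm]
  · change (extChartAt (𝓡 n) p).symm (concat Q 1) = p
    rw [hQ1, hsymm]
  · intro i j hij
    have : (i : ℝ) ≤ j := by exact_mod_cast hij
    change (i : ℝ) / 4 ≤ j / 4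
    linarith
  · intro i _
    -- The lift of any one vector shows that the base polygon stays in the chart domain.
    obtain ⟨v⟩ := ‹Nonempty (F.indicatrix p)›
    have hmaps : MapsTo (fun s : ℝ => 4 * s - i) (Icc ((i : ℝ) / 4) (((i + 1 : ℕ) : ℝ) / 4))
        (Icc 0 1) := by
      intro s hs
      push_cast at hs
      constructor <;> linarith [hs.1, hs.2]
    have hsm : ContMDiffOn 𝓘(ℝ) (𝓡 n) r
        (fun s => (extChartAt (𝓡 n) p).symm (Q i (4 * s - i)))
        (Icc ((i : ℝ) / 4) (((i + 1 : ℕ) : ℝ) / 4)) := by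
      have e1 : ContDiff ℝ r (fun s : ℝ => Q i (4 * s - i)) := by
        simp only [Q]
        fun_prop
      refine ((contMDiffOn_extChartAt_symm (n := ∞) p).of_le
        (by exact_mod_cast (le_top : r ≤ ⊤))).comp e1.contMDiff.contMDiffOn fun s hs => ?_
      have e2 := h.subset (h.polygonLeg_mem v.2 i (hmaps hs))
      have e3 := e2.1
      rw [h.polygonLeg_fst v.2 i (hmaps hs)] at e3
      exact e3
    exact hsm.congr fun s hs => by rw [concat_eq hQ hs]
  · set P := polygonLeg Γ a (x₀, v.1) with hPdef
    refine ⟨fun s => (inducedChart n p).symm (concat P s), fun t ht => ?_, ?_, ?_,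
      fun i _ => h.isParallelOn v.2 i⟩
    · have e1 : (concat P t).1 = concat Q t :=
        concat_map (fun i s hs => h.polygonLeg_fst v.2 i hs) ht.1
      have e2 : concat P t ∈ slitDomain p := by
        refine h.subset (h.polygonLeg_mem v.2 _ ⟨?_, ?_⟩)
        · linarith [Nat.floor_le (show 0 ≤ 4 * t by linarith [ht.1])]
        · linarith [Nat.lt_floor_add_one (4 * t)]
      change ((inducedChart n p).symm ((concat P t).1, (concat P t).2)).proj = _
      rw [inducedChart_symm_apply p e2.1]
      exact congrArg (extChartAt (𝓡 n) p).symm e1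
    · change (inducedChart n p).symm (concat P 0) = _
      rw [hc0, hPdef, h.polygonLeg_zero]
      exact inducedChart_symm_self p v.1
    · change (inducedChart n p).symm (concat P 1) = _
      rw [hc1, hPdef, h.polygonLeg_zero, hφ, ← inducedChart_symm_self]
      congr 1
      exact Prod.ext (h.polygonPt_four_fst v.2) rfl

end IsHorizontalPolygon

end FinslerMetric

end FinslerHolonomy

end

/-! ### Parallelogram holonomies and tangency of the curvature fields -/

section

namespace FinslerHolonomy

open Filter Topology Set

theorem IsFlowFor.mono {E : Type} [NormedAddCommGroup E] [NormedSpace ℝ E] {X : E → E} {ε ε' : ℝ}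
    {Γ : ℝ → E → ℝ → E} (h : IsFlowFor X ε Γ) (hε : ε' ≤ ε) : IsFlowFor X ε' Γ := by
  have hsub : Ioo (-ε') ε' ⊆ Ioo (-ε) ε := Ioo_subset_Ioo (by linarith) hε
  exact ⟨h.contDiffOn.mono (prod_mono hsub le_rfl), fun t ht => h.apply_zero t (hsub ht),
    fun t ht => h.hasDerivWithinAt t (hsub ht), fun t ht => h.unique t (hsub ht)⟩

/-- The sequence `x, y, x, y, …`. -/
def alternate {α : Type*} (x y : α) (i : ℕ) : α := if Even i then x else y

/-- The sequence `-t, -t, t, t, 0, 0, …`. -/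
def loopTime (t : ℝ) (i : ℕ) : ℝ := if i < 2 then -t else if i < 4 then t else 0

theorem polygonPt_four {E : Type*} (Γ₁ Γ₂ : ℝ → E → ℝ → E) (t : ℝ) (z : E) :
    polygonPt (alternate Γ₁ Γ₂) (loopTime t) z 4 = loopMap Γ₁ Γ₂ t z := by
  simp [polygonPt, loopMap, alternate, loopTime, show ¬ Even 1 by decide, show Even 2 by decide,
    show ¬ Even 3 by decide]

theorem abs_loopTime_le (t : ℝ) (i : ℕ) : |loopTime t i| ≤ |t| := by
  unfold loopTime
  split_ifs <;> simp

theorem sum_abs_loopTime_le (t : ℝ) (i : ℕ) :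
    ∑ j ∈ Finset.range i, |loopTime t j| ≤ 4 * |t| := by
  calc ∑ j ∈ Finset.range i, |loopTime t j| ≤ ∑ j ∈ Finset.range (4 + i), |loopTime t j| :=
        Finset.sum_le_sum_of_subset_of_nonneg (Finset.range_mono (by omega))
          fun _ _ _ => abs_nonneg _
    _ = ∑ j ∈ Finset.range 4, |loopTime t j| := by
        rw [Finset.sum_range_add, add_eq_left]
        exact Finset.sum_eq_zero fun j _ => by
          rw [loopTime, if_neg (by omega), if_neg (by omega), abs_zero]
    _ ≤ _ := (Finset.sum_le_sum fun j _ => abs_loopTime_le t j).trans (by simp)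

namespace FinslerMetric

variable {n : ℕ} {M : Type*} [TopologicalSpace M] [ChartedSpace (EuclideanSpace ℝ (Fin n)) M]
  [IsManifold (𝓡 n) ∞ M] (F : FinslerMetric n M) (p : M)

/-- By homogeneity, the positive minimum of the norm on the Euclidean unit sphere bounds the
indicatrix. -/
theorem isCompact_indicatrix : IsCompact (F.indicatrix p) := by
  have hcont : Continuous (F.normAt p) :=
    F.continuous.comp (FiberBundle.continuous_totalSpaceMk (EuclideanSpace ℝ (Fin n))
      (TangentSpace (𝓡 n)) p)
  have hunit : ∀ v : Model n, v ≠ 0 → ‖v‖⁻¹ • v ∈ Metric.sphere (0 : Model n) 1 := by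
    intro v hv
    rw [mem_sphere_zero_iff_norm, norm_smul, norm_inv, norm_norm,
      inv_mul_cancel₀ (norm_ne_zero_iff.2 hv)]
  refine Metric.isCompact_of_isClosed_isBounded (isClosed_eq hcont continuous_const) ?_
  rcases (F.indicatrix p).eq_empty_or_nonempty with h | ⟨v₀, hv₀⟩
  · rw [h]; exact Bornology.isBounded_empty
  obtain ⟨y, hy, hmin⟩ := (isCompact_sphere (0 : Model n) 1).exists_isMinOn
    ⟨_, hunit v₀ (F.ne_zero_of_mem hv₀)⟩ hcont.continuousOn
  have hy0 : y ≠ 0 := by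
    rintro rfl
    simp at hy
  refine isBounded_iff_forall_norm_le.2 ⟨(F.normAt p y)⁻¹, fun v hv => ?_⟩
  have hv0 := F.ne_zero_of_mem hv
  have hpos := norm_pos_iff.2 hv0
  have h1 : F.normAt p y ≤ F.normAt p (‖v‖⁻¹ • v) := hmin (hunit v hv0)
  rw [F.normAt_smul p v (inv_pos.2 hpos), show F.normAt p v = 1 from hv, mul_one] at h1
  exact (le_inv_comm₀ (F.normAt_pos p hy0) hpos).1 h1

/-- `Γ` is the flow of a bounded vector field `X` that is the horizontal lift of the constant field
`d` on a `δ`-neighbourhood `N` of the indicatrix. -/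
structure IsHorizontalFlow (X : Model n × Model n → Model n × Model n) (d : Model n)
    (Γ : ℝ → Model n × Model n → ℝ → Model n × Model n) (N : Set (Model n × Model n))
    (ε C δ : ℝ) : Prop where
  continuous : Continuous X
  flow : IsFlowFor X ε Γ
  bound : ∀ z, ‖X z‖ ≤ C
  horiz : ∀ y ∈ N, X y = F.horizField p d y
  subset : N ⊆ slitDomain p
  stay : ∀ v ∈ F.indicatrix p, ∀ y, ‖y - (extChartAt (𝓡 n) p p, v)‖ < δ → y ∈ N
  lt : 4 * ε * C < δ

theorem exists_isHorizontalFlow (u w : Model n) : ∃ X₁ X₂ Γ₁ Γ₂ N ε C δ, 0 < ε ∧ 0 < δ ∧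
    F.IsHorizontalFlow p X₁ u Γ₁ N ε C δ ∧ F.IsHorizontalFlow p X₂ w Γ₂ N ε C δ := by
  have hK : IsCompact (({extChartAt (𝓡 n) p p} : Set (Model n)) ×ˢ F.indicatrix p) :=
    isCompact_singleton.prod (F.isCompact_indicatrix p)
  have hKU : ({extChartAt (𝓡 n) p p} : Set (Model n)) ×ˢ F.indicatrix p ⊆ slitDomain p := by
    rintro ⟨x, v⟩ ⟨rfl, hv⟩
    exact mem_slitDomain_self p (F.ne_zero_of_mem hv)
  obtain ⟨χ, hχ, hcomp, hsupp, h1⟩ := exists_contDiff_cutoff hK (isOpen_slitDomain p) hKU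
  obtain ⟨N, hN, hKN, hN1⟩ := eventually_nhdsSet_iff_exists.1
    (h1.and ((isOpen_slitDomain p).mem_nhdsSet.2 hKU))
  obtain ⟨δ, hδ, hthick⟩ := hK.exists_thickening_subset_open hN hKN
  -- The cutoff makes the lifts globally smooth with compact support, hence bounded and Lipschitz,
  -- as the global flow construction demands; they are unchanged on `N`.
  have hsm : ∀ d, ContDiff ℝ ∞ fun z => χ z • F.horizField p d z := fun d =>
    contDiff_smul_of_tsupport_subset hχ (isOpen_slitDomain p) hsupp
      fun z hz => (F.contDiffAt_horizField p hz d).contDiffWithinAt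
  have hcs : ∀ d, HasCompactSupport fun z => χ z • F.horizField p d z := fun d => hcomp.smul_right
  have hflow : ∀ d, ∃ ε : ℝ, 0 < ε ∧ ∃ Γ, IsFlowFor (fun z => χ z • F.horizField p d z) ε Γ :=
    fun d => by
      obtain ⟨L, hL⟩ := ContDiff.lipschitzWith_of_hasCompactSupport (hcs d) (hsm d) (by simp)
      exact exists_isFlowFor (hsm d) hL
  have hbound : ∀ d, ∃ C, ∀ z, ‖χ z • F.horizField p d z‖ ≤ C := fun d =>
    (hsm d).continuous.bounded_above_of_compact_support (hcs d)
  obtain ⟨ε₁, hε₁, Γ₁, hΓ₁⟩ := hflow u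
  obtain ⟨ε₂, hε₂, Γ₂, hΓ₂⟩ := hflow w
  obtain ⟨C₁, hC₁⟩ := hbound u
  obtain ⟨C₂, hC₂⟩ := hbound w
  set C := max C₁ C₂
  have hC0 : 0 ≤ C := (norm_nonneg _).trans ((hC₁ 0).trans (le_max_left _ _))
  -- Four sides of duration below `ε` and speed at most `C` must stay within `δ`. The `C + 1` avoids
  -- division by zero, and halving makes the bound strict.
  set ε := min (min ε₁ ε₂) (δ / (4 * (C + 1)) / 2)
  have hε : 0 < ε := lt_min (lt_min hε₁ hε₂) (by positivity)
  have hlt : 4 * ε * C < δ := by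
    have h2 : ε ≤ δ / (4 * (C + 1)) / 2 := min_le_right _ _
    have h3 : ε * (4 * (C + 1)) ≤ δ / 2 := by
      calc ε * (4 * (C + 1)) ≤ δ / (4 * (C + 1)) / 2 * (4 * (C + 1)) := by gcongr
        _ = δ / 2 := by field_simp
    nlinarith
  have hstay : ∀ v ∈ F.indicatrix p, ∀ y, ‖y - (extChartAt (𝓡 n) p p, v)‖ < δ → y ∈ N :=
    fun v hv y hy => hthick (Metric.mem_thickening_iff.2
      ⟨(extChartAt (𝓡 n) p p, v), ⟨rfl, hv⟩, by rwa [dist_eq_norm]⟩)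
  refine ⟨_, _, Γ₁, Γ₂, N, ε, C, δ, hε, hδ,
    ⟨(hsm u).continuous, hΓ₁.mono ((min_le_left _ _).trans (min_le_left _ _)),
      fun z => (hC₁ z).trans (le_max_left _ _), fun y hy => ?_, fun y hy => (hN1 y hy).2, hstay,
      hlt⟩,
    ⟨(hsm w).continuous, hΓ₂.mono ((min_le_left _ _).trans (min_le_right _ _)),
      fun z => (hC₂ z).trans (le_max_right _ _), fun y hy => ?_, fun y hy => (hN1 y hy).2, hstay,
      hlt⟩⟩
  · rw [(hN1 y hy).1, one_smul]
  · rw [(hN1 y hy).1, one_smul]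

namespace IsHorizontalFlow

variable {F p} {X₁ X₂ : Model n × Model n → Model n × Model n} {u w : Model n}
  {Γ₁ Γ₂ : ℝ → Model n × Model n → ℝ → Model n × Model n}
  {N : Set (Model n × Model n)} {ε C δ t : ℝ}

theorem isHorizontalPolygon (h₁ : F.IsHorizontalFlow p X₁ u Γ₁ N ε C δ)
    (h₂ : F.IsHorizontalFlow p X₂ w Γ₂ N ε C δ) (ht : t ∈ Ioo (-ε) ε) :
    F.IsHorizontalPolygon p (alternate X₁ X₂) (alternate u w) (alternate Γ₁ Γ₂) (loopTime t)
      N ε C δ where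
  flow i := by
    unfold alternate
    split_ifs
    exacts [h₁.flow, h₂.flow]
  time i := by
    rw [mem_Ioo, ← abs_lt] at ht ⊢
    exact (abs_loopTime_le t i).trans_lt ht
  bound i := by
    unfold alternate
    split_ifs
    exacts [h₁.bound, h₂.bound]
  horiz i := by
    unfold alternate
    split_ifs
    exacts [h₁.horiz, h₂.horiz]
  subset := h₁.subset
  stay := h₁.stay
  sum_lt i := by
    have hC0 : 0 ≤ C := (norm_nonneg _).trans (h₁.bound 0)
    refine lt_of_le_of_lt ?_ h₁.lt
    gcongr
    exact (sum_abs_loopTime_le t i).trans (by gcongr; exact (abs_lt.2 ht).le)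
  closed := by
    simp [Finset.sum_range_succ, alternate, loopTime, show ¬ Even 1 by decide,
      show Even 2 by decide, show ¬ Even 3 by decide]

/-- The displacements `-t • u`, `-t • w`, `t • u`, `t • w` of the base point sum to zero. -/
theorem loopMap_fst (h₁ : F.IsHorizontalFlow p X₁ u Γ₁ N ε C δ)
    (h₂ : F.IsHorizontalFlow p X₂ w Γ₂ N ε C δ) (ht : t ∈ Ioo (-ε) ε) (v : F.indicatrix p) :
    (loopMap Γ₁ Γ₂ t (extChartAt (𝓡 n) p p, v.1)).1 = extChartAt (𝓡 n) p p := by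
  rw [← polygonPt_four]
  exact (h₁.isHorizontalPolygon h₂ ht).polygonPt_four_fst v.2

theorem loopMap_snd_mem (h₁ : F.IsHorizontalFlow p X₁ u Γ₁ N ε C δ)
    (h₂ : F.IsHorizontalFlow p X₂ w Γ₂ N ε C δ) (ht : t ∈ Ioo (-ε) ε) (v : F.indicatrix p) :
    (loopMap Γ₁ Γ₂ t (extChartAt (𝓡 n) p p, v.1)).2 ∈ F.indicatrix p := by
  rw [← polygonPt_four]
  exact (h₁.isHorizontalPolygon h₂ ht).polygonPt_four_snd_mem v.2

/-- The parallel translation along a small coordinate parallelogram. -/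
def loopFun (h₁ : F.IsHorizontalFlow p X₁ u Γ₁ N ε C δ)
    (h₂ : F.IsHorizontalFlow p X₂ w Γ₂ N ε C δ) (ht : t ∈ Ioo (-ε) ε) (v : F.indicatrix p) :
    F.indicatrix p := ⟨_, loopMap_snd_mem h₁ h₂ ht v⟩

theorem loopFun_loopFun (h₁ : F.IsHorizontalFlow p X₁ u Γ₁ N ε C δ)
    (h₂ : F.IsHorizontalFlow p X₂ w Γ₂ N ε C δ) (ht : t ∈ Ioo (-ε) ε) (v : F.indicatrix p) :
    loopFun h₂ h₁ ht (loopFun h₁ h₂ ht v) = v := by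
  apply Subtype.ext
  have e : (extChartAt (𝓡 n) p p, (loopMap Γ₁ Γ₂ t (extChartAt (𝓡 n) p p, v.1)).2) =
      loopMap Γ₁ Γ₂ t (extChartAt (𝓡 n) p p, v.1) :=
    Prod.ext (loopMap_fst h₁ h₂ ht v).symm rfl
  change (loopMap Γ₂ Γ₁ t (extChartAt (𝓡 n) p p,
    (loopMap Γ₁ Γ₂ t (extChartAt (𝓡 n) p p, v.1)).2)).2 = v.1
  rw [e, loopMap_loopMap h₁.flow h₂.flow ht]

theorem contDiffOn_loopMap_snd (h₁ : F.IsHorizontalFlow p X₁ u Γ₁ N ε C δ)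
    (h₂ : F.IsHorizontalFlow p X₂ w Γ₂ N ε C δ) :
    ContDiffOn ℝ ∞
      (fun x : ℝ × Model n => (loopMap Γ₁ Γ₂ x.1 (extChartAt (𝓡 n) p p, x.2)).2)
      (Ioo (-ε) ε ×ˢ univ) := by
  have h : ContDiffOn ℝ ∞ (fun x : ℝ × Model n => (x.1, (extChartAt (𝓡 n) p p, x.2)))
      (Ioo (-ε) ε ×ˢ univ) := by fun_prop
  exact ((contDiffOn_loopMap h₁.flow h₂.flow).comp h fun x hx => ⟨hx.1, trivial⟩).snd

theorem smoothAlong_loopFun (h₁ : F.IsHorizontalFlow p X₁ u Γ₁ N ε C δ)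
    (h₂ : F.IsHorizontalFlow p X₂ w Γ₂ N ε C δ) (ht : t ∈ Ioo (-ε) ε) :
    SmoothAlong (Subtype.val : F.indicatrix p → Model n) fun v => (loopFun h₁ h₂ ht v : Model n) :=
  fun _ => ⟨univ, isOpen_univ, trivial, _, (contDiffOn_loopMap_snd h₁ h₂).comp
    (f := fun v : Model n => (t, v)) (by fun_prop) fun _ _ => ⟨ht, trivial⟩, fun _ _ => rfl⟩

/-- The parallel translation along a small coordinate parallelogram, as a diffeomorphism. -/
def loopDiffeo (h₁ : F.IsHorizontalFlow p X₁ u Γ₁ N ε C δ)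
    (h₂ : F.IsHorizontalFlow p X₂ w Γ₂ N ε C δ) (ht : t ∈ Ioo (-ε) ε) :
    diffGroup (F.indicatrix p) :=
  ⟨⟨loopFun h₁ h₂ ht, loopFun h₂ h₁ ht, loopFun_loopFun h₁ h₂ ht, loopFun_loopFun h₂ h₁ ht⟩,
    smoothAlong_loopFun h₁ h₂ ht, smoothAlong_loopFun h₂ h₁ ht⟩

theorem loopDiffeo_mem [Nonempty (F.indicatrix p)] (h₁ : F.IsHorizontalFlow p X₁ u Γ₁ N ε C δ)
    (h₂ : F.IsHorizontalFlow p X₂ w Γ₂ N ε C δ) (ht : t ∈ Ioo (-ε) ε) (r : ℕ∞) :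
    loopDiffeo h₁ h₂ ht ∈ F.holonomyGroup p r := by
  refine Subgroup.subset_closure ((h₁.isHorizontalPolygon h₂ ht).isLoopTranslation r fun v => ?_)
  rw [polygonPt_four]
  rfl

theorem eventuallyEq (h : F.IsHorizontalFlow p X₁ u Γ₁ N ε C δ) (hδ : 0 < δ)
    (v : F.indicatrix p) :
    X₁ =ᶠ[𝓝 (extChartAt (𝓡 n) p p, v.1)] F.horizField p u := by
  filter_upwards [Metric.ball_mem_nhds _ hδ] with y hy
  exact h.horiz y (h.stay v v.2 y (by rwa [← dist_eq_norm]))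

open Classical in
theorem hasTangentCurve_curvature [Nonempty (F.indicatrix p)]
    (h₁ : F.IsHorizontalFlow p X₁ u Γ₁ N ε C δ) (h₂ : F.IsHorizontalFlow p X₂ w Γ₂ N ε C δ)
    (hε : 0 < ε) (hδ : 0 < δ) (r : ℕ∞) :
    F.HasTangentCurve (F.holonomyGroup p r) (fun v => F.curvature p u w v) 2 := by
  set φ : ℝ → diffGroup (F.indicatrix p) := fun t =>
    if ht : t ∈ Ioo (-ε) ε then loopDiffeo h₁ h₂ ht else 1 with hφ
  have hφt : ∀ t ∈ Ioo (-ε) ε, ∀ v : F.indicatrix p, ((φ t : Equiv.Perm (F.indicatrix p)) v).1 =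
      (loopMap Γ₁ Γ₂ t (extChartAt (𝓡 n) p p, v.1)).2 := fun t ht v => by
    simp only [hφ, dif_pos ht]
    rfl
  have h0 : (0 : ℝ) ∈ Ioo (-ε) ε := ⟨by linarith, hε⟩
  refine ⟨ε, hε, φ, F.isSmoothCurveIn_of_contDiffOn (fun t ht => ?_)
    (isOpen_Ioo.prod isOpen_univ) (contDiffOn_loopMap_snd h₁ h₂) (fun t ht v => ⟨ht, trivial⟩)
    hφt, ?_, fun v => ?_⟩
  · simp only [hφ, dif_pos ht]
    exact loopDiffeo_mem h₁ h₂ ht r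
  · apply Subtype.ext
    ext1 v
    apply Subtype.ext
    rw [hφt 0 h0, loopMap_zero hε h₁.flow h₂.flow]
    rfl
  · have hlim := tendsto_loopMap hε h₁.flow h₂.flow h₁.continuous h₂.continuous h₁.bound h₂.bound
      (extChartAt (𝓡 n) p p, v.1)
    -- The cut-off fields agree with the horizontal lifts near the indicatrix, so the brackets
    -- coincide there.
    rw [(h₁.eventuallyEq hδ v).lieBracket_vectorField_eq (h₂.eventuallyEq hδ v)] at hlim
    have hlim2 := (continuous_snd.tendsto _).comp hlim
    rw [← F.curvature_eq] at hlim2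
    refine hlim2.congr' ?_
    filter_upwards [nhdsWithin_le_nhds (Ioo_mem_nhds h0.1 h0.2)] with t ht
    rw [hφt t ht]
    rfl

end IsHorizontalFlow

theorem isTangentTo_curvature (u w : Model n) (r : ℕ∞) :
    IsTangentTo (F.holonomyGroup p r) fun v => F.curvature p u w v := by
  rcases isEmpty_or_nonempty (F.indicatrix p) with h | h
  -- An empty indicatrix (dimension zero) leaves only the zero field.
  · have h0 := (F.tangentAlgebra (F.holonomyGroup p r)).zero_mem
    convert (show IsTangentTo (F.holonomyGroup p r) (0 : F.vectorFields p).1 from h0)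
  · obtain ⟨X₁, X₂, Γ₁, Γ₂, N, ε, C, δ, hε, hδ, h₁, h₂⟩ := F.exists_isHorizontalFlow p u w
    exact F.isTangentTo_iff.2 ⟨2, by norm_num, h₁.hasTangentCurve_curvature h₂ hε hδ r⟩

end FinslerMetric

end FinslerHolonomy

end

end

/-! ### The curvature algebra inside the holonomy algebra -/

theorem mainTheorem10 {n : ℕ} {M : Type*} [TopologicalSpace M]
    [ChartedSpace (EuclideanSpace ℝ (Fin n)) M] [IsManifold (𝓡 n) ∞ M]
    (F : FinslerHolonomy.FinslerMetric n M) (p : M) (r : ℕ∞) (hr : 1 ≤ r) :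
    (∀ u w : TangentSpace (𝓡 n) p, ∃ ξ : F.vectorFields p,
      (∀ v : F.indicatrix p, ξ.1 v = F.curvature p u w v) ∧ ξ ∈ F.holonomyAlgebra p r) ∧
    (∀ ξ ∈ F.curvatureAlgebra p,
      FinslerHolonomy.IsTangentTo (F.holonomyGroup p r) ξ.1) ∧
    ∃ 𝔥 : LieSubalgebra ℝ (F.vectorFields p),
      (𝔥 : Set (F.vectorFields p)) = F.holonomyAlgebra p r ∧ F.curvatureAlgebra p ≤ 𝔥 := by
  -- The tangent fields already form a Lie subalgebra, so containment need only be checked on the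
  -- generating curvature fields.
  have hle : F.curvatureAlgebra p ≤ F.tangentAlgebra (F.holonomyGroup p r) := by
    refine LieSubalgebra.lieSpan_le.2 ?_
    rintro ξ ⟨u, w, hξ⟩
    have h : ξ.1 = fun v : F.indicatrix p => F.curvature p u w v := funext hξ
    change FinslerHolonomy.IsTangentTo (F.holonomyGroup p r) ξ.1
    rw [h]
    exact F.isTangentTo_curvature p u w r
  exact ⟨fun u w => ⟨⟨_, F.curvature_mem p u w⟩, fun _ => rfl, F.isTangentTo_curvature p u w r⟩,
    fun ξ hξ => hle hξ, _, rfl, hle⟩
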